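/- **Setting.** Let $\Omega=(0,L_1)\times(0,L_2)$, let $\|\cdot\|$ and $\langle\cdot,\cdot\rangle$ be the norm and inner product of $L^2(\Omega)$ (the latter also denotes the duality pairing of $H^{-2}_{per}$ and $H^2_{per}$), and let $H^m_{per}(\Omega)$ be the $\Omega$-periodic Sobolev space with $\|u\|_{H^m}^2=\sum_{|a|\le m}\|\partial^a u\|^2$; $H^{-2}_{per}(\Omega)$ is the dual of $H^2_{per}(\Omega)$. Let $\alpha>0$, $0<p<q$, $\gamma\ge 0$, $\varepsilon>0$, and let $(\Phi,G)$ be one of $$\Phi_1(s)=\frac{\alpha(q-p)}{(p+s)(q+s)},\quad G_1(m)=\alpha\bigl(p\ln(p+|m|)-q\ln(q+|m|)\bigr),$$ $$\Phi_2(s)=\frac{\alpha}{q+(p+q)s/p},\quad G_2(m)=\alpha\Bigl(-\tfrac{p}{p+q}|m|+\tfrac{p^2q}{(p+q)^2}\ln\bigl(\tfrac{pq}{p+q}+|m|\bigr)\Bigr)\qquad(m\in\mathbb R^2).$$ Let $\chi\ge 2\alpha\frac{q-p}{pq}$ in the first case and $\chi\ge 0$ in the second, and put $G_+(m)=\frac{1}{2}\chi|m|^2$,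 $G_-=G-G_+$, $$a(h,\phi)=\gamma\langle\nabla h,\nabla\phi\rangle+\varepsilon^2\langle\Delta h,\Delta\phi\rangle-\langle\Phi(|\nabla h|)\nabla h,\nabla\phi\rangle,$$ $$a_+(h,\phi)=\gamma\langle\nabla h,\nabla\phi\rangle+\varepsilon^2\langle\Delta h,\Delta\phi\rangle+\langle(\nabla G_+)(\nabla h),\nabla\phi\rangle,\qquad a_-(h,\phi)=\langle(\nabla G_-)(\nabla h),\nabla\phi\rangle.$$ Let $T>0$, let $h_0\in H^2_{per}(\Omega)$ have mean value zero, and let $\zeta\in L^2(0,T;L^2(\Omega))$ have mean value zero on $\Omega$ for almost every $t$. A weak solution is a function $h\in L^2(0,T;H^2_{per}(\Omega))$ with $\partial_t h\in L^2(0,T;H^{-2}_{per}(\Omega))$, identified with its representative in $C([0,T];L^2(\Omega))$, such that $h(0)=h_0$ and, for a.e. $t\in(0,T)$, $\langle\partial_t h,\phi\rangle+a(h,\phi)=\langle\zeta,\phi\rangle$ for all $\phi\in H^2_{per}(\Omega)$. **Scheme.** For $N\ge1$ let $H_N\subset L^2(\Omega)$ be the span of the functions $\cos(\xi\cdot\tilde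 x)$ and $\sin(\xi\cdot\tilde x)$, where $\xi\in\mathbb Z^2$, $|\xi_1|,|\xi_2|\le N$, $\tilde x=2\pi(x_1/L_1,x_2/L_2)$, and let $P_N$ be the $L^2$-projection onto $H_N$. Let $M\ge1$, $\delta t=T/M$, $t_i=i\,\delta t$. Put $h_N^0=P_Nh_0$ and, for $i\ge 1$, let $h_N^i\in H_N$ satisfy $$\Bigl\langle\frac{h_N^i-h_N^{i-1}}{\delta t},\phi\Bigr\rangle+a_+(h_N^i,\phi)=\langle\zeta^i,\phi\rangle-a_-(h_N^{i-1},\phi)\qquad\text{for all }\phi\in H_N .$$ **Theorem (error estimate).** Let $1\le n\le M$ and let $m_1,m_2\ge2$ be integers. Let $h$ be a weak solution with $h_{tt}\in L^2(0,t_n;L^2(\Omega))$, $h_t\in L^2(0,t_n;H^{m_1}_{per}(\Omega))$ and $h\in L^\infty(0,t_{n-1};H^{m_2}_{per}(\Omega))$, where for $n=1$ the last condition is read as $h_0\in H^{m_2}_{per}(\Omega)$ (with the norm $\|h_0\|_{H^{m_2}}$). Let $\zeta^i\in H^{-2}_{per}(\Omega)$ be the value at $t_i$ of the representative of $\zeta$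 in $C([0,t_n];H^{-2}_{per}(\Omega))$, which exists under these assumptions. Then $$\|h(t_i)-h_N^i\|\le C e^{Ct_n}\bigl(\delta t+N^{-m_1}+N^{-(m_2-1)}\bigr)\qquad\text{for all }0\le i\le n,$$ where $C>0$ depends only on $L_1,L_2$, the choice of model, $\alpha,p,q,\chi,\gamma,\varepsilon$, $m_1,m_2$ and an upper bound $R$ of the norms of $h_{tt}$, $h_t$ and $h$ in the three spaces above; in particular it does not depend on $T$, $M$ (that is, $\delta t$), $N$ or $n$. -/

import Mathlib

open MeasureTheory Set
open scoped ENNReal ContDiff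

noncomputable section

namespace ThinFilm

/-! ### The periodic cell and periodic Sobolev spaces -/

/-- The open rectangle `Ω = (0, L₁) × (0, L₂)`. -/
def cell (L : Fin 2 → ℝ) : Set (Fin 2 → ℝ) := Set.pi univ fun j => Ioo 0 (L j)

/-- Lebesgue measure on `Ω`. -/
abbrev cellMeasure (L : Fin 2 → ℝ) : Measure (Fin 2 → ℝ) := volume.restrict (cell L)

instance (L : Fin 2 → ℝ) : IsFiniteMeasure (cellMeasure L) := by
  refine ⟨?_⟩
  rw [Measure.restrict_apply_univ, cell, Real.volume_pi_Ioo]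
  exact ENNReal.prod_lt_top fun _ _ => ENNReal.ofReal_lt_top

/-- The real Hilbert space `L²(Ω)`. -/
abbrev L2 (L : Fin 2 → ℝ) : Type := Lp ℝ 2 (cellMeasure L)

/-- The classical partial derivative in direction `x_j`. -/
def pd (j : Fin 2) (f : (Fin 2 → ℝ) → ℝ) : (Fin 2 → ℝ) → ℝ :=
  fun x => fderiv ℝ f x (Pi.single j 1)

/-- The classical mixed derivative `∂₁^a ∂₂^b f`. -/
def mixedDeriv (α : ℕ × ℕ) (f : (Fin 2 → ℝ) → ℝ) : (Fin 2 → ℝ) → ℝ :=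
  (pd 0)^[α.1] ((pd 1)^[α.2] f)

/-- Smooth `Ω`-periodic functions on the plane. -/
def IsPeriodicTest (L : Fin 2 → ℝ) (φ : (Fin 2 → ℝ) → ℝ) : Prop :=
  ContDiff ℝ ∞ φ ∧ ∀ (j : Fin 2) (x : Fin 2 → ℝ), φ (x + Pi.single j (L j)) = φ x

/-- `g` is the weak periodic derivative `∂^α u`. -/
def IsWeakDeriv (L : Fin 2 → ℝ) (α : ℕ × ℕ) (u g : L2 L) : Prop :=
  ∀ φ : (Fin 2 → ℝ) → ℝ, IsPeriodicTest L φ →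
    ∫ x, u x * mixedDeriv α φ x ∂(cellMeasure L)
      = (-1) ^ (α.1 + α.2) * ∫ x, g x * φ x ∂(cellMeasure L)

theorem contDiff_pd (j : Fin 2) {f : (Fin 2 → ℝ) → ℝ} (hf : ContDiff ℝ ∞ f) :
    ContDiff ℝ ∞ (pd j f) :=
  (hf.fderiv_right (m := ∞) (by simp)).clm_apply contDiff_const

theorem contDiff_iterate_pd (j : Fin 2) (n : ℕ) {f : (Fin 2 → ℝ) → ℝ} (hf : ContDiff ℝ ∞ f) :
    ContDiff ℝ ∞ ((pd j)^[n] f) := by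
  induction n with
  | zero => simpa using hf
  | succ n ih =>
    rw [Function.iterate_succ_apply']
    exact contDiff_pd j ih

theorem contDiff_mixedDeriv (α : ℕ × ℕ) {f : (Fin 2 → ℝ) → ℝ} (hf : ContDiff ℝ ∞ f) :
    ContDiff ℝ ∞ (mixedDeriv α f) :=
  contDiff_iterate_pd 0 _ (contDiff_iterate_pd 1 _ hf)

theorem memLp_of_continuous (L : Fin 2 → ℝ) {f : (Fin 2 → ℝ) → ℝ} (hf : Continuous f) :
    MemLp f 2 (cellMeasure L) := by
  have hcomp : IsCompact (Set.pi univ fun j => Icc 0 (L j) : Set (Fin 2 → ℝ)) :=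
    isCompact_univ_pi fun _ => isCompact_Icc
  obtain ⟨K, hK⟩ := hcomp.exists_bound_of_continuousOn hf.continuousOn
  refine MemLp.of_bound hf.aestronglyMeasurable K ?_
  have hm : MeasurableSet (cell L) := MeasurableSet.univ_pi fun _ => measurableSet_Ioo
  filter_upwards [ae_restrict_mem hm] with x hx
  exact hK x fun j hj => Ioo_subset_Icc_self (hx j hj)

theorem integrable_mul_of_continuous (L : Fin 2 → ℝ) (u : L2 L) {f : (Fin 2 → ℝ) → ℝ}
    (hf : Continuous f) : Integrable (fun x => u x * f x) (cellMeasure L) :=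
  (Lp.memLp u).integrable_mul (memLp_of_continuous L hf)

theorem IsWeakDeriv.add {L : Fin 2 → ℝ} {α : ℕ × ℕ} {u v f g : L2 L}
    (hu : IsWeakDeriv L α u f) (hv : IsWeakDeriv L α v g) :
    IsWeakDeriv L α (u + v) (f + g) := by
  intro φ hφ
  have key : ∀ (a b : L2 L) (w : (Fin 2 → ℝ) → ℝ), Continuous w →
      ∫ x, (a + b : L2 L) x * w x ∂(cellMeasure L)
        = ∫ x, a x * w x ∂(cellMeasure L) + ∫ x, b x * w x ∂(cellMeasure L) := by
    intro a b w hw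
    rw [← integral_add (integrable_mul_of_continuous L a hw)
      (integrable_mul_of_continuous L b hw)]
    refine integral_congr_ae ?_
    filter_upwards [Lp.coeFn_add a b] with x hx
    rw [hx, Pi.add_apply, add_mul]
  rw [key _ _ _ (contDiff_mixedDeriv α hφ.1).continuous, key _ _ _ hφ.1.continuous,
    hu φ hφ, hv φ hφ]
  ring

theorem IsWeakDeriv.smul {L : Fin 2 → ℝ} {α : ℕ × ℕ} {u f : L2 L} (c : ℝ)
    (hu : IsWeakDeriv L α u f) : IsWeakDeriv L α (c • u) (c • f) := by
  intro φ hφ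
  have key : ∀ (a : L2 L) (w : (Fin 2 → ℝ) → ℝ),
      ∫ x, (c • a : L2 L) x * w x ∂(cellMeasure L)
        = c * ∫ x, a x * w x ∂(cellMeasure L) := by
    intro a w
    rw [← integral_const_mul]
    refine integral_congr_ae ?_
    filter_upwards [Lp.coeFn_smul c a] with x hx
    rw [hx, Pi.smul_apply, smul_eq_mul, mul_assoc]
  rw [key, key, hu φ hφ]
  ring

theorem IsWeakDeriv.zero {L : Fin 2 → ℝ} {α : ℕ × ℕ} : IsWeakDeriv L α 0 0 := by
  simpa using IsWeakDeriv.smul (L := L) (α := α) (u := 0) (f := 0) 0 (by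
    intro φ _
    have key : ∀ w : (Fin 2 → ℝ) → ℝ, ∫ x, (0 : L2 L) x * w x ∂(cellMeasure L) = 0 := by
      intro w
      rw [← integral_zero (Fin 2 → ℝ) ℝ (μ := cellMeasure L)]
      refine integral_congr_ae ?_
      filter_upwards [Lp.coeFn_zero ℝ 2 (cellMeasure L)] with x hx
      rw [hx, Pi.zero_apply, zero_mul]
    rw [key, key, mul_zero])

/-- Multi-indices `α = (a, b)` of order `a + b ≤ m`. -/
abbrev MultiIndex (m : ℕ) : Type := {α : ℕ × ℕ // α.1 + α.2 ≤ m}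

instance (m : ℕ) : Fintype (MultiIndex m) :=
  Fintype.subtype
    ((Finset.range (m + 1) ×ˢ Finset.range (m + 1)).filter fun α => α.1 + α.2 ≤ m) (by
      rintro ⟨a, b⟩
      simp only [Finset.mem_filter, Finset.mem_product, Finset.mem_range]
      omega)

/-- The periodic Sobolev space `H^m_per(Ω)`: an element is the family `(∂^α u)_{|α| ≤ m}` of the
weak derivatives of a function `u ∈ L²(Ω)` (which is the entry with `α = 0`); the inherited norm is
`‖u‖_{H^m}² = ∑_{|α| ≤ m} ‖∂^α u‖²`. -/
def sobolev (L : Fin 2 → ℝ) (m : ℕ) : Submodule ℝ (PiLp 2 fun _ : MultiIndex m => L2 L) where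
  carrier := {u | ∀ α : MultiIndex m, IsWeakDeriv L α.1 (u ⟨(0, 0), Nat.zero_le m⟩) (u α)}
  add_mem' := fun hu hv α => (hu α).add (hv α)
  zero_mem' := fun _ => IsWeakDeriv.zero
  smul_mem' := fun c _ hu α => (hu α).smul c

/-- `H^m_per(Ω)` as a type. -/
abbrev Sob (L : Fin 2 → ℝ) (m : ℕ) : Type := sobolev L m

/-- The weak derivative `∂^α u` of `u ∈ H^m_per(Ω)`, as a continuous linear map into `L²(Ω)`. -/
def weakDeriv (L : Fin 2 → ℝ) {m : ℕ} (α : MultiIndex m) : Sob L m →L[ℝ] L2 L :=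
  (PiLp.proj 2 (fun _ : MultiIndex m => L2 L) α).comp (sobolev L m).subtypeL

/-- The inclusion `H^m_per(Ω) → L²(Ω)`. -/
def toL2 (L : Fin 2 → ℝ) {m : ℕ} : Sob L m →L[ℝ] L2 L :=
  weakDeriv L ⟨(0, 0), Nat.zero_le m⟩

/-- The plane with its Euclidean norm, in which gradients take their values. -/
abbrev Plane : Type := EuclideanSpace ℝ (Fin 2)

/-- The weak gradient of `u ∈ H²_per(Ω)`. -/
def grad (L : Fin 2 → ℝ) (u : Sob L 2) (x : Fin 2 → ℝ) : Plane :=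
  !₂[weakDeriv L ⟨(1, 0), by decide⟩ u x, weakDeriv L ⟨(0, 1), by decide⟩ u x]

/-- The weak Laplacian of `u ∈ H²_per(Ω)`. -/
def lap (L : Fin 2 → ℝ) (u : Sob L 2) : L2 L :=
  weakDeriv L ⟨(2, 0), by decide⟩ u + weakDeriv L ⟨(0, 2), by decide⟩ u

/-- The dual space `H^{-2}_per(Ω)`. -/
abbrev SobDual (L : Fin 2 → ℝ) : Type := StrongDual ℝ (Sob L 2)

/-- The inclusion `L²(Ω) → H^{-2}_per(Ω)`, `u ↦ (φ ↦ ⟨u, φ⟩)`. -/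
def toDual (L : Fin 2 → ℝ) (u : L2 L) : SobDual L := (innerSL ℝ u).comp (toL2 L)

/-! ### Functions of time -/

/-- `g` is the weak derivative of `u` on the time interval `(a, b)`. -/
def IsWeakTimeDeriv {V : Type*} [NormedAddCommGroup V] [NormedSpace ℝ V] (a b : ℝ)
    (u g : ℝ → V) : Prop :=
  IntegrableOn u (Ioo a b) ∧ IntegrableOn g (Ioo a b) ∧
    ∀ η : ℝ → ℝ, ContDiff ℝ ∞ η → HasCompactSupport η → tsupport η ⊆ Ioo a b →
      ∫ t in Ioo a b, deriv η t • u t = -∫ t in Ioo a b, η t • g t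

/-- `u ∈ L^r(a, b; H^m_per(Ω))` is represented by `U`, which takes its values in `H^m_per(Ω)`. -/
def IsSobPath (L : Fin 2 → ℝ) (m : ℕ) (r : ℝ≥0∞) (a b : ℝ) (u : ℝ → L2 L)
    (U : ℝ → Sob L m) : Prop :=
  MemLp U r (volume.restrict (Ioo a b)) ∧ ∀ᵐ t ∂volume.restrict (Ioo a b), toL2 L (U t) = u t

/-- `u ∈ L^r(a, b; H^m_per(Ω))` with norm at most `R`. -/
def SobPathBound (L : Fin 2 → ℝ) (m : ℕ) (r : ℝ≥0∞) (a b : ℝ) (R : ℝ) (u : ℝ → L2 L) : Prop :=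
  ∃ U : ℝ → Sob L m, IsSobPath L m r a b u U ∧
    eLpNorm U r (volume.restrict (Ioo a b)) ≤ ENNReal.ofReal R

/-! ### The Ehrlich-Schwoebel current and its potential -/

/-- The two models of the Ehrlich-Schwoebel current. -/
inductive ESModel : Type
  | one
  | two

/-- `Φ_k(s)`, so that the current is `J(m) = Φ_k(|m|) m`. -/
def Phi (k : ESModel) (α p q s : ℝ) : ℝ :=
  match k with
  | .one => α * (q - p) / ((p + s) * (q + s))
  | .two => α / (q + (p + q) * s / p)

/-- The potential `G_k`. -/
def G (k : ESModel) (α p q : ℝ) (v : Plane) : ℝ :=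
  match k with
  | .one => α * (p * Real.log (p + ‖v‖) - q * Real.log (q + ‖v‖))
  | .two => α * (-(p / (p + q)) * ‖v‖
      + p ^ 2 * q / (p + q) ^ 2 * Real.log (p * q / (p + q) + ‖v‖))

/-- The convex part `G_+(m) = χ |m|² / 2`. -/
def Gplus (χ : ℝ) (v : Plane) : ℝ := 1 / 2 * χ * ‖v‖ ^ 2

/-- The concave part `G_- = G_k - G_+`. -/
def Gminus (k : ESModel) (α p q χ : ℝ) (v : Plane) : ℝ := G k α p q v - Gplus χ v

/-- The smallest admissible splitting parameter `χ`. -/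
def chiMin (k : ESModel) (α p q : ℝ) : ℝ :=
  match k with
  | .one => 2 * α * ((q - p) / (p * q))
  | .two => 0

/-! ### The weak problem -/

/-- The form `a(h, φ)`. -/
def formA (L : Fin 2 → ℝ) (k : ESModel) (α p q γ ε : ℝ) (h φ : Sob L 2) : ℝ :=
  γ * ∫ x, inner ℝ (grad L h x) (grad L φ x) ∂(cellMeasure L)
    + ε ^ 2 * inner ℝ (lap L h) (lap L φ)
    - ∫ x, Phi k α p q ‖grad L h x‖ * inner ℝ (grad L h x) (grad L φ x) ∂(cellMeasure L)

/-- The implicit part `a_+(h, φ)`. -/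
def formPlus (L : Fin 2 → ℝ) (χ γ ε : ℝ) (h φ : Sob L 2) : ℝ :=
  γ * ∫ x, inner ℝ (grad L h x) (grad L φ x) ∂(cellMeasure L)
    + ε ^ 2 * inner ℝ (lap L h) (lap L φ)
    + ∫ x, inner ℝ (gradient (Gplus χ) (grad L h x)) (grad L φ x) ∂(cellMeasure L)

/-- The explicit part `a_-(h, φ)`. -/
def formMinus (L : Fin 2 → ℝ) (k : ESModel) (α p q χ : ℝ) (h φ : Sob L 2) : ℝ :=
  ∫ x, inner ℝ (gradient (Gminus k α p q χ) (grad L h x)) (grad L φ x) ∂(cellMeasure L)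

/-- `h` is a weak solution on `(0, T)` with initial value `h₀` and deposition rate `ζ`:
`h ∈ L²(0,T; H²_per)` with `∂_t h ∈ L²(0,T; H^{-2}_per)`, the weak equation holds for almost every
`t`, and `h(0) = h₀`. Here `h` stands for its representative in `C([0,T]; L²(Ω))`, the one for which
the values `h(t)` at individual times are meant. -/
def IsWeakSolution (L : Fin 2 → ℝ) (k : ESModel) (α p q γ ε T : ℝ) (h₀ : L2 L)
    (ζ h : ℝ → L2 L) : Prop :=
  ContinuousOn h (Icc 0 T) ∧
  (∃ (H : ℝ → Sob L 2) (F : ℝ → SobDual L),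
    IsSobPath L 2 2 0 T h H ∧
    MemLp F 2 (volume.restrict (Ioo 0 T)) ∧
    IsWeakTimeDeriv 0 T (fun t => toDual L (h t)) F ∧
    ∀ᵐ t ∂volume.restrict (Ioo 0 T), ∀ φ : Sob L 2,
      F t φ + formA L k α p q γ ε (H t) φ = inner ℝ (ζ t) (toL2 L φ)) ∧
  h 0 = h₀

/-! ### The fully discrete scheme -/

/-- `ξ · x̃` with `x̃ = 2π (x₁/L₁, x₂/L₂)`. -/
def phase (L : Fin 2 → ℝ) (ξ : ℤ × ℤ) (x : Fin 2 → ℝ) : ℝ :=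
  2 * Real.pi * (ξ.1 * (x 0 / L 0) + ξ.2 * (x 1 / L 1))

theorem continuous_phase (L : Fin 2 → ℝ) (ξ : ℤ × ℤ) : Continuous (phase L ξ) := by
  unfold phase
  fun_prop

/-- The mode `cos (ξ · x̃)` in `L²(Ω)`. -/
def cosMode (L : Fin 2 → ℝ) (ξ : ℤ × ℤ) : L2 L :=
  (memLp_of_continuous L (Real.continuous_cos.comp (continuous_phase L ξ))).toLp

/-- The mode `sin (ξ · x̃)` in `L²(Ω)`. -/
def sinMode (L : Fin 2 → ℝ) (ξ : ℤ × ℤ) : L2 L :=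
  (memLp_of_continuous L (Real.continuous_sin.comp (continuous_phase L ξ))).toLp

/-- The frequencies `ξ ∈ ℤ²` with `|ξ₁|, |ξ₂| ≤ N`. -/
def freq (N : ℕ) : Finset (ℤ × ℤ) := Finset.Icc (-(N : ℤ)) N ×ˢ Finset.Icc (-(N : ℤ)) N

/-- The Fourier space `H_N`, spanned by `cos (ξ · x̃)`, `sin (ξ · x̃)`, `|ξ₁|, |ξ₂| ≤ N` (the
constant function `1` is the cosine mode with `ξ = 0`). -/
def fourierSpace (L : Fin 2 → ℝ) (N : ℕ) : Submodule ℝ (L2 L) :=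
  Submodule.span ℝ (cosMode L '' freq N ∪ sinMode L '' freq N)

instance (L : Fin 2 → ℝ) (N : ℕ) : FiniteDimensional ℝ (fourierSpace L N) :=
  FiniteDimensional.span_of_finite ℝ
    (((freq N).finite_toSet.image _).union ((freq N).finite_toSet.image _))

/-- `z ∈ H^{-2}_per(Ω)` is the value at time `t` of `ζ`, taken as the value of the representative of
`ζ` that is continuous on `[0, τ]` with values in `H^{-2}_per(Ω)`. -/
def IsTimeValue (L : Fin 2 → ℝ) (τ : ℝ) (ζ : ℝ → L2 L) (t : ℝ) (z : SobDual L) : Prop :=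
  ∃ Z : ℝ → SobDual L, ContinuousOn Z (Icc 0 τ) ∧
    (∀ᵐ s ∂volume.restrict (Ioo 0 τ), Z s = toDual L (ζ s)) ∧ Z t = z

/-- `hN 0, …, hN n` are the first steps of the convex-splitting Fourier-Galerkin scheme with time
step `δt`, with `ζd i` as the deposition rate at time `i δt`. Elements of `H_N` are taken as
elements of `H²_per(Ω)`. -/
def IsScheme (L : Fin 2 → ℝ) (k : ESModel) (α p q χ γ ε δt : ℝ) (N n : ℕ) (h₀ : L2 L)
    (ζd : ℕ → SobDual L) (hN : ℕ → Sob L 2) : Prop :=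
  toL2 L (hN 0) = (fourierSpace L N).starProjection h₀ ∧
  ∀ i : ℕ, 1 ≤ i → i ≤ n →
    toL2 L (hN i) ∈ fourierSpace L N ∧
    ∀ φ : Sob L 2, toL2 L φ ∈ fourierSpace L N →
      inner ℝ (δt⁻¹ • toL2 L (hN i - hN (i - 1))) (toL2 L φ) + formPlus L χ γ ε (hN i) φ
        = ζd i φ - formMinus L k α p q χ (hN (i - 1)) φ

end ThinFilm

end

/-!
The error is split as `h(t_i) - h_N^i = ρ_i + η_i` with the projection error
`ρ_i = h(t_i) - P_N h(t_i)` and the discrete error `η_i = P_N h(t_i) - h_N^i ∈ H_N`.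

Spatial estimates are read off Fourier coefficients. Testing the definition of a weak derivative
with plane waves gives `c_ξ(∂^α u) = (iκ)^α c_ξ(u)` (`IsWeakDeriv.coef_eq`); together with Parseval's
identity (`hasSum_norm_sq_coef`, transported from the torus) this yields the interpolation and
Poincaré inequalities for gradients, the approximation properties of `P_N` (`IsTail.norm_sq_le`,
`IsTail.gradSq_le`), and the orthogonality of `ρ_i` to `H_N` together with all derivatives
(`inner_tail_eq_zero`), by which `ρ_i` disappears from every linear term of the error equation.

In time, the du Bois-Reymond lemma (`IsWeakTimeDeriv.exists_eq_primitive`) turns the weak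
derivatives into primitives. Hence `h` is continuous with values in `H²_per`, `h_t` is continuous
with values in `L²`, and the equation holds at every grid point (`exists_representatives`).

The current `J(v) = Φ(|v|) v` is globally Lipschitz, so the explicit form `a_-` is Lipschitz in the
gradient (`abs_formMinus_sub_le`). Subtracting the scheme from the equation and testing with `η_i`
(`error_inequality`) leaves on the right the consistency error of the difference quotient and the
product of `‖∇η_i‖` with the sum of `‖∇(h(t_i) - h(t_{i-1}))‖`, `‖∇ρ_{i-1}‖` and `‖∇η_{i-1}‖`. The
factor `‖∇η_i‖` at the new time is absorbed into `ε² ‖Δη_i‖²` by Poincaré's inequality, and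
`‖∇η_{i-1}‖²` is interpolated between `‖Δη_{i-1}‖²` and `‖η_{i-1}‖²`; what remains on the right is
explicit (`energy_step`). Gronwall's inequality then applies for every step size, and `η_0 = 0`.

The `H^{m₂}` bound controls `ρ_j` for `j < n`, including the endpoint `t_{n-1}` by continuity. The
last projection error `ρ_n` is reached from `ρ_{n-1}` through `h_t ∈ L²(H^{m₁})`, which is where
`N^{-m₁}` enters (`projection_error_le`).
-/

noncomputable section

namespace ThinFilm

/-! ### Integration by parts for periodic functions -/

theorem IsPeriodicTest.pd {L : Fin 2 → ℝ} {f : (Fin 2 → ℝ) → ℝ} (hf : IsPeriodicTest L f)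
    (j : Fin 2) : IsPeriodicTest L (ThinFilm.pd j f) := by
  refine ⟨contDiff_pd j hf.1, fun i x => ?_⟩
  have h : (fun y => f (y + Pi.single i (L i))) = f := funext fun y => hf.2 i y
  unfold ThinFilm.pd
  rw [← fderiv_comp_add_right, h]

theorem IsPeriodicTest.iterate_pd {L : Fin 2 → ℝ} {f : (Fin 2 → ℝ) → ℝ} (hf : IsPeriodicTest L f)
    (j : Fin 2) (n : ℕ) : IsPeriodicTest L ((ThinFilm.pd j)^[n] f) := by
  induction n with
  | zero => simpa using hf
  | succ n ih =>
    rw [Function.iterate_succ_apply']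
    exact ih.pd j

theorem IsPeriodicTest.mul {L : Fin 2 → ℝ} {f g : (Fin 2 → ℝ) → ℝ} (hf : IsPeriodicTest L f)
    (hg : IsPeriodicTest L g) : IsPeriodicTest L (fun x => f x * g x) :=
  ⟨hf.1.mul hg.1, fun i x => by simp only [hf.2 i x, hg.2 i x]⟩

/-- The derivative of a periodic function integrates to zero over the cell: in the divergence
theorem the contributions of opposite faces cancel. -/
theorem integral_pd_eq_zero {L : Fin 2 → ℝ} (hL : ∀ j, 0 < L j) (j : Fin 2)
    {f : (Fin 2 → ℝ) → ℝ} (hf : IsPeriodicTest L f) :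
    ∫ x, pd j f x ∂(cellMeasure L) = 0 := by
  have hset : cell L =ᵐ[volume] Icc (0 : Fin 2 → ℝ) L := by
    have := Measure.univ_pi_Ioo_ae_eq_Icc (μ := fun _ : Fin 2 => (volume : Measure ℝ))
      (f := (0 : Fin 2 → ℝ)) (g := L)
    simpa [cell, volume_pi] using this
  have hdiff : Differentiable ℝ f := hf.1.differentiable (by simp)
  rw [cellMeasure, setIntegral_congr_set hset]
  have key := integral_divergence_of_hasFDerivAt_off_countable' (E := ℝ) (n := 1) 0 L
    (fun i => (hL i).le) (Pi.single j f) (Pi.single j (fderiv ℝ f)) ∅ countable_empty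
    (fun i => ?_) (fun x _ i => ?_) ?_
  · have h1 : ∀ x, ∑ i : Fin 2, (Pi.single j (fderiv ℝ f) :
        Fin 2 → (Fin 2 → ℝ) → (Fin 2 → ℝ) →L[ℝ] ℝ) i x (Pi.single i 1) = pd j f x := by
      intro x
      rw [Finset.sum_eq_single j]
      · simp [pd]
      · intro i _ hij
        simp [Pi.single_eq_of_ne hij]
      · simp
    rw [← setIntegral_congr_fun measurableSet_Icc (fun x _ => h1 x)]
    refine key.trans (Finset.sum_eq_zero fun i _ => ?_)
    rw [sub_eq_zero]
    refine setIntegral_congr_fun measurableSet_Icc fun x _ => ?_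
    have hx : (i.insertNth (L i) x : Fin 2 → ℝ)
        = i.insertNth ((0 : Fin 2 → ℝ) i) x + Pi.single i (L i) := by
      ext l
      refine Fin.succAboveCases i ?_ (fun m => ?_) l
      · simp
      · simp [Fin.succAbove_ne]
    by_cases hij : i = j
    · subst hij
      simp only [Pi.single_eq_same]
      rw [hx, hf.2]
    · simp [Pi.single_eq_of_ne hij]
  · by_cases hij : i = j
    · subst hij
      simpa using hf.1.continuous.continuousOn
    · rw [Pi.single_eq_of_ne hij]
      exact continuousOn_const
  · by_cases hij : i = j
    · subst hij
      simpa using (hdiff x).hasFDerivAt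
    · rw [Pi.single_eq_of_ne hij, Pi.single_eq_of_ne hij]
      exact hasFDerivAt_const (0 : ℝ) x
  · refine Continuous.integrableOn_Icc ?_
    refine continuous_finsetSum _ fun i _ => ?_
    by_cases hij : i = j
    · subst hij
      simp only [Pi.single_eq_same]
      exact (contDiff_pd i hf.1).continuous
    · rw [Pi.single_eq_of_ne hij]
      exact continuous_const

theorem integral_mul_pd {L : Fin 2 → ℝ} (hL : ∀ j, 0 < L j) (j : Fin 2)
    {f g : (Fin 2 → ℝ) → ℝ} (hf : IsPeriodicTest L f) (hg : IsPeriodicTest L g) :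
    ∫ x, f x * pd j g x ∂(cellMeasure L) = -∫ x, pd j f x * g x ∂(cellMeasure L) := by
  have h := integral_pd_eq_zero hL j (hf.mul hg)
  have hd : ∀ x, pd j (fun x => f x * g x) x = f x * pd j g x + pd j f x * g x := by
    intro x
    unfold pd
    rw [fderiv_fun_mul (hf.1.differentiable (by simp) x) (hg.1.differentiable (by simp) x)]
    simp [mul_comm]
  have hint : ∀ {a b : (Fin 2 → ℝ) → ℝ}, IsPeriodicTest L a → IsPeriodicTest L b →
      Integrable (fun x => a x * b x) (cellMeasure L) := fun ha hb =>
    (memLp_of_continuous L ha.1.continuous).integrable_mul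
      (memLp_of_continuous L hb.1.continuous)
  simp_rw [hd] at h
  rw [integral_add (hint hf (hg.pd j)) (hint (hf.pd j) hg)] at h
  linarith

theorem integral_mul_iterate_pd {L : Fin 2 → ℝ} (hL : ∀ j, 0 < L j) (j : Fin 2) (n : ℕ)
    {f g : (Fin 2 → ℝ) → ℝ} (hf : IsPeriodicTest L f) (hg : IsPeriodicTest L g) :
    ∫ x, f x * (pd j)^[n] g x ∂(cellMeasure L)
      = (-1) ^ n * ∫ x, (pd j)^[n] f x * g x ∂(cellMeasure L) := by
  induction n generalizing f with
  | zero => simp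
  | succ n ih =>
    rw [Function.iterate_succ_apply', integral_mul_pd hL j hf (hg.iterate_pd j n),
      ih (hf.pd j), Function.iterate_succ_apply]
    ring

/-! ### Plane waves -/

/-- The plane wave `cos (ξ · x̃ + θ)`. The phase shift `θ` treats sines and cosines alike and turns
differentiation into a shift of `θ` by `π / 2`. -/
def wave (L : Fin 2 → ℝ) (ξ : ℤ × ℤ) (θ : ℝ) (x : Fin 2 → ℝ) : ℝ := Real.cos (phase L ξ x + θ)

/-- The wave vector `κ = 2π (ξ₁/L₁, ξ₂/L₂)` of the frequency `ξ`. -/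
def wavevec (L : Fin 2 → ℝ) (ξ : ℤ × ℤ) : Fin 2 → ℝ :=
  ![2 * Real.pi * ξ.1 / L 0, 2 * Real.pi * ξ.2 / L 1]

theorem hasFDerivAt_phase (L : Fin 2 → ℝ) (ξ : ℤ × ℤ) (x : Fin 2 → ℝ) :
    HasFDerivAt (phase L ξ)
      (∑ j : Fin 2, wavevec L ξ j • (ContinuousLinearMap.proj j : (Fin 2 → ℝ) →L[ℝ] ℝ)) x := by
  have h : phase L ξ = fun y =>
      (∑ j : Fin 2, wavevec L ξ j • (ContinuousLinearMap.proj j : (Fin 2 → ℝ) →L[ℝ] ℝ)) y := by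
    ext y
    simp [phase, wavevec, Fin.sum_univ_two]
    ring
  rw [h]
  exact ContinuousLinearMap.hasFDerivAt _

theorem contDiff_phase (L : Fin 2 → ℝ) (ξ : ℤ × ℤ) : ContDiff ℝ ∞ (phase L ξ) := by
  unfold phase
  fun_prop

theorem pd_const_mul_wave (L : Fin 2 → ℝ) (ξ : ℤ × ℤ) (c θ : ℝ) (j : Fin 2) :
    pd j (fun x => c * wave L ξ θ x)
      = fun x => c * wavevec L ξ j * wave L ξ (θ + Real.pi / 2) x := by
  ext x
  have h := (((hasFDerivAt_phase L ξ x).add_const θ).cos).const_mul c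
  unfold pd wave
  rw [h.fderiv, ← add_assoc, Real.cos_add_pi_div_two]
  fin_cases j <;> simp [Fin.sum_univ_two] <;> ring

theorem iterate_pd_const_mul_wave (L : Fin 2 → ℝ) (ξ : ℤ × ℤ) (c θ : ℝ) (j : Fin 2) (n : ℕ) :
    (pd j)^[n] (fun x => c * wave L ξ θ x)
      = fun x => c * wavevec L ξ j ^ n * wave L ξ (θ + n * (Real.pi / 2)) x := by
  induction n with
  | zero => simp
  | succ n ih =>
    rw [Function.iterate_succ_apply', ih, pd_const_mul_wave]
    ext x
    push_cast
    ring_nf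

/-- The monomial `κ₁^a κ₂^b`. -/
def wavePow (L : Fin 2 → ℝ) (ξ : ℤ × ℤ) (α : ℕ × ℕ) : ℝ :=
  wavevec L ξ 0 ^ α.1 * wavevec L ξ 1 ^ α.2

theorem mixedDeriv_wave (L : Fin 2 → ℝ) (ξ : ℤ × ℤ) (θ : ℝ) (α : ℕ × ℕ) :
    mixedDeriv α (wave L ξ θ)
      = fun x => wavePow L ξ α * wave L ξ (θ + (α.1 + α.2 : ℕ) * (Real.pi / 2)) x := by
  have h : wave L ξ θ = fun x => 1 * wave L ξ θ x := by simp
  rw [mixedDeriv, h, iterate_pd_const_mul_wave, iterate_pd_const_mul_wave]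
  ext x
  rw [wavePow]
  push_cast
  ring_nf

theorem isPeriodicTest_wave {L : Fin 2 → ℝ} (hL : ∀ j, 0 < L j) (ξ : ℤ × ℤ) (θ : ℝ) :
    IsPeriodicTest L (wave L ξ θ) := by
  refine ⟨Real.contDiff_cos.comp ((contDiff_phase L ξ).add contDiff_const), fun j x => ?_⟩
  have h0 := (hL 0).ne'
  have h1 := (hL 1).ne'
  fin_cases j
  · have : phase L ξ (x + Pi.single 0 (L 0)) + θ
        = phase L ξ x + θ + ξ.1 * (2 * Real.pi) := by
      simp [phase]
      field_simp
      ring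
    simp only [wave, Fin.zero_eta]
    rw [this, Real.cos_add_int_mul_two_pi]
  · have : phase L ξ (x + Pi.single 1 (L 1)) + θ
        = phase L ξ x + θ + ξ.2 * (2 * Real.pi) := by
      simp [phase]
      field_simp
      ring
    simp only [wave, Fin.mk_one]
    rw [this, Real.cos_add_int_mul_two_pi]

/-- The plane wave as an element of `L²(Ω)`. -/
def waveL2 (L : Fin 2 → ℝ) (ξ : ℤ × ℤ) (θ : ℝ) : L2 L :=
  (memLp_of_continuous L (f := wave L ξ θ)
    (Real.continuous_cos.comp ((continuous_phase L ξ).add continuous_const))).toLp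

theorem coeFn_waveL2 (L : Fin 2 → ℝ) (ξ : ℤ × ℤ) (θ : ℝ) :
    waveL2 L ξ θ =ᵐ[cellMeasure L] wave L ξ θ := MemLp.coeFn_toLp _

theorem cosMode_eq (L : Fin 2 → ℝ) (ξ : ℤ × ℤ) : cosMode L ξ = waveL2 L ξ 0 := by
  unfold cosMode waveL2
  congr 1
  ext x
  simp [wave]

theorem sinMode_eq (L : Fin 2 → ℝ) (ξ : ℤ × ℤ) : sinMode L ξ = waveL2 L ξ (-(Real.pi / 2)) := by
  unfold sinMode waveL2
  congr 1
  ext x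
  simp [wave, ← sub_eq_add_neg, Real.cos_sub_pi_div_two]

theorem waveL2_add_pi (L : Fin 2 → ℝ) (ξ : ℤ × ℤ) (θ : ℝ) :
    waveL2 L ξ (θ + Real.pi) = -waveL2 L ξ θ := by
  refine Lp.ext ?_
  filter_upwards [coeFn_waveL2 L ξ (θ + Real.pi), coeFn_waveL2 L ξ θ,
    Lp.coeFn_neg (waveL2 L ξ θ)] with x h1 h2 h3
  rw [h1, h3, Pi.neg_apply, h2, wave, wave, ← add_assoc, Real.cos_add_pi]

theorem isWeakDeriv_waveL2 {L : Fin 2 → ℝ} (hL : ∀ j, 0 < L j) (ξ : ℤ × ℤ) (θ : ℝ) (α : ℕ × ℕ) :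
    IsWeakDeriv L α (waveL2 L ξ θ)
      (wavePow L ξ α • waveL2 L ξ (θ + (α.1 + α.2 : ℕ) * (Real.pi / 2))) := by
  intro φ hφ
  have hw := isPeriodicTest_wave hL ξ θ
  have h1 : ∫ x, waveL2 L ξ θ x * mixedDeriv α φ x ∂(cellMeasure L)
      = ∫ x, wave L ξ θ x * (pd 0)^[α.1] ((pd 1)^[α.2] φ) x ∂(cellMeasure L) := by
    refine integral_congr_ae ?_
    filter_upwards [coeFn_waveL2 L ξ θ] with x hx
    rw [hx, mixedDeriv]
  rw [h1, integral_mul_iterate_pd hL 0 _ hw (hφ.iterate_pd 1 _),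
    integral_mul_iterate_pd hL 1 _ (hw.iterate_pd 0 _) hφ, pow_add, mul_assoc]
  congr 2
  refine integral_congr_ae ?_
  filter_upwards [coeFn_waveL2 L ξ (θ + (α.1 + α.2 : ℕ) * (Real.pi / 2)),
    Lp.coeFn_smul (wavePow L ξ α) (waveL2 L ξ (θ + (α.1 + α.2 : ℕ) * (Real.pi / 2)))]
    with x hx hs
  have h : wave L ξ θ = fun x => 1 * wave L ξ θ x := by simp
  rw [hs, Pi.smul_apply, hx, h, iterate_pd_const_mul_wave, iterate_pd_const_mul_wave, wavePow]
  push_cast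
  simp only [one_mul, smul_eq_mul]
  ring_nf

theorem integral_mul_wave_eq_inner (L : Fin 2 → ℝ) (ξ : ℤ × ℤ) (θ : ℝ) (u : L2 L) :
    ∫ x, u x * wave L ξ θ x ∂(cellMeasure L) = inner ℝ (waveL2 L ξ θ) u := by
  rw [L2.inner_def]
  refine integral_congr_ae ?_
  filter_upwards [coeFn_waveL2 L ξ θ] with x hx
  rw [hx]
  simp

/-- Testing a weak derivative with plane waves. -/
theorem IsWeakDeriv.inner_waveL2 {L : Fin 2 → ℝ} (hL : ∀ j, 0 < L j) {α : ℕ × ℕ} {u g : L2 L}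
    (h : IsWeakDeriv L α u g) (ξ : ℤ × ℤ) (θ : ℝ) :
    inner ℝ (waveL2 L ξ θ) g = (-1) ^ (α.1 + α.2) * wavePow L ξ α *
      inner ℝ (waveL2 L ξ (θ + (α.1 + α.2 : ℕ) * (Real.pi / 2))) u := by
  have h1 := h _ (isPeriodicTest_wave hL ξ θ)
  rw [mixedDeriv_wave, integral_mul_wave_eq_inner] at h1
  have h2 : ∫ x, u x * (wavePow L ξ α * wave L ξ (θ + (α.1 + α.2 : ℕ) * (Real.pi / 2)) x)
      ∂(cellMeasure L)
      = wavePow L ξ α * inner ℝ (waveL2 L ξ (θ + (α.1 + α.2 : ℕ) * (Real.pi / 2))) u := by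
    rw [← integral_mul_wave_eq_inner, ← integral_const_mul]
    refine integral_congr_ae (Filter.Eventually.of_forall fun x => ?_)
    ring
  rw [h2] at h1
  rw [mul_assoc, h1, ← mul_assoc, ← mul_pow]
  norm_num

/-! ### Fourier coefficients and Parseval's identity -/

/-- The complex Fourier coefficient `∫_Ω u e^{-i ξ · x̃}` of a real function `u ∈ L²(Ω)`. -/
def coef (L : Fin 2 → ℝ) (ξ : ℤ × ℤ) : L2 L →L[ℝ] ℂ :=
  Complex.ofRealCLM.comp (innerSL ℝ (cosMode L ξ))
    - Complex.I • Complex.ofRealCLM.comp (innerSL ℝ (sinMode L ξ))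

theorem coef_apply (L : Fin 2 → ℝ) (ξ : ℤ × ℤ) (u : L2 L) :
    coef L ξ u = (inner ℝ (cosMode L ξ) u : ℝ) - Complex.I * (inner ℝ (sinMode L ξ) u : ℝ) := by
  simp [coef]

/-- Differentiation multiplies the Fourier coefficients by `(iκ)^α`. -/
theorem IsWeakDeriv.coef_eq {L : Fin 2 → ℝ} (hL : ∀ j, 0 < L j) {α : ℕ × ℕ} {u g : L2 L}
    (h : IsWeakDeriv L α u g) (ξ : ℤ × ℤ) :
    coef L ξ g = Complex.I ^ (α.1 + α.2) * wavePow L ξ α * coef L ξ u := by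
  have key : ∀ n : ℕ,
      ((inner ℝ (waveL2 L ξ (n * (Real.pi / 2))) u : ℝ) : ℂ)
        - Complex.I * (inner ℝ (waveL2 L ξ (-(Real.pi / 2) + n * (Real.pi / 2))) u : ℝ)
      = (-Complex.I) ^ n * coef L ξ u := by
    intro n
    induction n with
    | zero => simp [coef_apply, cosMode_eq, sinMode_eq]
    | succ n ih =>
      have h1 : ((n + 1 : ℕ) : ℝ) * (Real.pi / 2)
          = (-(Real.pi / 2) + n * (Real.pi / 2)) + Real.pi := by push_cast; ring
      have h2 : -(Real.pi / 2) + ((n + 1 : ℕ) : ℝ) * (Real.pi / 2) = n * (Real.pi / 2) := by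
        push_cast; ring
      rw [h2, h1, waveL2_add_pi, inner_neg_left, pow_succ', mul_assoc, ← ih, mul_sub, neg_mul,
        neg_mul, ← mul_assoc, Complex.I_mul_I]
      push_cast
      ring
  have hI : (-1 : ℂ) ^ (α.1 + α.2) * (-Complex.I) ^ (α.1 + α.2) = Complex.I ^ (α.1 + α.2) := by
    rw [← mul_pow]; simp
  rw [coef_apply, cosMode_eq, sinMode_eq, h.inner_waveL2 hL, h.inner_waveL2 hL, ← hI, zero_add]
  push_cast
  have := key (α.1 + α.2)
  push_cast at this
  linear_combination (-1 : ℂ) ^ (α.1 + α.2) * (wavePow L ξ α : ℂ) * this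

theorem coef_weakDeriv {L : Fin 2 → ℝ} (hL : ∀ j, 0 < L j) {m : ℕ} (u : Sob L m)
    (α : MultiIndex m) (ξ : ℤ × ℤ) :
    coef L ξ (weakDeriv L α u)
      = Complex.I ^ (α.1.1 + α.1.2) * wavePow L ξ α.1 * coef L ξ (toL2 L u) :=
  IsWeakDeriv.coef_eq hL (u.2 α) ξ

theorem norm_sq_coef_weakDeriv {L : Fin 2 → ℝ} (hL : ∀ j, 0 < L j) {m : ℕ} (u : Sob L m)
    (α : MultiIndex m) (ξ : ℤ × ℤ) :
    ‖coef L ξ (weakDeriv L α u)‖ ^ 2 = wavePow L ξ α.1 ^ 2 * ‖coef L ξ (toL2 L u)‖ ^ 2 := by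
  rw [coef_weakDeriv hL]
  simp [mul_pow]

theorem coef_eq_integral (L : Fin 2 → ℝ) (ξ : ℤ × ℤ) (u : L2 L) :
    coef L ξ u = ∫ x, Complex.exp (-(phase L ξ x : ℂ) * Complex.I) * (u x : ℂ)
      ∂(cellMeasure L) := by
  have hc : Integrable (fun x => u x * Real.cos (phase L ξ x)) (cellMeasure L) :=
    integrable_mul_of_continuous L u (Real.continuous_cos.comp (continuous_phase L ξ))
  have hs : Integrable (fun x => u x * Real.sin (phase L ξ x)) (cellMeasure L) :=
    integrable_mul_of_continuous L u (Real.continuous_sin.comp (continuous_phase L ξ))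
  have hcos : (inner ℝ (cosMode L ξ) u : ℝ)
      = ∫ x, u x * Real.cos (phase L ξ x) ∂(cellMeasure L) := by
    rw [cosMode_eq, ← integral_mul_wave_eq_inner]
    simp [wave]
  have hsin : (inner ℝ (sinMode L ξ) u : ℝ)
      = ∫ x, u x * Real.sin (phase L ξ x) ∂(cellMeasure L) := by
    rw [sinMode_eq, ← integral_mul_wave_eq_inner]
    simp [wave, ← sub_eq_add_neg, Real.cos_sub_pi_div_two]
  rw [coef_apply, hcos, hsin, ← integral_complex_ofReal, ← integral_complex_ofReal,
    ← integral_const_mul, ← integral_sub hc.ofReal (hs.ofReal.const_mul _)]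
  refine integral_congr_ae (Filter.Eventually.of_forall fun x => ?_)
  simp only [Complex.exp_mul_I, Complex.cos_neg, Complex.sin_neg]
  push_cast
  ring

section Torus

-- The normalised Haar measure on the circle, with respect to which Mathlib defines `mFourierCoeff`.

local instance : MeasureSpace UnitAddCircle := ⟨AddCircle.haarAddCircle⟩

local instance : Measure.IsAddHaarMeasure (volume : Measure UnitAddCircle) :=
  inferInstanceAs (Measure.IsAddHaarMeasure AddCircle.haarAddCircle)

local instance : IsProbabilityMeasure (volume : Measure UnitAddCircle) :=
  inferInstanceAs (IsProbabilityMeasure AddCircle.haarAddCircle)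

/-- The section of the covering of the torus by the plane with values in `(0, L₁] × (0, L₂]`. -/
def torusSection (L : Fin 2 → ℝ) (y : UnitAddTorus (Fin 2)) : Fin 2 → ℝ :=
  fun j => L j * (UnitAddTorus.measurableEquivPiIoc (0 : Fin 2 → ℝ) y).1 j

theorem measurable_torusSection (L : Fin 2 → ℝ) : Measurable (torusSection L) := by
  refine measurable_pi_lambda _ fun j => Measurable.const_mul ?_ _
  exact (measurable_pi_apply j).comp
    (measurable_subtype_coe.comp (UnitAddTorus.measurableEquivPiIoc (0 : Fin 2 → ℝ)).measurable)

/-- Up to the factor `|Ω|`, the torus and the cell carry the same measure. -/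
theorem map_torusSection {L : Fin 2 → ℝ} (hL : ∀ j, 0 < L j) :
    ENNReal.ofReal (L 0 * L 1) • Measure.map (torusSection L) volume = cellMeasure L := by
  have hdet : (Matrix.diagonal L).det = L 0 * L 1 := by
    simp [Matrix.det_diagonal, Fin.prod_univ_two]
  have hpos : 0 < L 0 * L 1 := mul_pos (hL 0) (hL 1)
  have hdiag : ∀ x : Fin 2 → ℝ, Matrix.toLin' (Matrix.diagonal L) x = fun j => L j * x j := by
    intro x
    ext j
    simp [Matrix.mulVec_diagonal]
  have hmeas : Measurable (Matrix.toLin' (Matrix.diagonal L)) := by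
    rw [show ⇑(Matrix.toLin' (Matrix.diagonal L)) = fun x j => L j * x j from funext hdiag]
    exact measurable_pi_lambda _ fun j => (measurable_pi_apply j).const_mul _
  set B : Set (Fin 2 → ℝ) := {x | ∀ i, x i ∈ Ioc ((0 : Fin 2 → ℝ) i) ((0 : Fin 2 → ℝ) i + 1)}
    with hB
  have hBm : MeasurableSet B := by
    have : B = Set.pi univ fun i => Ioc ((0 : Fin 2 → ℝ) i) ((0 : Fin 2 → ℝ) i + 1) := by
      ext x; simp [hB]
    rw [this]
    exact MeasurableSet.univ_pi fun _ => measurableSet_Ioc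
  have h1 : Measure.map (torusSection L) volume
      = Measure.map (Matrix.toLin' (Matrix.diagonal L)) (volume.restrict B) := by
    have e1 := (UnitAddTorus.measurePreserving_equivPiIoc (0 : Fin 2 → ℝ)).map_eq
    have e2 := map_comap_subtype_coe hBm (volume : Measure (Fin 2 → ℝ))
    rw [← e2]
    erw [← e1]
    rw [Measure.map_map measurable_subtype_coe (MeasurableEquiv.measurable _),
      Measure.map_map hmeas (measurable_subtype_coe.comp (MeasurableEquiv.measurable _))]
    congr 1
    ext y j
    simp only [torusSection, Function.comp_apply, hdiag]
  set C : Set (Fin 2 → ℝ) := Set.pi univ fun j => Ioc 0 (L j) with hC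
  have hCm : MeasurableSet C := MeasurableSet.univ_pi fun _ => measurableSet_Ioc
  have hpre : Matrix.toLin' (Matrix.diagonal L) ⁻¹' C = B := by
    ext x
    simp only [hC, hB, Set.mem_preimage, hdiag, Set.mem_univ_pi, Set.mem_Ioc, Set.mem_ofPred_eq,
      Pi.zero_apply, zero_add]
    refine forall_congr' fun j => ?_
    rw [mul_pos_iff_of_pos_left (hL j), mul_le_iff_le_one_right (hL j)]
  have h2 := Real.smul_map_diagonal_volume_pi (D := L) (by rw [hdet]; exact hpos.ne')
  rw [hdet, abs_of_pos hpos] at h2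
  have hae : cell L =ᵐ[volume] C := by
    have e := Measure.univ_pi_Ioo_ae_eq_Icc (μ := fun _ : Fin 2 => (volume : Measure ℝ))
      (f := (0 : Fin 2 → ℝ)) (g := L)
    have e' := Measure.univ_pi_Ioc_ae_eq_Icc (μ := fun _ : Fin 2 => (volume : Measure ℝ))
      (f := (0 : Fin 2 → ℝ)) (g := L)
    simpa [cell, volume_pi, hC] using e.trans e'.symm
  rw [h1, ← hpre, ← Measure.restrict_map hmeas hCm, ← Measure.restrict_smul, h2, cellMeasure,
    Measure.restrict_congr_set hae]

theorem mFourier_neg_torusSection {L : Fin 2 → ℝ} (hL : ∀ j, 0 < L j) (n : Fin 2 → ℤ)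
    (y : UnitAddTorus (Fin 2)) :
    UnitAddTorus.mFourier (-n) y
      = Complex.exp (-(phase L (n 0, n 1) (torusSection L y) : ℂ) * Complex.I) := by
  set e := UnitAddTorus.measurableEquivPiIoc (0 : Fin 2 → ℝ)
  have hy : y = fun i => (((e y).1 i : ℝ) : UnitAddCircle) := by
    conv_lhs => rw [← e.symm_apply_apply y]
    rfl
  have h0 : (L 0 : ℂ) ≠ 0 := by exact_mod_cast (hL 0).ne'
  have h1 : (L 1 : ℂ) ≠ 0 := by exact_mod_cast (hL 1).ne'
  conv_lhs => rw [hy]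
  simp only [UnitAddTorus.mFourier, ContinuousMap.coe_mk, Fin.prod_univ_two, Pi.neg_apply,
    fourier_coe_apply, ← Complex.exp_add]
  congr 1
  simp only [phase, torusSection]
  push_cast
  field_simp
  ring

theorem integral_cell_eq {E : Type*} [NormedAddCommGroup E] [NormedSpace ℝ E] {L : Fin 2 → ℝ}
    (hL : ∀ j, 0 < L j) {F : (Fin 2 → ℝ) → E}
    (hF : AEStronglyMeasurable F (Measure.map (torusSection L) volume)) :
    ∫ x, F x ∂(cellMeasure L) = (L 0 * L 1) • ∫ y, F (torusSection L y) := by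
  rw [← map_torusSection hL, integral_smul_measure,
    ENNReal.toReal_ofReal (mul_pos (hL 0) (hL 1)).le,
    integral_map (measurable_torusSection L).aemeasurable hF]

/-- **Parseval's identity** on the cell. -/
theorem hasSum_norm_sq_coef {L : Fin 2 → ℝ} (hL : ∀ j, 0 < L j) (u : L2 L) :
    HasSum (fun ξ => ‖coef L ξ u‖ ^ 2) (L 0 * L 1 * ‖u‖ ^ 2) := by
  have hpos : 0 < L 0 * L 1 := mul_pos (hL 0) (hL 1)
  set ν : Measure (Fin 2 → ℝ) := Measure.map (torusSection L) volume with hν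
  have hsmul : ENNReal.ofReal (L 0 * L 1) • ν = cellMeasure L := map_torusSection hL
  have hνc : ν = (ENNReal.ofReal (L 0 * L 1))⁻¹ • cellMeasure L := by
    rw [← hsmul, smul_smul, ENNReal.inv_mul_cancel (by simpa using hpos) ENNReal.ofReal_ne_top,
      one_smul]
  have hmem : MemLp (fun x => (u x : ℂ)) 2 ν := by
    rw [hνc]
    exact ((Lp.memLp u).ofReal).smul_measure (by simpa using hpos)
  have hmem' : MemLp (fun y => (u (torusSection L y) : ℂ)) 2
      (volume : Measure (UnitAddTorus (Fin 2))) :=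
    hmem.comp_of_map (measurable_torusSection L).aemeasurable
  have hcoef : ∀ n : Fin 2 → ℤ, coef L (n 0, n 1) u
      = (L 0 * L 1 : ℝ) * UnitAddTorus.mFourierCoeff (hmem'.toLp _) n := by
    intro n
    rw [coef_eq_integral, integral_cell_eq hL, Complex.real_smul]
    · congr 1
      refine integral_congr_ae ?_
      filter_upwards [hmem'.coeFn_toLp] with y hy
      rw [hy, mFourier_neg_torusSection hL, smul_eq_mul]
    · refine AEStronglyMeasurable.mul (Continuous.aestronglyMeasurable ?_) hmem.1
      have := continuous_phase L (n 0, n 1)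
      fun_prop
  have hsum := (UnitAddTorus.hasSum_sq_mFourierCoeff (hmem'.toLp _)).mul_left ((L 0 * L 1) ^ 2)
  have hnorm : ((L 0 * L 1) ^ 2 * ∫ y, ‖(hmem'.toLp _ : _ → ℂ) y‖ ^ 2) = L 0 * L 1 * ‖u‖ ^ 2 := by
    have hu : ‖u‖ ^ 2 = ∫ x, (u x) ^ 2 ∂(cellMeasure L) := by
      rw [← real_inner_self_eq_norm_sq, L2.inner_def]
      simp
    have h1 : ∫ y, ‖(hmem'.toLp _ : _ → ℂ) y‖ ^ 2 = ∫ y, (u (torusSection L y)) ^ 2 := by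
      refine integral_congr_ae ?_
      filter_upwards [hmem'.coeFn_toLp] with y hy
      simp [hy]
    have h2 : ∫ x, (u x) ^ 2 ∂(cellMeasure L)
        = (L 0 * L 1) * ∫ y, (u (torusSection L y)) ^ 2 := by
      have hF : AEStronglyMeasurable (fun x => (u x) ^ 2) ν := by
        rw [hνc]
        exact ((Lp.memLp u).1.pow 2).smul_measure _
      exact integral_cell_eq hL hF
    rw [hu, h1, h2]
    ring
  rw [hnorm] at hsum
  rw [← (finTwoArrowEquiv ℤ).hasSum_iff]
  refine hsum.congr_fun fun n => ?_
  have h := hcoef n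
  change ‖coef L (n 0, n 1) u‖ ^ 2 = _
  rw [h, norm_mul, mul_pow, Complex.norm_real, Real.norm_of_nonneg hpos.le]

end Torus

/-! ### Norm inequalities from Fourier coefficients -/

/-- Inequalities between weighted sums of squared norms may be checked on Fourier coefficients. -/
theorem sum_norm_sq_le_of_coef {L : Fin 2 → ℝ} (hL : ∀ j, 0 < L j) {ι ι' : Type*}
    [Fintype ι] [Fintype ι'] (a : ι → ℝ) (b : ι' → ℝ) (u : ι → L2 L) (v : ι' → L2 L)
    (h : ∀ ξ, ∑ i, a i * ‖coef L ξ (u i)‖ ^ 2 ≤ ∑ i, b i * ‖coef L ξ (v i)‖ ^ 2) :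
    ∑ i, a i * ‖u i‖ ^ 2 ≤ ∑ i, b i * ‖v i‖ ^ 2 := by
  have hpos : 0 < L 0 * L 1 := mul_pos (hL 0) (hL 1)
  have h1 := hasSum_sum (s := Finset.univ) fun i _ => (hasSum_norm_sq_coef hL (u i)).mul_left (a i)
  have h2 := hasSum_sum (s := Finset.univ) fun i _ => (hasSum_norm_sq_coef hL (v i)).mul_left (b i)
  have h3 := hasSum_le h h1 h2
  have e1 : ∀ {ι : Type _} [Fintype ι] (a : ι → ℝ) (u : ι → L2 L),
      ∑ i, a i * (L 0 * L 1 * ‖u i‖ ^ 2) = L 0 * L 1 * ∑ i, a i * ‖u i‖ ^ 2 := by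
    intro ι _ a u
    rw [Finset.mul_sum]
    exact Finset.sum_congr rfl fun i _ => by ring
  have e2 : ∑ i, b i * (L 0 * L 1 * ‖v i‖ ^ 2) = L 0 * L 1 * ∑ i, b i * ‖v i‖ ^ 2 := by
    rw [Finset.mul_sum]
    exact Finset.sum_congr rfl fun i _ => by ring
  rw [e1, e2] at h3
  exact le_of_mul_le_mul_left h3 hpos

theorem eq_zero_of_coef {L : Fin 2 → ℝ} (hL : ∀ j, 0 < L j) {u : L2 L}
    (h : ∀ ξ, coef L ξ u = 0) : u = 0 := by
  have h1 := sum_norm_sq_le_of_coef hL (ι := Unit) (ι' := Unit) (fun _ => 1) (fun _ => 0)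
    (fun _ => u) (fun _ => u) (fun ξ => by simp [h ξ])
  simpa using h1

theorem toL2_injective {L : Fin 2 → ℝ} (hL : ∀ j, 0 < L j) (m : ℕ) :
    Function.Injective (toL2 L : Sob L m → L2 L) := by
  rw [injective_iff_map_eq_zero]
  intro u hu
  have h : ∀ α, weakDeriv L α u = 0 := fun α => eq_zero_of_coef hL fun ξ => by
    rw [coef_weakDeriv hL, hu]; simp
  apply Subtype.ext
  ext α : 1
  exact h α

/-- Functions with disjoint Fourier supports are orthogonal. -/
theorem inner_eq_zero_of_coef {L : Fin 2 → ℝ} (hL : ∀ j, 0 < L j) {u v : L2 L}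
    (h : ∀ ξ, coef L ξ u = 0 ∨ coef L ξ v = 0) : inner ℝ u v = (0 : ℝ) := by
  have hpos : 0 < L 0 * L 1 := mul_pos (hL 0) (hL 1)
  have h1 := hasSum_norm_sq_coef hL (u + v)
  have h2 := (hasSum_norm_sq_coef hL u).add (hasSum_norm_sq_coef hL v)
  have h3 : ∀ ξ, ‖coef L ξ (u + v)‖ ^ 2 = ‖coef L ξ u‖ ^ 2 + ‖coef L ξ v‖ ^ 2 := by
    intro ξ
    rcases h ξ with h | h <;> simp [h]
  simp_rw [h3] at h1
  have h4 := h1.unique h2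
  have h5 : ‖u + v‖ ^ 2 = ‖u‖ ^ 2 + ‖v‖ ^ 2 :=
    mul_left_cancel₀ hpos.ne' (by rw [h4]; ring)
  rw [norm_add_sq_real] at h5
  linarith

theorem wavevec_sq_ge {L : Fin 2 → ℝ} (hL : ∀ j, 0 < L j) (ξ : ℤ × ℤ) {N : ℕ} :
    ((N : ℤ) ≤ |ξ.1| → (2 * Real.pi * N / max (L 0) (L 1)) ^ 2 ≤ wavevec L ξ 0 ^ 2) ∧
    ((N : ℤ) ≤ |ξ.2| → (2 * Real.pi * N / max (L 0) (L 1)) ^ 2 ≤ wavevec L ξ 1 ^ 2) := by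
  have key : ∀ (z : ℤ) (l : ℝ), 0 < l → l ≤ max (L 0) (L 1) → (N : ℤ) ≤ |z| →
      (2 * Real.pi * N / max (L 0) (L 1)) ^ 2 ≤ (2 * Real.pi * z / l) ^ 2 := by
    intro z l hl hl' hz
    have hz' : (N : ℝ) ≤ |(z : ℝ)| := by exact_mod_cast hz
    rw [← sq_abs (2 * Real.pi * z / l), abs_div, abs_mul, abs_of_pos hl,
      abs_of_pos Real.two_pi_pos]
    have := Real.two_pi_pos
    have hmax : 0 < max (L 0) (L 1) := (hL 0).trans_le (le_max_left _ _)
    have h0 : 0 ≤ 2 * Real.pi * N / max (L 0) (L 1) := by positivity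
    gcongr
  exact ⟨fun h => by simpa [wavevec] using key _ _ (hL 0) (le_max_left _ _) h,
    fun h => by simpa [wavevec] using key _ _ (hL 1) (le_max_right _ _) h⟩

/-- The partial derivative `∂_j u` of `u ∈ H²_per(Ω)`. -/
def deriv1 (L : Fin 2 → ℝ) (j : Fin 2) : Sob L 2 →L[ℝ] L2 L :=
  match j with
  | 0 => weakDeriv L ⟨(1, 0), by decide⟩
  | 1 => weakDeriv L ⟨(0, 1), by decide⟩

theorem norm_sq_coef_deriv1 {L : Fin 2 → ℝ} (hL : ∀ j, 0 < L j) (j : Fin 2) (u : Sob L 2)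
    (ξ : ℤ × ℤ) :
    ‖coef L ξ (deriv1 L j u)‖ ^ 2 = wavevec L ξ j ^ 2 * ‖coef L ξ (toL2 L u)‖ ^ 2 := by
  fin_cases j <;> simp [deriv1, norm_sq_coef_weakDeriv hL, wavePow]

/-- The Laplacian as a continuous linear map on `H²_per(Ω)`. -/
def lapCLM (L : Fin 2 → ℝ) : Sob L 2 →L[ℝ] L2 L :=
  weakDeriv L ⟨(2, 0), by decide⟩ + weakDeriv L ⟨(0, 2), by decide⟩

theorem lapCLM_apply (L : Fin 2 → ℝ) (u : Sob L 2) : lapCLM L u = lap L u := rfl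

theorem coef_lapCLM {L : Fin 2 → ℝ} (hL : ∀ j, 0 < L j) (u : Sob L 2) (ξ : ℤ × ℤ) :
    coef L ξ (lapCLM L u)
      = -((wavevec L ξ 0 ^ 2 + wavevec L ξ 1 ^ 2 : ℝ) : ℂ) * coef L ξ (toL2 L u) := by
  rw [lapCLM, add_apply, map_add, coef_weakDeriv hL, coef_weakDeriv hL]
  simp [wavePow]
  ring

theorem norm_sq_coef_lapCLM {L : Fin 2 → ℝ} (hL : ∀ j, 0 < L j) (u : Sob L 2) (ξ : ℤ × ℤ) :
    ‖coef L ξ (lapCLM L u)‖ ^ 2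
      = (wavevec L ξ 0 ^ 2 + wavevec L ξ 1 ^ 2) ^ 2 * ‖coef L ξ (toL2 L u)‖ ^ 2 := by
  rw [coef_lapCLM hL, norm_mul, norm_neg, Complex.norm_real, mul_pow, Real.norm_eq_abs, sq_abs]

/-- The squared gradient norm `‖∇u‖²`. -/
def gradSq (L : Fin 2 → ℝ) (u : Sob L 2) : ℝ := ‖deriv1 L 0 u‖ ^ 2 + ‖deriv1 L 1 u‖ ^ 2

/-- Interpolation of the gradient between `L²` and the Laplacian. -/
theorem gradSq_le_interp {L : Fin 2 → ℝ} (hL : ∀ j, 0 < L j) {μ : ℝ} (hμ : 0 < μ) (u : Sob L 2) :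
    gradSq L u ≤ μ * ‖lapCLM L u‖ ^ 2 + 1 / (4 * μ) * ‖toL2 L u‖ ^ 2 := by
  have h := sum_norm_sq_le_of_coef hL ![1, 1] ![μ, 1 / (4 * μ)]
    ![deriv1 L 0 u, deriv1 L 1 u] ![lapCLM L u, toL2 L u] (fun ξ => ?_)
  · simpa [Fin.sum_univ_two, gradSq] using h
  · simp only [Fin.sum_univ_two, Matrix.cons_val_zero, Matrix.cons_val_one]
    rw [norm_sq_coef_deriv1 hL, norm_sq_coef_deriv1 hL, norm_sq_coef_lapCLM hL]
    set s := wavevec L ξ 0 ^ 2 + wavevec L ξ 1 ^ 2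
    have hs : s ≤ μ * s ^ 2 + 1 / (4 * μ) := by
      have : μ * s ^ 2 + 1 / (4 * μ) - s = (2 * μ * s - 1) ^ 2 / (4 * μ) := by
        field_simp
        ring
      have h2 : 0 ≤ (2 * μ * s - 1) ^ 2 / (4 * μ) := by positivity
      linarith
    have := mul_le_mul_of_nonneg_right hs (sq_nonneg ‖coef L ξ (toL2 L u)‖)
    calc _ = s * ‖coef L ξ (toL2 L u)‖ ^ 2 := by ring
      _ ≤ _ := this
      _ = _ := by ring

/-- The Poincaré constant of the cell for gradients of periodic functions. -/
def poincare (L : Fin 2 → ℝ) : ℝ := (max (L 0) (L 1) / (2 * Real.pi)) ^ 2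

theorem poincare_pos {L : Fin 2 → ℝ} (hL : ∀ j, 0 < L j) : 0 < poincare L := by
  have := (hL 0).trans_le (le_max_left (L 0) (L 1))
  have := Real.pi_pos
  unfold poincare
  positivity

/-- Poincaré's inequality for gradients. -/
theorem gradSq_le_poincare {L : Fin 2 → ℝ} (hL : ∀ j, 0 < L j) (u : Sob L 2) :
    gradSq L u ≤ poincare L * ‖lapCLM L u‖ ^ 2 := by
  have hmax : 0 < max (L 0) (L 1) := (hL 0).trans_le (le_max_left (L 0) (L 1))
  have h := sum_norm_sq_le_of_coef hL ![1, 1] (fun _ : Unit => poincare L)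
    ![deriv1 L 0 u, deriv1 L 1 u] (fun _ => lapCLM L u) (fun ξ => ?_)
  · simpa [Fin.sum_univ_two, gradSq] using h
  · simp only [Fin.sum_univ_two, Matrix.cons_val_zero, Matrix.cons_val_one, Finset.univ_unique,
      Finset.sum_singleton]
    rw [norm_sq_coef_deriv1 hL, norm_sq_coef_deriv1 hL, norm_sq_coef_lapCLM hL]
    set s := wavevec L ξ 0 ^ 2 + wavevec L ξ 1 ^ 2 with hs
    have hs0 : 0 ≤ s := by positivity
    have hc : poincare L * (2 * Real.pi * (1 : ℕ) / max (L 0) (L 1)) ^ 2 = 1 := by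
      have := Real.pi_pos.ne'
      unfold poincare
      field_simp
      simp
    have hP := poincare_pos hL
    have hkey : s ≤ poincare L * s ^ 2 := by
      have hor : s = 0 ∨ (2 * Real.pi * (1 : ℕ) / max (L 0) (L 1)) ^ 2 ≤ s := by
        by_cases h1 : ξ.1 = 0
        · by_cases h2 : ξ.2 = 0
          · left; simp [hs, wavevec, h1, h2]
          · right
            have := (wavevec_sq_ge hL ξ (N := 1)).2 (by exact_mod_cast Int.one_le_abs h2)
            nlinarith [sq_nonneg (wavevec L ξ 0)]
        · right
          have := (wavevec_sq_ge hL ξ (N := 1)).1 (by exact_mod_cast Int.one_le_abs h1)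
          nlinarith [sq_nonneg (wavevec L ξ 1)]
      rcases hor with h0 | h0
      · rw [h0]; simp
      · have : 1 ≤ poincare L * s := by
          rw [← hc]; gcongr
        nlinarith
    have := mul_le_mul_of_nonneg_right hkey (sq_nonneg ‖coef L ξ (toL2 L u)‖)
    calc _ = s * ‖coef L ξ (toL2 L u)‖ ^ 2 := by ring
      _ ≤ _ := this
      _ = _ := by ring

/-! ### The Fourier projection -/

/-- Plane waves as elements of `H^m_per(Ω)`. -/
theorem exists_sob_waveL2 {L : Fin 2 → ℝ} (hL : ∀ j, 0 < L j) (m : ℕ) (ξ : ℤ × ℤ) (θ : ℝ) :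
    ∃ u : Sob L m, toL2 L u = waveL2 L ξ θ := by
  have h0 : wavePow L ξ (0, 0) • waveL2 L ξ (θ + ((0 + 0 : ℕ) : ℝ) * (Real.pi / 2))
      = waveL2 L ξ θ := by simp [wavePow]
  refine ⟨⟨WithLp.toLp 2 fun α => wavePow L ξ α.1 •
    waveL2 L ξ (θ + (α.1.1 + α.1.2 : ℕ) * (Real.pi / 2)), fun α => ?_⟩, h0⟩
  have h := isWeakDeriv_waveL2 hL ξ θ α.1
  rw [← h0] at h
  exact h

theorem exists_sob_of_mem_fourierSpace {L : Fin 2 → ℝ} (hL : ∀ j, 0 < L j) (m N : ℕ) {v : L2 L}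
    (hv : v ∈ fourierSpace L N) : ∃ u : Sob L m, toL2 L u = v := by
  have hle : fourierSpace L N ≤ LinearMap.range (toL2 L : Sob L m →L[ℝ] L2 L).toLinearMap := by
    refine Submodule.span_le.2 ?_
    rintro _ (⟨ξ, _, rfl⟩ | ⟨ξ, _, rfl⟩)
    · rw [cosMode_eq]; exact exists_sob_waveL2 hL m ξ 0
    · rw [sinMode_eq]; exact exists_sob_waveL2 hL m ξ _
  exact hle hv

theorem mem_freq {N : ℕ} {ξ : ℤ × ℤ} : ξ ∈ freq N ↔ |ξ.1| ≤ N ∧ |ξ.2| ≤ N := by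
  simp [freq, abs_le]

/-- Two modes with `κ_j(ξ)² ≠ κ_j(η)²` are eigenfunctions of `∂_j²` for different eigenvalues. -/
theorem coef_waveL2_eq_zero {L : Fin 2 → ℝ} (hL : ∀ j, 0 < L j) {ξ η : ℤ × ℤ} (θ : ℝ)
    (h : |ξ.1| ≠ |η.1| ∨ |ξ.2| ≠ |η.2|) : coef L ξ (waveL2 L η θ) = 0 := by
  have key : ∀ α : ℕ × ℕ, α.1 + α.2 = 2 → wavePow L ξ α ≠ wavePow L η α →
      coef L ξ (waveL2 L η θ) = 0 := by
    intro α hα hne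
    have h1 := (isWeakDeriv_waveL2 hL η θ α).coef_eq hL ξ
    rw [hα] at h1
    have h2 : θ + ((2 : ℕ) : ℝ) * (Real.pi / 2) = θ + Real.pi := by push_cast; ring
    rw [h2, waveL2_add_pi, smul_neg, map_neg, map_smul, Complex.I_sq, Complex.real_smul] at h1
    have h3 : ((wavePow L ξ α : ℂ) - wavePow L η α) * coef L ξ (waveL2 L η θ) = 0 := by
      linear_combination h1
    rcases mul_eq_zero.1 h3 with h4 | h4
    · exact absurd (by exact_mod_cast sub_eq_zero.1 h4) hne
    · exact h4
  have hz : ∀ (a b : ℤ) (l : ℝ), 0 < l → |a| ≠ |b| →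
      (2 * Real.pi * a / l) ^ 2 ≠ (2 * Real.pi * b / l) ^ 2 := by
    intro a b l hl hab he
    have hπ := Real.pi_pos.ne'
    have hl' := hl.ne'
    apply hab
    rw [← sq_eq_sq_iff_abs_eq_abs]
    have : (a : ℝ) ^ 2 = (b : ℝ) ^ 2 := by
      field_simp at he
      exact he
    exact_mod_cast this
  rcases h with h | h
  · refine key (2, 0) rfl ?_
    simpa [wavePow, wavevec] using hz _ _ _ (hL 0) h
  · refine key (0, 2) rfl ?_
    simpa [wavePow, wavevec] using hz _ _ _ (hL 1) h

theorem coef_eq_zero_of_mem_fourierSpace {L : Fin 2 → ℝ} (hL : ∀ j, 0 < L j) {N : ℕ} {v : L2 L}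
    (hv : v ∈ fourierSpace L N) {ξ : ℤ × ℤ} (hξ : ξ ∉ freq N) : coef L ξ v = 0 := by
  have hle : fourierSpace L N ≤ LinearMap.ker (coef L ξ).toLinearMap := by
    refine Submodule.span_le.2 ?_
    have hne : ∀ η ∈ freq N, |ξ.1| ≠ |η.1| ∨ |ξ.2| ≠ |η.2| := by
      intro η hη
      by_contra! hcon
      rw [mem_freq] at hη hξ
      rw [hcon.1, hcon.2] at hξ
      exact hξ hη
    rintro _ (⟨η, hη, rfl⟩ | ⟨η, hη, rfl⟩)
    · rw [cosMode_eq]; exact coef_waveL2_eq_zero hL _ (hne η hη)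
    · rw [sinMode_eq]; exact coef_waveL2_eq_zero hL _ (hne η hη)
  exact hle hv

theorem coef_starProjection_of_mem {L : Fin 2 → ℝ} {N : ℕ} (u : L2 L) {ξ : ℤ × ℤ}
    (hξ : ξ ∈ freq N) : coef L ξ ((fourierSpace L N).starProjection u) = coef L ξ u := by
  have h : ∀ w ∈ fourierSpace L N,
      (inner ℝ w ((fourierSpace L N).starProjection u) : ℝ) = inner ℝ w u := by
    intro w hw
    have := Submodule.starProjection_inner_eq_zero (K := fourierSpace L N) u w hw
    rw [inner_sub_left, sub_eq_zero] at this
    rw [real_inner_comm, ← this, real_inner_comm]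
  rw [coef_apply, coef_apply,
    h _ (Submodule.subset_span (Or.inl ⟨ξ, hξ, rfl⟩)),
    h _ (Submodule.subset_span (Or.inr ⟨ξ, hξ, rfl⟩))]

/-- `r` is the part of `u` with frequencies outside `{|ξ₁|, |ξ₂| ≤ N}`. -/
def IsTail (L : Fin 2 → ℝ) (N : ℕ) (u r : L2 L) : Prop :=
  ∀ ξ, coef L ξ r = if ξ ∈ freq N then 0 else coef L ξ u

theorem isTail_sub_starProjection {L : Fin 2 → ℝ} (hL : ∀ j, 0 < L j) (N : ℕ) (u : L2 L) :
    IsTail L N u (u - (fourierSpace L N).starProjection u) := by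
  intro ξ
  rw [map_sub]
  split_ifs with hξ
  · rw [coef_starProjection_of_mem u hξ, sub_self]
  · rw [coef_eq_zero_of_mem_fourierSpace hL (Submodule.starProjection_apply_mem _ _) hξ, sub_zero]

theorem norm_sq_sob_ge (L : Fin 2 → ℝ) {m : ℕ} (hm : 1 ≤ m) (u : Sob L m) :
    ‖weakDeriv L ⟨(m, 0), by simp⟩ u‖ ^ 2 + ‖weakDeriv L ⟨(0, m), by simp⟩ u‖ ^ 2 ≤ ‖u‖ ^ 2 := by
  have h : ‖u‖ ^ 2 = ∑ α : MultiIndex m, ‖weakDeriv L α u‖ ^ 2 := by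
    rw [← Submodule.norm_coe, PiLp.norm_sq_eq_of_L2]
    rfl
  rw [h]
  have hne : (⟨(m, 0), by simp⟩ : MultiIndex m) ≠ ⟨(0, m), by simp⟩ := by
    simp only [ne_eq, Subtype.mk.injEq, Prod.mk.injEq, not_and]
    omega
  rw [← Finset.sum_pair hne (f := fun α => ‖weakDeriv L α u‖ ^ 2)]
  exact Finset.sum_le_sum_of_subset_of_nonneg (Finset.subset_univ _) fun _ _ _ => by positivity

theorem tail_weight {L : Fin 2 → ℝ} (hL : ∀ j, 0 < L j) {N : ℕ} (hN : 1 ≤ N) {ξ : ℤ × ℤ}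
    (hξ : ξ ∉ freq N) (m : ℕ) :
    1 ≤ (poincare L / N ^ 2) ^ m
        * ((wavevec L ξ 0 ^ m) ^ 2 + (wavevec L ξ 1 ^ m) ^ 2) ∧
    wavevec L ξ 0 ^ 2 + wavevec L ξ 1 ^ 2 ≤ 2 * (poincare L / N ^ 2) ^ m
        * ((wavevec L ξ 0 ^ (m + 1)) ^ 2 + (wavevec L ξ 1 ^ (m + 1)) ^ 2) := by
  have hmax : 0 < max (L 0) (L 1) := (hL 0).trans_le (le_max_left (L 0) (L 1))
  have hN' : (0 : ℝ) < N := by exact_mod_cast hN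
  set r := poincare L / N ^ 2 with hr
  have hr0 : 0 < r := div_pos (poincare_pos hL) (by positivity)
  have hc : r * (2 * Real.pi * N / max (L 0) (L 1)) ^ 2 = 1 := by
    have := Real.pi_pos.ne'
    rw [hr]
    unfold poincare
    field_simp
  set a := wavevec L ξ 0 ^ 2 with ha
  set b := wavevec L ξ 1 ^ 2 with hb
  have ha0 : 0 ≤ a := sq_nonneg _
  have hb0 : 0 ≤ b := sq_nonneg _
  have hab : 1 ≤ r * max a b := by
    have hle : (2 * Real.pi * N / max (L 0) (L 1)) ^ 2 ≤ max a b := by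
      rw [mem_freq, not_and_or, not_le, not_le] at hξ
      rcases hξ with h | h
      · exact ((wavevec_sq_ge hL ξ).1 h.le).trans (le_max_left _ _)
      · exact ((wavevec_sq_ge hL ξ).2 h.le).trans (le_max_right _ _)
    rw [← hc]
    gcongr
  have hM0 : 0 ≤ max a b := ha0.trans (le_max_left _ _)
  have hpow : ∀ n : ℕ, (max a b) ^ n ≤ a ^ n + b ^ n := by
    intro n
    rcases max_cases a b with ⟨h, _⟩ | ⟨h, _⟩ <;> rw [h]
    · exact le_add_of_nonneg_right (by positivity)
    · exact le_add_of_nonneg_left (by positivity)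
  have e : ∀ (x : ℝ) (n : ℕ), (x ^ n) ^ 2 = (x ^ 2) ^ n := fun x n => by
    rw [← pow_mul, ← pow_mul, mul_comm]
  have h1 : ∀ n, 1 ≤ r ^ n * (max a b) ^ n := fun n => by
    rw [← mul_pow]; exact one_le_pow₀ hab
  rw [e, e, e, e, ← ha, ← hb]
  constructor
  · exact (h1 m).trans (by gcongr; exact hpow m)
  · calc a + b ≤ 2 * max a b := by linarith [le_max_left a b, le_max_right a b]
      _ ≤ 2 * max a b * (r ^ m * (max a b) ^ m) := le_mul_of_one_le_right (by positivity) (h1 m)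
      _ = 2 * r ^ m * (max a b) ^ (m + 1) := by ring
      _ ≤ _ := by gcongr; exact hpow _

/-- Approximation by trigonometric polynomials in `L²`. -/
theorem IsTail.norm_sq_le {L : Fin 2 → ℝ} (hL : ∀ j, 0 < L j) {N m : ℕ} (hN : 1 ≤ N)
    (hm : 1 ≤ m) {r : L2 L} {u : Sob L m} (h : IsTail L N (toL2 L u) r) :
    ‖r‖ ^ 2 ≤ (poincare L / N ^ 2) ^ m * ‖u‖ ^ 2 := by
  have hr0 : 0 ≤ (poincare L / N ^ 2) ^ m :=
    pow_nonneg (div_nonneg (poincare_pos hL).le (by positivity)) _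
  have h1 := sum_norm_sq_le_of_coef hL (fun _ : Unit => 1)
    (fun _ : Fin 2 => (poincare L / N ^ 2) ^ m) (fun _ => r)
    ![weakDeriv L ⟨(m, 0), by simp⟩ u, weakDeriv L ⟨(0, m), by simp⟩ u] (fun ξ => ?_)
  · refine le_trans ?_ (mul_le_mul_of_nonneg_left (norm_sq_sob_ge L hm u) hr0)
    simpa [Fin.sum_univ_two, mul_add] using h1
  · simp only [Fin.sum_univ_two, Matrix.cons_val_zero, Matrix.cons_val_one, Finset.univ_unique,
      Finset.sum_singleton, norm_sq_coef_weakDeriv hL, wavePow, pow_zero, mul_one, one_mul]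
    rw [h ξ]
    split_ifs with hξ
    · simp only [norm_zero, ne_eq, OfNat.ofNat_ne_zero, not_false_eq_true, zero_pow]
      exact add_nonneg (mul_nonneg hr0 (by positivity)) (mul_nonneg hr0 (by positivity))
    · have h2 := mul_le_mul_of_nonneg_right (tail_weight hL hN hξ m).1
        (sq_nonneg ‖coef L ξ (toL2 L u)‖)
      calc _ = 1 * ‖coef L ξ (toL2 L u)‖ ^ 2 := by ring
        _ ≤ _ := h2
        _ = _ := by ring

/-- Approximation by trigonometric polynomials in `H¹`: one power of `N` is lost. -/
theorem IsTail.gradSq_le {L : Fin 2 → ℝ} (hL : ∀ j, 0 < L j) {N m : ℕ} (hN : 1 ≤ N)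
    (hm : 1 ≤ m) {r : Sob L 2} {u : Sob L m} (h : IsTail L N (toL2 L u) (toL2 L r)) :
    gradSq L r ≤ 2 * (poincare L / N ^ 2) ^ (m - 1) * ‖u‖ ^ 2 := by
  have hr0 : 0 ≤ 2 * (poincare L / N ^ 2) ^ (m - 1) :=
    mul_nonneg zero_le_two (pow_nonneg (div_nonneg (poincare_pos hL).le (by positivity)) _)
  have h1 := sum_norm_sq_le_of_coef hL (fun _ : Fin 2 => 1)
    (fun _ : Fin 2 => 2 * (poincare L / N ^ 2) ^ (m - 1)) ![deriv1 L 0 r, deriv1 L 1 r]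
    ![weakDeriv L ⟨(m, 0), by simp⟩ u, weakDeriv L ⟨(0, m), by simp⟩ u] (fun ξ => ?_)
  · refine le_trans ?_ (mul_le_mul_of_nonneg_left (norm_sq_sob_ge L hm u) hr0)
    simpa [Fin.sum_univ_two, mul_add, gradSq] using h1
  · simp only [Fin.sum_univ_two, Matrix.cons_val_zero, Matrix.cons_val_one,
      norm_sq_coef_weakDeriv hL, norm_sq_coef_deriv1 hL, wavePow, pow_zero, mul_one, one_mul]
    rw [h ξ]
    split_ifs with hξ
    · simp only [norm_zero, ne_eq, OfNat.ofNat_ne_zero, not_false_eq_true, zero_pow, mul_zero,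
        add_zero]
      exact add_nonneg (mul_nonneg hr0 (by positivity)) (mul_nonneg hr0 (by positivity))
    · have h2 := mul_le_mul_of_nonneg_right (tail_weight hL hN hξ (m - 1)).2
        (sq_nonneg ‖coef L ξ (toL2 L u)‖)
      rw [Nat.sub_add_cancel hm] at h2
      calc _ = _ := by ring
        _ ≤ _ := h2
        _ = _ := by ring

/-! ### The current and its potential -/

/-- The Ehrlich-Schwoebel current `J(v) = Φ_k(|v|) v`. -/
def current (k : ESModel) (α p q : ℝ) (v : Plane) : Plane := Phi k α p q ‖v‖ • v

theorem current_zero (k : ESModel) (α p q : ℝ) : current k α p q 0 = 0 := by simp [current]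

theorem norm_radial_sub_le {A B : ℝ} {φ : ℝ → ℝ} (hA : ∀ s, 0 ≤ s → |φ s| ≤ A)
    (hB : ∀ s t, 0 ≤ s → 0 ≤ t → |φ s - φ t| * t ≤ B * |s - t|) (hB0 : 0 ≤ B) (v w : Plane) :
    ‖φ ‖v‖ • v - φ ‖w‖ • w‖ ≤ (A + B) * ‖v - w‖ := by
  have e : φ ‖v‖ • v - φ ‖w‖ • w = φ ‖v‖ • (v - w) + (φ ‖v‖ - φ ‖w‖) • w := by
    rw [smul_sub, sub_smul]; abel
  rw [e]
  refine (norm_add_le _ _).trans ?_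
  rw [norm_smul, norm_smul, Real.norm_eq_abs, Real.norm_eq_abs, add_mul]
  refine add_le_add (mul_le_mul_of_nonneg_right (hA _ (norm_nonneg _)) (norm_nonneg _)) ?_
  refine (hB _ _ (norm_nonneg _) (norm_nonneg _)).trans ?_
  exact mul_le_mul_of_nonneg_left (abs_norm_sub_norm_le v w) hB0

theorem abs_inv_sub_inv_mul_le {a c s t : ℝ} (ha : 0 < a) (hc : 0 < c) (hs : 0 ≤ s) (ht : 0 ≤ t) :
    |(a + c * s)⁻¹ - (a + c * t)⁻¹| * t ≤ a⁻¹ * |s - t| := by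
  have h1 : 0 < a + c * s := by positivity
  have h2 : 0 < a + c * t := by positivity
  have e : (a + c * s)⁻¹ - (a + c * t)⁻¹ = (c / ((a + c * s) * (a + c * t))) * (t - s) := by
    field_simp
    ring
  rw [e, abs_mul, abs_of_pos (by positivity), abs_sub_comm t s]
  have h3 : c / ((a + c * s) * (a + c * t)) * t ≤ a⁻¹ := by
    rw [div_mul_eq_mul_div, div_le_iff₀ (by positivity), inv_mul_eq_div, le_div_iff₀ ha]
    have : 0 ≤ c * s := by positivity
    have : 0 ≤ c * t := by positivity
    nlinarith
  calc _ = c / ((a + c * s) * (a + c * t)) * t * |s - t| := by ring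
    _ ≤ _ := mul_le_mul_of_nonneg_right h3 (abs_nonneg _)

/-- The current is globally Lipschitz. -/
theorem exists_lipschitzWith_current (k : ESModel) {α p q : ℝ} (hα : 0 < α) (hp : 0 < p)
    (hpq : p < q) : ∃ K, LipschitzWith K (current k α p q) := by
  have hq : 0 < q := hp.trans hpq
  suffices h : ∃ A B : ℝ, 0 ≤ B ∧ (∀ s, 0 ≤ s → |Phi k α p q s| ≤ A) ∧
      ∀ s t, 0 ≤ s → 0 ≤ t → |Phi k α p q s - Phi k α p q t| * t ≤ B * |s - t| by
    obtain ⟨A, B, hB0, hA, hB⟩ := h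
    have hA0 : 0 ≤ A := (abs_nonneg _).trans (hA 0 le_rfl)
    refine ⟨⟨A + B, by positivity⟩, LipschitzWith.of_dist_le_mul fun v w => ?_⟩
    rw [dist_eq_norm, dist_eq_norm]
    exact norm_radial_sub_le hA hB hB0 v w
  cases k with
  | one =>
    -- partial fractions: `Φ₁(s) = α (1 / (p + s) - 1 / (q + s))`
    have e : ∀ s, 0 ≤ s → Phi .one α p q s = α * ((p + 1 * s)⁻¹ - (q + 1 * s)⁻¹) := by
      intro s hs
      have : p + 1 * s ≠ 0 := by positivity
      have : q + 1 * s ≠ 0 := by positivity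
      have : p + s ≠ 0 := by positivity
      have : q + s ≠ 0 := by positivity
      simp only [Phi]
      field_simp
      ring
    refine ⟨α * p⁻¹, α * (p⁻¹ + q⁻¹), by positivity, fun s hs => ?_, fun s t hs ht => ?_⟩
    · have h1 : (q + 1 * s)⁻¹ ≤ (p + 1 * s)⁻¹ := by gcongr
      have h2 : (p + 1 * s)⁻¹ ≤ p⁻¹ := by gcongr; linarith
      have h3 : 0 ≤ (q + 1 * s)⁻¹ := by positivity
      rw [e s hs, abs_mul, abs_of_pos hα, abs_of_nonneg (by linarith)]
      gcongr
      linarith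
    · have h1 := abs_inv_sub_inv_mul_le hp one_pos hs ht
      have h2 := abs_inv_sub_inv_mul_le hq one_pos hs ht
      rw [e s hs, e t ht, ← mul_sub, abs_mul, abs_of_pos hα, mul_assoc, mul_assoc]
      refine mul_le_mul_of_nonneg_left ?_ hα.le
      have h3 : |(p + 1 * s)⁻¹ - (q + 1 * s)⁻¹ - ((p + 1 * t)⁻¹ - (q + 1 * t)⁻¹)|
          ≤ |(p + 1 * s)⁻¹ - (p + 1 * t)⁻¹| + |(q + 1 * s)⁻¹ - (q + 1 * t)⁻¹| := by
        refine le_trans (le_of_eq ?_) (abs_sub _ _)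
        congr 1
        ring
      calc _ ≤ _ := mul_le_mul_of_nonneg_right h3 ht
        _ ≤ _ := by rw [add_mul, add_mul]; exact add_le_add h1 h2
  | two =>
    have e : ∀ s, Phi .two α p q s = α * (q + ((p + q) / p) * s)⁻¹ := by
      intro s
      simp only [Phi]
      rw [div_eq_mul_inv, div_mul_eq_mul_div]
    refine ⟨α * q⁻¹, α * q⁻¹, by positivity, fun s hs => ?_, fun s t hs ht => ?_⟩
    · rw [e, abs_of_nonneg (by positivity)]
      gcongr
      have : 0 ≤ (p + q) / p * s := by positivity
      linarith
    · have h1 := abs_inv_sub_inv_mul_le hq (div_pos (add_pos hp hq) hp) hs ht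
      rw [e, e, ← mul_sub, abs_mul, abs_of_pos hα, mul_assoc, mul_assoc]
      exact mul_le_mul_of_nonneg_left h1 hα.le

/-- The gradient of a radial function `g(|v|)` with `g'(s) = c(s) s`; no exception has to be made
for the origin since `g'(0) = 0`. -/
theorem hasGradientAt_radial {g c : ℝ → ℝ} (hg : ∀ s, 0 ≤ s → HasDerivAt g (c s * s) s)
    (v : Plane) : HasGradientAt (fun w => g ‖w‖) (c ‖v‖ • v) v := by
  rw [hasGradientAt_iff_hasFDerivAt]
  by_cases hv : v = 0
  · subst hv
    have h0 := hg 0 le_rfl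
    rw [mul_zero, hasDerivAt_iff_isLittleO] at h0
    simp only [norm_zero, smul_zero, map_zero]
    rw [hasFDerivAt_iff_isLittleO]
    have ht : Filter.Tendsto (fun w : Plane => ‖w‖) (nhds 0) (nhds 0) := by
      simpa using (continuous_norm (E := Plane)).tendsto 0
    have h1 := h0.comp_tendsto ht
    have h2 : (fun w : Plane => g ‖w‖ - g 0) =o[nhds 0] fun w => ‖w‖ := by
      simpa [Function.comp_def] using h1
    simpa using h2.of_norm_right
  · have hpos : 0 < ‖v‖ := norm_pos_iff.2 hv
    have hsq : HasFDerivAt (fun w : Plane => ‖w‖ ^ 2) (2 • innerSL ℝ v) v :=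
      (hasStrictFDerivAt_norm_sq v).hasFDerivAt
    have hs : HasFDerivAt (fun w : Plane => Real.sqrt (‖w‖ ^ 2))
        ((1 / (2 * Real.sqrt (‖v‖ ^ 2))) • (2 • innerSL ℝ v)) v := hsq.sqrt (by positivity)
    simp only [Real.sqrt_sq (norm_nonneg _)] at hs
    have h := (hg ‖v‖ hpos.le).comp_hasFDerivAt v hs
    refine h.congr_fderiv ?_
    ext w
    simp
    field_simp

theorem hasDerivAt_potential_one {α p q s : ℝ} (hp : 0 < p) (hq : 0 < q) (hs : 0 ≤ s) :
    HasDerivAt (fun s => α * (p * Real.log (p + s) - q * Real.log (q + s)))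
      (-Phi .one α p q s * s) s := by
  have h1 : p + s ≠ 0 := by positivity
  have h2 : q + s ≠ 0 := by positivity
  have h := (((((hasDerivAt_id s).const_add p).log h1).const_mul p).sub
    ((((hasDerivAt_id s).const_add q).log h2).const_mul q)).const_mul α
  refine h.congr_deriv ?_
  simp only [id, Phi]
  field_simp
  ring

theorem hasDerivAt_potential_two {α p q s : ℝ} (hp : 0 < p) (hq : 0 < q) (hs : 0 ≤ s) :
    HasDerivAt (fun s => α * (-(p / (p + q)) * s
      + p ^ 2 * q / (p + q) ^ 2 * Real.log (p * q / (p + q) + s)))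
      (-Phi .two α p q s * s) s := by
  have h1 : p * q / (p + q) + s ≠ 0 := by positivity
  have h := (((hasDerivAt_id s).const_mul (-(p / (p + q)))).add
    ((((hasDerivAt_id s).const_add (p * q / (p + q))).log h1).const_mul
      (p ^ 2 * q / (p + q) ^ 2))).const_mul α
  refine h.congr_deriv ?_
  have h3 : q + (p + q) * s / p ≠ 0 := by positivity
  have h4 : p * q + s * (p + q) ≠ 0 := by positivity
  have h5 : q * p + (p + q) * s ≠ 0 := by positivity
  have h6 : p + q ≠ 0 := by positivity
  simp only [id, Phi]
  field_simp
  ring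

theorem hasGradientAt_G (k : ESModel) {α p q : ℝ} (hp : 0 < p) (hq : 0 < q) (v : Plane) :
    HasGradientAt (G k α p q) (-current k α p q v) v := by
  rw [current, ← neg_smul]
  cases k with
  | one =>
    exact hasGradientAt_radial (c := fun s => -Phi .one α p q s)
      (fun s hs => hasDerivAt_potential_one hp hq hs) v
  | two =>
    exact hasGradientAt_radial (c := fun s => -Phi .two α p q s)
      (fun s hs => hasDerivAt_potential_two hp hq hs) v

theorem hasGradientAt_Gplus (χ : ℝ) (v : Plane) : HasGradientAt (Gplus χ) (χ • v) v := by
  refine hasGradientAt_radial (g := fun s => 1 / 2 * χ * s ^ 2) (c := fun _ => χ)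
    (fun s _ => ?_) v
  refine ((hasDerivAt_pow 2 s).const_mul (1 / 2 * χ)).congr_deriv ?_
  push_cast
  ring

theorem gradient_Gplus (χ : ℝ) (v : Plane) : gradient (Gplus χ) v = χ • v :=
  (hasGradientAt_Gplus χ v).gradient

theorem gradient_Gminus (k : ESModel) {α p q : ℝ} (hp : 0 < p) (hq : 0 < q) (χ : ℝ) (v : Plane) :
    gradient (Gminus k α p q χ) v = -current k α p q v - χ • v := by
  have h1 := (hasGradientAt_G k (α := α) hp hq v).hasFDerivAt
  have h2 := (hasGradientAt_Gplus χ v).hasFDerivAt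
  have h3 := h1.sub h2
  rw [← map_sub] at h3
  exact (hasGradientAt_iff_hasFDerivAt.2 h3).gradient

/-! ### The forms of the weak problem -/

/-- The gradient as a continuous linear map from `H²_per(Ω)` to `L²(Ω; ℝ²)`. -/
def gradL (L : Fin 2 → ℝ) : Sob L 2 →L[ℝ] Lp Plane 2 (cellMeasure L) :=
  ∑ j : Fin 2, (ContinuousLinearMap.compLpL 2 (cellMeasure L)
    (ContinuousLinearMap.toSpanSingleton ℝ (EuclideanSpace.single j (1 : ℝ) : Plane))).comp
      (deriv1 L j)

theorem coeFn_gradL (L : Fin 2 → ℝ) (u : Sob L 2) : gradL L u =ᵐ[cellMeasure L] grad L u := by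
  have h : gradL L u = ContinuousLinearMap.compLpL 2 (cellMeasure L)
      (ContinuousLinearMap.toSpanSingleton ℝ (EuclideanSpace.single 0 (1 : ℝ) : Plane))
        (deriv1 L 0 u) + ContinuousLinearMap.compLpL 2 (cellMeasure L)
      (ContinuousLinearMap.toSpanSingleton ℝ (EuclideanSpace.single 1 (1 : ℝ) : Plane))
        (deriv1 L 1 u) := by
    simp [gradL, Fin.sum_univ_two]
  rw [h]
  filter_upwards [Lp.coeFn_add (ContinuousLinearMap.compLpL 2 (cellMeasure L)
      (ContinuousLinearMap.toSpanSingleton ℝ (EuclideanSpace.single 0 (1 : ℝ) : Plane))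
        (deriv1 L 0 u)) (ContinuousLinearMap.compLpL 2 (cellMeasure L)
      (ContinuousLinearMap.toSpanSingleton ℝ (EuclideanSpace.single 1 (1 : ℝ) : Plane))
        (deriv1 L 1 u)),
    ContinuousLinearMap.coeFn_compLpL (p := 2) (μ := cellMeasure L)
      (ContinuousLinearMap.toSpanSingleton ℝ (EuclideanSpace.single 0 (1 : ℝ) : Plane))
      (deriv1 L 0 u),
    ContinuousLinearMap.coeFn_compLpL (p := 2) (μ := cellMeasure L)
      (ContinuousLinearMap.toSpanSingleton ℝ (EuclideanSpace.single 1 (1 : ℝ) : Plane))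
      (deriv1 L 1 u)] with x h1 h2 h3
  rw [h1, Pi.add_apply, h2, h3]
  ext i
  fin_cases i <;> simp [grad, deriv1]

theorem inner_gradL (L : Fin 2 → ℝ) (u v : Sob L 2) :
    inner ℝ (gradL L u) (gradL L v)
      = ∫ x, inner ℝ (grad L u x) (grad L v x) ∂(cellMeasure L) := by
  rw [L2.inner_def]
  refine integral_congr_ae ?_
  filter_upwards [coeFn_gradL L u, coeFn_gradL L v] with x h1 h2
  rw [h1, h2]

theorem inner_gradL_eq_sum (L : Fin 2 → ℝ) (u v : Sob L 2) :
    (inner ℝ (gradL L u) (gradL L v) : ℝ)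
      = inner ℝ (deriv1 L 0 u) (deriv1 L 0 v) + inner ℝ (deriv1 L 1 u) (deriv1 L 1 v) := by
  rw [inner_gradL, L2.inner_def, L2.inner_def, ← integral_add (L2.integrable_inner _ _)
    (L2.integrable_inner _ _)]
  refine integral_congr_ae (Filter.Eventually.of_forall fun x => ?_)
  simp [grad, deriv1, PiLp.inner_apply, Fin.sum_univ_two]

theorem norm_sq_gradL (L : Fin 2 → ℝ) (u : Sob L 2) : ‖gradL L u‖ ^ 2 = gradSq L u := by
  rw [← real_inner_self_eq_norm_sq, inner_gradL_eq_sum, real_inner_self_eq_norm_sq,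
    real_inner_self_eq_norm_sq, gradSq]

theorem integral_inner_current {L : Fin 2 → ℝ} {k : ESModel} {α p q : ℝ} {K : NNReal}
    (hK : LipschitzWith K (current k α p q)) (u v : Sob L 2) :
    ∫ x, inner ℝ (current k α p q (grad L u x)) (grad L v x) ∂(cellMeasure L)
      = inner ℝ (hK.compLp (current_zero k α p q) (gradL L u)) (gradL L v) := by
  rw [L2.inner_def]
  refine integral_congr_ae ?_
  filter_upwards [coeFn_gradL L u, coeFn_gradL L v,
    hK.coeFn_compLp (current_zero k α p q) (gradL L u)] with x h1 h2 h3
  rw [h3, Function.comp_apply, h1, h2]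

theorem formPlus_eq (L : Fin 2 → ℝ) (χ γ ε : ℝ) (u v : Sob L 2) :
    formPlus L χ γ ε u v = (γ + χ) * inner ℝ (gradL L u) (gradL L v)
      + ε ^ 2 * inner ℝ (lapCLM L u) (lapCLM L v) := by
  simp only [formPlus, gradient_Gplus, real_inner_smul_left, integral_const_mul, ← inner_gradL,
    lapCLM_apply]
  ring

theorem formA_eq {L : Fin 2 → ℝ} {k : ESModel} {α p q : ℝ} {K : NNReal}
    (hK : LipschitzWith K (current k α p q)) (γ ε : ℝ) (u v : Sob L 2) :
    formA L k α p q γ ε u v = γ * inner ℝ (gradL L u) (gradL L v)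
      + ε ^ 2 * inner ℝ (lapCLM L u) (lapCLM L v)
      - inner ℝ (hK.compLp (current_zero k α p q) (gradL L u)) (gradL L v) := by
  rw [← integral_inner_current, formA, inner_gradL, lapCLM_apply, lapCLM_apply]
  simp only [current, real_inner_smul_left]

theorem formMinus_eq {L : Fin 2 → ℝ} {k : ESModel} {α p q : ℝ} (hp : 0 < p) (hq : 0 < q)
    {K : NNReal} (hK : LipschitzWith K (current k α p q)) (χ : ℝ) (u v : Sob L 2) :
    formMinus L k α p q χ u v
      = -inner ℝ (hK.compLp (current_zero k α p q) (gradL L u)) (gradL L v)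
        - χ * inner ℝ (gradL L u) (gradL L v) := by
  have hi : Integrable (fun x => inner ℝ (current k α p q (grad L u x)) (grad L v x))
      (cellMeasure L) := by
    refine (L2.integrable_inner (𝕜 := ℝ) (hK.compLp (current_zero k α p q) (gradL L u))
      (gradL L v)).congr ?_
    filter_upwards [coeFn_gradL L u, coeFn_gradL L v,
      hK.coeFn_compLp (current_zero k α p q) (gradL L u)] with x h1 h2 h3
    rw [h3, Function.comp_apply, h1, h2]
  have hi' : Integrable (fun x => inner ℝ (grad L u x) (grad L v x)) (cellMeasure L) := by
    refine (L2.integrable_inner (𝕜 := ℝ) (gradL L u) (gradL L v)).congr ?_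
    filter_upwards [coeFn_gradL L u, coeFn_gradL L v] with x h1 h2
    rw [h1, h2]
  rw [← integral_inner_current, inner_gradL, formMinus, ← integral_const_mul, ← integral_neg,
    ← integral_sub (by exact hi.neg) (hi'.const_mul χ)]
  refine integral_congr_ae (Filter.Eventually.of_forall fun x => ?_)
  simp only [gradient_Gminus k hp hq, inner_sub_left, inner_neg_left, real_inner_smul_left]

/-- The splitting is consistent: `a = a_+ + a_-`. -/
theorem formA_eq_add {L : Fin 2 → ℝ} {k : ESModel} {α p q : ℝ} (hp : 0 < p) (hq : 0 < q)
    {K : NNReal} (hK : LipschitzWith K (current k α p q)) (χ γ ε : ℝ) (u v : Sob L 2) :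
    formA L k α p q γ ε u v = formPlus L χ γ ε u v + formMinus L k α p q χ u v := by
  rw [formA_eq hK, formPlus_eq, formMinus_eq hp hq hK]
  ring

theorem abs_formMinus_sub_le {L : Fin 2 → ℝ} {k : ESModel} {α p q : ℝ} (hp : 0 < p) (hq : 0 < q)
    {K : NNReal} (hK : LipschitzWith K (current k α p q)) (χ : ℝ) (u u' v : Sob L 2) :
    |formMinus L k α p q χ u v - formMinus L k α p q χ u' v|
      ≤ (K + |χ|) * ‖gradL L (u - u')‖ * ‖gradL L v‖ := by
  have e : formMinus L k α p q χ u v - formMinus L k α p q χ u' v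
      = -(inner ℝ (hK.compLp (current_zero k α p q) (gradL L u)
          - hK.compLp (current_zero k α p q) (gradL L u')) (gradL L v)
        + χ * inner ℝ (gradL L (u - u')) (gradL L v)) := by
    rw [formMinus_eq hp hq hK, formMinus_eq hp hq hK, map_sub, inner_sub_left, inner_sub_left]
    ring
  rw [e, abs_neg, add_mul, add_mul]
  refine (abs_add_le _ _).trans (add_le_add ?_ ?_)
  · refine (abs_real_inner_le_norm _ _).trans (mul_le_mul_of_nonneg_right ?_ (norm_nonneg _))
    rw [map_sub]
    exact hK.norm_compLp_sub_le _ _ _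
  · rw [abs_mul, mul_assoc]
    exact mul_le_mul_of_nonneg_left (abs_real_inner_le_norm _ _) (abs_nonneg _)

theorem continuous_formA {L : Fin 2 → ℝ} {k : ESModel} {α p q : ℝ} {K : NNReal}
    (hK : LipschitzWith K (current k α p q)) (γ ε : ℝ) (v : Sob L 2) :
    Continuous fun u => formA L k α p q γ ε u v := by
  simp only [formA_eq hK]
  have := hK.continuous_compLp (p := 2) (μ := cellMeasure L) (current_zero k α p q)
  fun_prop

/-! ### Weak derivatives in time -/

section WeakTime

variable {V W : Type*} [NormedAddCommGroup V] [NormedSpace ℝ V] [NormedAddCommGroup W]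
  [NormedSpace ℝ W] {a b : ℝ} {u g : ℝ → V}

theorem integrableOn_test_smul (hu : IntegrableOn u (Ioo a b)) {η : ℝ → ℝ} (hη : Continuous η)
    (hc : HasCompactSupport η) : IntegrableOn (fun t => η t • u t) (Ioo a b) := by
  obtain ⟨C, hC⟩ := hη.bounded_above_of_compact_support hc
  exact Integrable.bdd_smul hu C hη.aestronglyMeasurable (Filter.Eventually.of_forall hC)

/-- Weak derivatives are unique. -/
theorem IsWeakTimeDeriv.unique [CompleteSpace V] {g' : ℝ → V} (h : IsWeakTimeDeriv a b u g)
    (h' : IsWeakTimeDeriv a b u g') : ∀ᵐ t ∂volume.restrict (Ioo a b), g t = g' t := by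
  rw [ae_restrict_iff' measurableSet_Ioo]
  have hint : IntegrableOn (fun t => g t - g' t) (Ioo a b) := h.2.1.sub h'.2.1
  have h0 := isOpen_Ioo.ae_eq_zero_of_integral_contDiff_smul_eq_zero (μ := volume)
    hint.locallyIntegrableOn (fun η hη hc hs => ?_)
  · filter_upwards [h0] with t ht hmem
    exact sub_eq_zero.1 (ht hmem)
  · have e1 := h.2.2 η hη hc hs
    have e2 := h'.2.2 η hη hc hs
    rw [e1, neg_inj] at e2
    rw [← setIntegral_eq_integral_of_forall_compl_eq_zero (s := Ioo a b)]
    · simp_rw [smul_sub]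
      rw [integral_sub (integrableOn_test_smul h.2.1 hη.continuous hc)
        (integrableOn_test_smul h'.2.1 hη.continuous hc), e2, sub_self]
    · intro t ht
      rw [image_eq_zero_of_notMem_tsupport (fun hm => ht (hs hm)), zero_smul]

theorem IsWeakTimeDeriv.mono {a' b' : ℝ} (h : IsWeakTimeDeriv a b u g) (ha : a ≤ a')
    (hb : b' ≤ b) : IsWeakTimeDeriv a' b' u g := by
  have hsub : Ioo a' b' ⊆ Ioo a b := Ioo_subset_Ioo ha hb
  refine ⟨h.1.mono_set hsub, h.2.1.mono_set hsub, fun η hη hc hs => ?_⟩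
  have h1 := h.2.2 η hη hc (hs.trans hsub)
  rw [setIntegral_eq_of_subset_of_forall_sdiff_eq_zero measurableSet_Ioo hsub fun t ht => ?_,
    setIntegral_eq_of_subset_of_forall_sdiff_eq_zero measurableSet_Ioo hsub fun t ht => ?_] at h1
  · exact h1
  · rw [image_eq_zero_of_notMem_tsupport (fun hm => ht.2 (hs hm)), zero_smul]
  · have : deriv η t = 0 :=
      Function.notMem_support.1 fun hm => ht.2 (hs (support_deriv_subset hm))
    rw [this, zero_smul]

theorem IsWeakTimeDeriv.clm [CompleteSpace V] [CompleteSpace W] (A : V →L[ℝ] W)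
    (h : IsWeakTimeDeriv a b u g) :
    IsWeakTimeDeriv a b (fun t => A (u t)) (fun t => A (g t)) := by
  refine ⟨A.integrable_comp h.1, A.integrable_comp h.2.1, fun η hη hc hs => ?_⟩
  have h1 := congrArg A (h.2.2 η hη hc hs)
  rw [map_neg, ← A.integral_comp_comm (integrableOn_test_smul h.1
      (hη.continuous_deriv (by simp)) hc.deriv),
    ← A.integral_comp_comm (integrableOn_test_smul h.2.1 hη.continuous hc)] at h1
  simpa only [map_smul] using h1

/-- Integration by parts against the primitive of an integrable function. -/
theorem integral_deriv_smul_primitive [CompleteSpace V] (hg : IntegrableOn g (Ioo a b))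
    {η : ℝ → ℝ} (hη : ContDiff ℝ ∞ η) (hc : HasCompactSupport η) (hs : tsupport η ⊆ Ioo a b) :
    ∫ t in Ioo a b, deriv η t • ∫ s in a..t, g s = -∫ t in Ioo a b, η t • g t := by
  have hη' : Continuous (deriv η) := hη.continuous_deriv (by simp)
  have hηi : IntegrableOn (deriv η) (Ioo a b) :=
    (hη'.integrable_of_hasCompactSupport hc.deriv).integrableOn
  set f : ℝ → ℝ → V := fun t s => (Iic t).indicator (fun s => deriv η t • g s) s with hf
  have hfint : Integrable (Function.uncurry f)
      ((volume.restrict (Ioo a b)).prod (volume.restrict (Ioo a b))) := by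
    have h1 := (Integrable.smul_prod hηi hg).indicator
      (measurableSet_le measurable_snd measurable_fst)
    refine h1.congr (Filter.Eventually.of_forall fun p => ?_)
    simp [hf, Function.uncurry, Set.indicator]
  have hswap := integral_integral_swap hfint
  have hL : ∀ t ∈ Ioo a b, ∫ s in Ioo a b, f t s = deriv η t • ∫ s in a..t, g s := by
    intro t ht
    simp only [hf]
    rw [integral_indicator measurableSet_Iic, integral_smul,
      Measure.restrict_restrict measurableSet_Iic, intervalIntegral.integral_of_le ht.1.le]
    congr 3
    ext s
    simp only [mem_inter_iff, mem_Iic, mem_Ioo, mem_Ioc]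
    exact ⟨fun h => ⟨h.2.1, h.1⟩, fun h => ⟨h.2, h.1, h.2.trans_lt ht.2⟩⟩
  have hR : ∀ s ∈ Ioo a b, ∫ t in Ioo a b, f t s = -(η s • g s) := by
    intro s hs'
    have e1 : ∀ t, f t s = (Ici s).indicator (fun t => deriv η t • g s) t := fun t => by
      simp [hf, Set.indicator]
    simp_rw [e1]
    rw [integral_indicator measurableSet_Ici, integral_smul_const,
      Measure.restrict_restrict measurableSet_Ici]
    have e2 : Ici s ∩ Ioo a b = Ico s b := by
      ext t
      simp only [mem_inter_iff, mem_Ici, mem_Ioo, mem_Ico]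
      exact ⟨fun h => ⟨h.1, h.2.2⟩, fun h => ⟨h.1, hs'.1.trans_le h.1, h.2⟩⟩
    have e3 : η b = 0 := image_eq_zero_of_notMem_tsupport fun hm => (hs hm).2.false
    rw [e2, integral_Ico_eq_integral_Ioc, ← intervalIntegral.integral_of_le hs'.2.le,
      intervalIntegral.integral_deriv_eq_sub
        (fun t _ => (hη.differentiable (by simp)).differentiableAt)
        (hη'.intervalIntegrable _ _), e3, zero_sub, neg_smul]
  rw [setIntegral_congr_fun measurableSet_Ioo hL, setIntegral_congr_fun measurableSet_Ioo hR,
    integral_neg] at hswap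
  exact hswap

/-- A smooth function with compact support in `(a, b)` and vanishing integral has a primitive with
compact support in `(a, b)`. -/
theorem exists_test_primitive {φ : ℝ → ℝ} (hφ : ContDiff ℝ ∞ φ) (hc : HasCompactSupport φ)
    (hs : tsupport φ ⊆ Ioo a b) (h0 : ∫ t in Ioo a b, φ t = 0) :
    ∃ η : ℝ → ℝ, ContDiff ℝ ∞ η ∧ HasCompactSupport η ∧ tsupport η ⊆ Ioo a b ∧ deriv η = φ := by
  rcases (tsupport φ).eq_empty_or_nonempty with hemp | hne
  · refine ⟨0, contDiff_const, HasCompactSupport.zero, by simp, ?_⟩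
    rw [tsupport_eq_empty_iff.1 hemp]
    ext t
    simp
  obtain ⟨c, hcm, hcl⟩ := hc.exists_isLeast hne
  obtain ⟨d, hdm, hdg⟩ := hc.exists_isGreatest hne
  have hac := (hs hcm).1
  have hdb := (hs hdm).2
  have hcd : c ≤ d := hcl hdm
  have hout : ∀ t, t ∉ Icc c d → φ t = 0 := fun t ht =>
    image_eq_zero_of_notMem_tsupport fun hm => ht ⟨hcl hm, hdg hm⟩
  have hder : ∀ t, HasDerivAt (fun t => ∫ s in a..t, φ s) (φ t) t := fun t =>
    (hφ.continuous.integral_hasStrictDerivAt a t).hasDerivAt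
  have hderiv : deriv (fun t => ∫ s in a..t, φ s) = φ := funext fun t => (hder t).deriv
  have hzero : ∀ t, t ∉ Icc c d → ∫ s in a..t, φ s = 0 := by
    intro t ht
    by_cases htc : t < c
    · rw [intervalIntegral.integral_congr (g := fun _ => (0 : ℝ)) fun s hs' => ?_]
      · simp
      · refine hout s fun hm => ?_
        have : s ≤ max a t := hs'.2
        exact absurd (hm.1.trans this) (not_le.2 (max_lt hac htc))
    · have hdt : d < t := by
        by_contra! h
        exact ht ⟨not_lt.1 htc, h⟩
      have e1 : ∫ s in a..b, φ s = 0 := by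
        rw [intervalIntegral.integral_of_le (hac.le.trans (hcd.trans hdb.le)),
          integral_Ioc_eq_integral_Ioo, h0]
      have e2 : ∫ s in b..t, φ s = 0 := by
        rw [intervalIntegral.integral_congr (g := fun _ => (0 : ℝ)) fun s hs' => ?_]
        · simp
        · refine hout s fun hm => ?_
          have : min b t ≤ s := hs'.1
          exact absurd (this.trans hm.2) (not_le.2 (lt_min hdb hdt))
      rw [← intervalIntegral.integral_add_adjacent_intervals (hφ.continuous.intervalIntegrable a b)
        (hφ.continuous.intervalIntegrable b t), e1, e2, add_zero]
  have hsupp : tsupport (fun t => ∫ s in a..t, φ s) ⊆ Icc c d := by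
    refine closure_minimal (fun t ht => ?_) isClosed_Icc
    by_contra h
    exact ht (hzero t h)
  refine ⟨fun t => ∫ s in a..t, φ s, ?_, ?_, ?_, hderiv⟩
  · rw [contDiff_infty_iff_deriv, hderiv]
    exact ⟨fun t => (hder t).differentiableAt, hφ⟩
  · exact isCompact_Icc.of_isClosed_subset (isClosed_tsupport _) hsupp
  · exact hsupp.trans fun t ht => ⟨hac.trans_le ht.1, ht.2.trans_lt hdb⟩

/-- **Du Bois-Reymond lemma**: a function with an integrable weak derivative is, up to a constant,
the primitive of that derivative. -/
theorem IsWeakTimeDeriv.exists_eq_primitive [CompleteSpace V] (hab : a < b)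
    (h : IsWeakTimeDeriv a b u g) :
    ∃ c : V, ∀ᵐ t ∂volume.restrict (Ioo a b), u t = c + ∫ s in a..t, g s := by
  set w : ℝ → V := fun t => u t - ∫ s in a..t, g s with hw
  have hgi : IntervalIntegrable g volume a b := by
    rw [intervalIntegrable_iff_integrableOn_Ioo_of_le hab.le]
    exact h.2.1
  have hprim : IntegrableOn (fun t => ∫ s in a..t, g s) (Ioo a b) := by
    have := intervalIntegral.continuousOn_primitive_interval' hgi left_mem_uIcc
    rw [uIcc_of_le hab.le] at this
    exact (this.integrableOn_Icc).mono_set Ioo_subset_Icc_self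
  have hwi : IntegrableOn w (Ioo a b) := h.1.sub hprim
  have hw0 : ∀ η : ℝ → ℝ, ContDiff ℝ ∞ η → HasCompactSupport η → tsupport η ⊆ Ioo a b →
      ∫ t in Ioo a b, deriv η t • w t = 0 := by
    intro η hη hc hs
    have hc' : Continuous (deriv η) := hη.continuous_deriv (by simp)
    simp only [hw, smul_sub]
    rw [integral_sub (integrableOn_test_smul h.1 hc' hc.deriv)
      (integrableOn_test_smul hprim hc' hc.deriv), h.2.2 η hη hc hs,
      integral_deriv_smul_primitive h.2.1 hη hc hs, sub_self]
  -- a reference bump of integral one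
  let B : ContDiffBump ((a + b) / 2) := ⟨(b - a) / 8, (b - a) / 4, by linarith, by linarith⟩
  set ψ : ℝ → ℝ := B.normed volume with hψ
  have hψd : ContDiff ℝ ∞ ψ := B.contDiff_normed
  have hψc : HasCompactSupport ψ := B.hasCompactSupport_normed
  have hψs : tsupport ψ ⊆ Ioo a b := by
    rw [hψ, B.tsupport_normed_eq, Real.closedBall_eq_Icc]
    intro t ht
    simp only [B, mem_Icc] at ht
    constructor <;> linarith [ht.1, ht.2]
  have hψ1 : ∫ t in Ioo a b, ψ t = 1 := by
    rw [setIntegral_eq_integral_of_forall_compl_eq_zero, B.integral_normed]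
    exact fun t ht => image_eq_zero_of_notMem_tsupport fun hm => ht (hψs hm)
  refine ⟨∫ t in Ioo a b, ψ t • w t, ?_⟩
  set c := ∫ t in Ioo a b, ψ t • w t with hcdef
  rw [ae_restrict_iff' measurableSet_Ioo]
  have hint : IntegrableOn (fun t => w t - c) (Ioo a b) := hwi.sub (integrableOn_const (by simp))
  have hz := isOpen_Ioo.ae_eq_zero_of_integral_contDiff_smul_eq_zero (μ := volume)
    hint.locallyIntegrableOn (fun φ hφ hc hs => ?_)
  · filter_upwards [hz] with t ht hmem
    have := ht hmem
    simp only [hw] at this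
    rw [sub_sub, sub_eq_zero] at this
    rw [this, add_comm]
  · rw [← setIntegral_eq_integral_of_forall_compl_eq_zero (s := Ioo a b)]
    swap
    · intro t ht
      rw [image_eq_zero_of_notMem_tsupport (fun hm => ht (hs hm)), zero_smul]
    have hφi : IntegrableOn φ (Ioo a b) :=
      (hφ.continuous.integrable_of_hasCompactSupport hc).integrableOn
    have hψi : IntegrableOn ψ (Ioo a b) :=
      (hψd.continuous.integrable_of_hasCompactSupport hψc).integrableOn
    set m := ∫ t in Ioo a b, φ t with hm
    have hdc : HasCompactSupport (fun t => φ t - m * ψ t) := hc.sub (hψc.mul_left (f := fun _ => m))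
    have hds : tsupport (fun t => φ t - m * ψ t) ⊆ Ioo a b := by
      have hcl : IsClosed (tsupport φ ∪ tsupport ψ) :=
        (isClosed_tsupport φ).union (isClosed_tsupport ψ)
      refine (closure_minimal (fun t ht => ?_) hcl).trans (union_subset hs hψs)
      by_contra hcon
      rw [mem_union, not_or] at hcon
      apply ht
      simp [image_eq_zero_of_notMem_tsupport hcon.1, image_eq_zero_of_notMem_tsupport hcon.2]
    obtain ⟨η, hη, hηc, hηs, hηd⟩ := exists_test_primitive (hφ.sub (contDiff_const.mul hψd)) hdc
      hds (by rw [integral_sub hφi (hψi.const_mul m), integral_const_mul, hψ1, mul_one, hm,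
        sub_self])
    have h1 := hw0 η hη hηc hηs
    rw [hηd] at h1
    simp_rw [sub_smul, mul_smul] at h1
    rw [integral_sub (integrableOn_test_smul hwi hφ.continuous hc)
      (by exact (integrableOn_test_smul hwi hψd.continuous hψc).smul m), integral_smul,
      ← hcdef] at h1
    simp_rw [smul_sub]
    rw [integral_sub (integrableOn_test_smul hwi hφ.continuous hc)
      (hφi.smul_const c), integral_smul_const, ← hm]
    exact h1

theorem integral_sub_primitive [CompleteSpace V] {c : V} {v : ℝ → V}
    (hg : IntervalIntegrable g volume a b) (hv : ∀ t ∈ Icc a b, v t = c + ∫ s in a..t, g s)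
    {s t : ℝ} (hs : s ∈ Icc a b) (ht : t ∈ Icc a b) : v t - v s = ∫ r in s..t, g r := by
  have hI : ∀ r ∈ Icc a b, IntervalIntegrable g volume a r := fun r hr =>
    hg.mono_set (by
      rw [uIcc_of_le hr.1, uIcc_of_le (hr.1.trans hr.2)]; exact Icc_subset_Icc_right hr.2)
  rw [hv t ht, hv s hs, add_sub_add_left_eq_sub,
    intervalIntegral.integral_interval_sub_left (hI t ht) (hI s hs)]

/-- The Cauchy-Schwarz inequality on an interval. -/
theorem sq_integral_le {f : ℝ → ℝ} {s t : ℝ} (hst : s ≤ t) (hf : IntervalIntegrable f volume s t)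
    (hf2 : IntervalIntegrable (fun r => f r ^ 2) volume s t) :
    (∫ r in s..t, f r) ^ 2 ≤ (t - s) * ∫ r in s..t, f r ^ 2 := by
  set I := ∫ r in s..t, f r with hI
  set Q := ∫ r in s..t, f r ^ 2 with hQ
  have h : ∀ c : ℝ, 0 ≤ Q - 2 * c * I + c ^ 2 * (t - s) := by
    intro c
    have h0 : 0 ≤ ∫ r in s..t, (f r - c) ^ 2 :=
      intervalIntegral.integral_nonneg hst fun r _ => sq_nonneg _
    have e : ∫ r in s..t, (f r - c) ^ 2 = ∫ r in s..t, (f r ^ 2 - 2 * c * f r + c ^ 2) :=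
      intervalIntegral.integral_congr fun r _ => by ring
    rw [e, intervalIntegral.integral_add (hf2.sub (hf.const_mul _)) (by simp),
      intervalIntegral.integral_sub hf2 (hf.const_mul _), intervalIntegral.integral_const_mul,
      intervalIntegral.integral_const, smul_eq_mul] at h0
    linarith
  rcases hst.eq_or_lt with rfl | hlt
  · simp [hI]
  · have hpos : 0 < t - s := sub_pos.2 hlt
    have h1 := h (I / (t - s))
    have e : Q - 2 * (I / (t - s)) * I + (I / (t - s)) ^ 2 * (t - s) = Q - I ^ 2 / (t - s) := by
      field_simp
      ring
    rw [e, sub_nonneg, div_le_iff₀ hpos] at h1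
    linarith

end WeakTime

/-! ### Regular representatives of the weak solution -/

theorem integral_mul_eq_inner (L : Fin 2 → ℝ) (u : L2 L) {f : (Fin 2 → ℝ) → ℝ}
    (hf : Continuous f) :
    ∫ x, u x * f x ∂(cellMeasure L) = inner ℝ ((memLp_of_continuous L hf).toLp) u := by
  rw [L2.inner_def]
  refine integral_congr_ae ?_
  filter_upwards [(memLp_of_continuous L hf).coeFn_toLp] with x hx
  rw [hx]
  simp

theorem isClosed_sobolev (L : Fin 2 → ℝ) (m : ℕ) :
    IsClosed (sobolev L m : Set (PiLp 2 fun _ : MultiIndex m => L2 L)) := by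
  have e : (sobolev L m : Set (PiLp 2 fun _ : MultiIndex m => L2 L))
      = ⋂ α : MultiIndex m, ⋂ φ : (Fin 2 → ℝ) → ℝ, ⋂ hφ : IsPeriodicTest L φ,
        {u | (inner ℝ ((memLp_of_continuous L
            (contDiff_mixedDeriv α.1 hφ.1).continuous).toLp) (u ⟨(0, 0), Nat.zero_le m⟩) : ℝ)
          = (-1) ^ (α.1.1 + α.1.2)
            * inner ℝ ((memLp_of_continuous L hφ.1.continuous).toLp) (u α)} := by
    ext u
    simp only [mem_iInter, SetLike.mem_coe]
    refine forall_congr' fun α => forall_congr' fun φ => forall_congr' fun hφ => ?_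
    rw [integral_mul_eq_inner L _ (contDiff_mixedDeriv α.1 hφ.1).continuous,
      integral_mul_eq_inner L _ hφ.1.continuous]
    rfl
  rw [e]
  refine isClosed_iInter fun α => isClosed_iInter fun φ => isClosed_iInter fun hφ => ?_
  exact isClosed_eq (by fun_prop) (by fun_prop)

instance (L : Fin 2 → ℝ) (m : ℕ) : CompleteSpace (Sob L m) :=
  (isClosed_sobolev L m).completeSpace_coe

/-- The inclusion `H^m_per(Ω) → H^l_per(Ω)` for `l ≤ m`. -/
def sobIncl (L : Fin 2 → ℝ) {l m : ℕ} (h : l ≤ m) : Sob L m →L[ℝ] Sob L l :=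
  ((PiLp.continuousLinearEquiv 2 ℝ (fun _ : MultiIndex l => L2 L)).symm.toContinuousLinearMap.comp
    (ContinuousLinearMap.pi fun α : MultiIndex l =>
      weakDeriv L (⟨α.1, α.2.trans h⟩ : MultiIndex m))).codRestrict (sobolev L l)
    fun u α => u.2 ⟨α.1, α.2.trans h⟩

theorem toL2_sobIncl (L : Fin 2 → ℝ) {l m : ℕ} (h : l ≤ m) (u : Sob L m) :
    toL2 L (sobIncl L h u) = toL2 L u := rfl

theorem intervalIntegrable_of_memLp_two {V : Type*} [NormedAddCommGroup V] {a b : ℝ}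
    (hab : a ≤ b) {f : ℝ → V} (hf : MemLp f 2 (volume.restrict (Ioo a b))) :
    IntervalIntegrable f volume a b := by
  rw [intervalIntegrable_iff_integrableOn_Ioo_of_le hab]
  exact hf.integrable (by norm_num)

theorem eqOn_Icc_of_ae_Ioo {V : Type*} [NormedAddCommGroup V] {a b : ℝ} (hab : a < b)
    {f g : ℝ → V} (hf : ContinuousOn f (Icc a b)) (hg : ContinuousOn g (Icc a b))
    (h : ∀ᵐ t ∂volume.restrict (Ioo a b), f t = g t) : EqOn f g (Icc a b) := by
  refine Measure.eqOn_Icc_of_ae_eq volume hab.ne ?_ hf hg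
  rw [← restrict_Ioo_eq_restrict_Icc]
  exact h

theorem continuousOn_primitive {V : Type*} [NormedAddCommGroup V] [NormedSpace ℝ V] {a b s : ℝ}
    (hs : s ∈ Icc a b) {f : ℝ → V} (hf : IntervalIntegrable f volume a b) :
    ContinuousOn (fun t => ∫ r in s..t, f r) (Icc a b) := by
  have hab := hs.1.trans hs.2
  rw [← uIcc_of_le hab] at hs ⊢
  exact intervalIntegral.continuousOn_primitive_interval' hf hs

/-- A weak solution with the regularity of the error estimate has representatives `H` with values
in `H²_per(Ω)` and `V` of the time derivative for which the equation holds at every time. -/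
theorem exists_representatives {L : Fin 2 → ℝ} (hL : ∀ j, 0 < L j) {k : ESModel} {α p q : ℝ}
    {K : NNReal} (hK : LipschitzWith K (current k α p q)) {γ ε T τ : ℝ} (hτ : 0 < τ)
    (hτT : τ ≤ T) {m : ℕ} (hm : 2 ≤ m) {h₀ : L2 L} {ζ h ht htt : ℝ → L2 L} {U : ℝ → Sob L m}
    (hsol : IsWeakSolution L k α p q γ ε T h₀ ζ h) (h1 : IsWeakTimeDeriv 0 τ h ht)
    (h2 : IsWeakTimeDeriv 0 τ ht htt) (hU : IsSobPath L m 2 0 τ ht U) :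
    ∃ (H : ℝ → Sob L 2) (V : ℝ → L2 L),
      ContinuousOn H (Icc 0 τ) ∧ ContinuousOn V (Icc 0 τ) ∧
      (∀ t ∈ Icc 0 τ, toL2 L (H t) = h t) ∧
      (∀ s ∈ Icc 0 τ, ∀ t ∈ Icc 0 τ, H t - H s = sobIncl L hm (∫ r in s..t, U r)) ∧
      (∀ s ∈ Icc 0 τ, ∀ t ∈ Icc 0 τ, V t - V s = ∫ r in s..t, htt r) ∧
      (∀ s ∈ Icc 0 τ, ∀ t ∈ Icc 0 τ, h t - h s = ∫ r in s..t, V r) ∧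
      ∀ Z : ℝ → SobDual L, ContinuousOn Z (Icc 0 τ) →
        (∀ᵐ s ∂volume.restrict (Ioo 0 τ), Z s = toDual L (ζ s)) →
        ∀ t ∈ Icc 0 τ, ∀ φ : Sob L 2,
          inner ℝ (V t) (toL2 L φ) + formA L k α p q γ ε (H t) φ = Z t φ := by
  obtain ⟨hcont, ⟨H₀, F, hH₀, -, hF, heq⟩, -⟩ := hsol
  have hsub : Ioo 0 τ ⊆ Ioo 0 T := Ioo_subset_Ioo_right hτT
  have hcont' : ContinuousOn h (Icc 0 τ) := hcont.mono (Icc_subset_Icc_right hτT)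
  have hH₀' : ∀ᵐ t ∂volume.restrict (Ioo 0 τ), toL2 L (H₀ t) = h t :=
    ae_restrict_of_ae_restrict_of_subset hsub hH₀.2
  have hint1 : IntervalIntegrable ht volume 0 τ :=
    (intervalIntegrable_iff_integrableOn_Ioo_of_le hτ.le).2 h1.2.1
  have hint2 : IntervalIntegrable htt volume 0 τ :=
    (intervalIntegrable_iff_integrableOn_Ioo_of_le hτ.le).2 h2.2.1
  have hUint0 : IntervalIntegrable U volume 0 τ := intervalIntegrable_of_memLp_two hτ.le hU.1
  have hUint : IntervalIntegrable (fun r => sobIncl L hm (U r)) volume 0 τ :=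
    intervalIntegrable_of_memLp_two hτ.le ((sobIncl L hm).comp_memLp' hU.1)
  have hsubI : ∀ {E : Type _} [NormedAddCommGroup E] {f : ℝ → E} {s t : ℝ},
      IntervalIntegrable f volume 0 τ → s ∈ Icc 0 τ → t ∈ Icc 0 τ →
      IntervalIntegrable f volume s t := by
    intro E _ f s t hf hs ht
    refine hf.mono_set ?_
    rw [uIcc_of_le hτ.le]
    exact uIcc_subset_Icc hs ht
  have h0mem : (0 : ℝ) ∈ Icc 0 τ := left_mem_Icc.2 hτ.le
  -- the primitives of the two weak time derivatives
  obtain ⟨c, hc⟩ := h1.exists_eq_primitive hτ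
  have hprim : ∀ t ∈ Icc 0 τ, h t = c + ∫ s in (0 : ℝ)..t, ht s :=
    eqOn_Icc_of_ae_Ioo hτ hcont' (continuousOn_const.add (continuousOn_primitive h0mem hint1)) hc
  obtain ⟨c', hc'⟩ := h2.exists_eq_primitive hτ
  set V : ℝ → L2 L := fun t => c' + ∫ s in (0 : ℝ)..t, htt s with hV
  have hVc : ContinuousOn V (Icc 0 τ) :=
    continuousOn_const.add (continuousOn_primitive h0mem hint2)
  have hVd : ∀ s ∈ Icc 0 τ, ∀ t ∈ Icc 0 τ, V t - V s = ∫ r in s..t, htt r :=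
    fun s hs t ht' => integral_sub_primitive hint2 (fun _ _ => rfl) hs ht'
  have hhd : ∀ s ∈ Icc 0 τ, ∀ t ∈ Icc 0 τ, h t - h s = ∫ r in s..t, ht r :=
    fun s hs t ht' => integral_sub_primitive hint1 hprim hs ht'
  have hae : ∀ {E : Type _} [NormedAddCommGroup E] [NormedSpace ℝ E] {f g : ℝ → E} {s t : ℝ},
      (∀ᵐ r ∂volume.restrict (Ioo 0 τ), f r = g r) → s ∈ Icc 0 τ → t ∈ Icc 0 τ →
      ∫ r in s..t, f r = ∫ r in s..t, g r := by
    intro E _ _ f g s t hfg hs ht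
    refine intervalIntegral.integral_congr_ae_restrict ?_
    rw [restrict_Ioo_eq_restrict_Ioc] at hfg
    refine ae_restrict_of_ae_restrict_of_subset ?_ hfg
    exact fun r hr => ⟨(le_min hs.1 ht.1).trans_lt hr.1, hr.2.trans (max_le hs.2 ht.2)⟩
  -- a time at which the solution is known to lie in `H²`
  obtain ⟨s₀, hs₀, hs₀m⟩ : ∃ s, toL2 L (H₀ s) = h s ∧ s ∈ Ioo 0 τ := by
    have hne : (volume.restrict (Ioo 0 τ)) ≠ 0 := by
      rw [Ne, Measure.restrict_eq_zero, Real.volume_Ioo, sub_zero, ENNReal.ofReal_eq_zero, not_le]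
      exact hτ
    have : (ae (volume.restrict (Ioo 0 τ))).NeBot := ae_neBot.2 hne
    exact (hH₀'.and (ae_restrict_mem measurableSet_Ioo)).exists
  have hs₀' : s₀ ∈ Icc 0 τ := Ioo_subset_Icc_self hs₀m
  set H : ℝ → Sob L 2 := fun t => H₀ s₀ + ∫ r in s₀..t, sobIncl L hm (U r) with hH
  have hHc : ContinuousOn H (Icc 0 τ) :=
    continuousOn_const.add (continuousOn_primitive hs₀' hUint)
  have hHh : ∀ t ∈ Icc 0 τ, toL2 L (H t) = h t := by
    intro t htm
    rw [hH, map_add, hs₀, ← (toL2 L).intervalIntegral_comp_comm (hsubI hUint hs₀' htm)]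
    have e : ∫ r in s₀..t, toL2 L (sobIncl L hm (U r)) = ∫ r in s₀..t, ht r :=
      hae (by simpa only [toL2_sobIncl] using hU.2) hs₀' htm
    rw [e, ← hhd s₀ hs₀' t htm]
    abel
  refine ⟨H, V, hHc, hVc, hHh, ?_, hVd, ?_, ?_⟩
  · intro s hs t ht'
    rw [← (sobIncl L hm).intervalIntegral_comp_comm (hsubI hUint0 hs ht')]
    simp only [hH, add_sub_add_left_eq_sub]
    exact intervalIntegral.integral_interval_sub_left (hsubI hUint hs₀' ht')
      (hsubI hUint hs₀' hs)
  · intro s hs t ht'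
    rw [hhd s hs t ht']
    exact hae hc' hs ht'
  · intro Z hZ hZζ t htm φ
    -- both time derivatives, tested with `φ`, are weak derivatives of the same scalar function
    have hF1 := (hF.mono le_rfl hτT).clm (ContinuousLinearMap.apply ℝ ℝ φ)
    have hF2 := h1.clm (innerSL ℝ (toL2 L φ))
    have hfun : (fun t => ContinuousLinearMap.apply ℝ ℝ φ (toDual L (h t)))
        = fun t => innerSL ℝ (toL2 L φ) (h t) := by
      ext t
      simp [toDual, real_inner_comm]
    rw [hfun] at hF1
    have hFt := hF1.unique hF2
    have hleft : ContinuousOn (fun t => inner ℝ (V t) (toL2 L φ) + formA L k α p q γ ε (H t) φ)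
        (Icc 0 τ) :=
      (hVc.inner continuousOn_const).add ((continuous_formA hK γ ε φ).comp_continuousOn hHc)
    have hright : ContinuousOn (fun t => Z t φ) (Icc 0 τ) := hZ.clm_apply continuousOn_const
    refine eqOn_Icc_of_ae_Ioo hτ hleft hright ?_ htm
    filter_upwards [hFt, hc', hH₀', hZζ, ae_restrict_of_ae_restrict_of_subset hsub heq,
      ae_restrict_mem measurableSet_Ioo] with r e1 e2 e3 e4 e5 e6
    have e7 : H₀ r = H r :=
      toL2_injective hL 2 (by rw [e3, hHh r (Ioo_subset_Icc_self e6)])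
    have e8 := e5 φ
    have e9 : V r = ht r := e2.symm
    simp only [ContinuousLinearMap.apply_apply, innerSL_apply_apply] at e1
    rw [e9, ← e7, e4, real_inner_comm, ← e1, e8]
    simp [toDual]

/-! ### A discrete energy inequality -/

/-- One step of the energy estimate. The implicit factor `g` is absorbed by Poincaré's inequality
`g² ≤ P l²`, the term `r x` by the numerical dissipation `y²`, so that the time step `δ` need not
be small. -/
theorem energy_step {δ ε κ P A x x' y l l' g g' D r : ℝ} (hδ : 0 < δ) (hε : 0 < ε)
    (hP : 0 < P) (hA : 0 ≤ A) (hr : 0 ≤ r) (hxy : x ≤ x' + y) (hg : g ^ 2 ≤ P * l ^ 2)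
    (hg' : 2 * κ ^ 2 * P / ε ^ 2 * g' ^ 2 ≤ ε ^ 2 * l' ^ 2 + A * x' ^ 2)
    (h : x ^ 2 - x' ^ 2 + y ^ 2 + 2 * δ * (ε ^ 2 * l ^ 2)
      ≤ 2 * δ * (κ * (D + g') * g) + 2 * δ * (r * x)) :
    x ^ 2 + δ * ε ^ 2 * l ^ 2 ≤ (1 + (1 + A) * δ) * (x' ^ 2 + δ * ε ^ 2 * l' ^ 2)
      + (2 * κ ^ 2 * P / ε ^ 2 * (δ * D ^ 2) + (δ + δ ^ 2) * r ^ 2) := by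
  set B := 2 * κ ^ 2 * P / ε ^ 2 with hB
  have h1 : 2 * (κ * (D + g') * g) ≤ ε ^ 2 * l ^ 2 + B * (D ^ 2 + g' ^ 2) := by
    have e1 : 2 * (κ * (D + g') * g) ≤ ε ^ 2 / P * g ^ 2 + κ ^ 2 * P / ε ^ 2 * (D + g') ^ 2 := by
      have : ε ^ 2 / P * g ^ 2 + κ ^ 2 * P / ε ^ 2 * (D + g') ^ 2 - 2 * (κ * (D + g') * g)
          = (ε ^ 2 * g - P * (κ * (D + g'))) ^ 2 / (P * ε ^ 2) := by
        field_simp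
        ring
      have h2 : 0 ≤ (ε ^ 2 * g - P * (κ * (D + g'))) ^ 2 / (P * ε ^ 2) := by positivity
      linarith
    have e2 : ε ^ 2 / P * g ^ 2 ≤ ε ^ 2 * l ^ 2 := by
      rw [div_mul_eq_mul_div, div_le_iff₀ hP]
      nlinarith [sq_nonneg ε]
    have e3 : κ ^ 2 * P / ε ^ 2 * (D + g') ^ 2 ≤ B * (D ^ 2 + g' ^ 2) := by
      have e4 : B * (D ^ 2 + g' ^ 2) = κ ^ 2 * P / ε ^ 2 * (2 * (D ^ 2 + g' ^ 2)) := by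
        rw [hB]; ring
      rw [e4]
      refine mul_le_mul_of_nonneg_left ?_ (by positivity)
      nlinarith [sq_nonneg (D - g')]
    linarith
  have h2 : 2 * δ * (r * x) ≤ y ^ 2 + δ * x' ^ 2 + (δ + δ ^ 2) * r ^ 2 := by
    have e1 : r * x ≤ r * x' + r * y := by
      rw [← mul_add]; exact mul_le_mul_of_nonneg_left hxy hr
    have e2 : 2 * δ * (r * x) ≤ 2 * δ * (r * x' + r * y) :=
      mul_le_mul_of_nonneg_left e1 (by positivity)
    nlinarith [sq_nonneg (δ * r - y), mul_nonneg hδ.le (sq_nonneg (r - x'))]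
  have h3 : 2 * δ * (κ * (D + g') * g) ≤ δ * (ε ^ 2 * l ^ 2 + B * (D ^ 2 + g' ^ 2)) := by
    have := mul_le_mul_of_nonneg_left h1 hδ.le
    linarith
  have h4 : δ * (B * g' ^ 2) ≤ δ * (ε ^ 2 * l' ^ 2 + A * x' ^ 2) :=
    mul_le_mul_of_nonneg_left hg' hδ.le
  have h5 : 0 ≤ (1 + A) * δ * (δ * ε ^ 2 * l' ^ 2) := by positivity
  linarith

/-- The discrete Gronwall lemma. -/
theorem discrete_gronwall {F E : ℕ → ℝ} {c : ℝ} {n : ℕ} (hc : 0 ≤ c) (h0 : F 0 = 0)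
    (hE : ∀ i, 0 ≤ E i) (h : ∀ i < n, F (i + 1) ≤ (1 + c) * F i + E i) :
    ∀ i ≤ n, F i ≤ Real.exp (c * i) * ∑ j ∈ Finset.range i, E j := by
  intro i
  induction i with
  | zero => intro _; simp [h0]
  | succ i ih =>
    intro hi
    have h1 := ih (Nat.le_of_succ_le hi)
    have hexp : (1 + c) * Real.exp (c * i) ≤ Real.exp (c * (i + 1 : ℕ)) := by
      have : c * ((i + 1 : ℕ) : ℝ) = c + c * i := by push_cast; ring
      rw [this, Real.exp_add]
      refine mul_le_mul_of_nonneg_right ?_ (Real.exp_pos _).le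
      linarith [Real.add_one_le_exp c]
    have hone : 1 ≤ Real.exp (c * (i + 1 : ℕ)) := Real.one_le_exp (by positivity)
    have hS : 0 ≤ ∑ j ∈ Finset.range i, E j := Finset.sum_nonneg fun j _ => hE j
    calc F (i + 1) ≤ (1 + c) * F i + E i := h i (Nat.lt_of_succ_le hi)
      _ ≤ (1 + c) * (Real.exp (c * i) * ∑ j ∈ Finset.range i, E j) + E i := by gcongr
      _ = (1 + c) * Real.exp (c * i) * ∑ j ∈ Finset.range i, E j + 1 * E i := by ring
      _ ≤ Real.exp (c * (i + 1 : ℕ)) * ∑ j ∈ Finset.range i, E j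
          + Real.exp (c * (i + 1 : ℕ)) * E i :=
        add_le_add (mul_le_mul_of_nonneg_right hexp hS)
          (mul_le_mul_of_nonneg_right hone (hE i))
      _ = _ := by rw [Finset.sum_range_succ]; ring

/-! ### Square-integrable functions of time -/

section Time

variable {V : Type*} [NormedAddCommGroup V] {τ R : ℝ} {f : ℝ → V}

theorem intervalIntegrable_norm_sq (hτ : 0 ≤ τ) (hf : MemLp f 2 (volume.restrict (Ioo 0 τ))) :
    IntervalIntegrable (fun r => ‖f r‖ ^ 2) volume 0 τ := by
  rw [intervalIntegrable_iff_integrableOn_Ioo_of_le hτ]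
  exact hf.integrable_norm_pow (by norm_num)

theorem integral_norm_sq_le (hτ : 0 ≤ τ) (hf : MemLp f 2 (volume.restrict (Ioo 0 τ)))
    (hR : eLpNorm f 2 (volume.restrict (Ioo 0 τ)) ≤ ENNReal.ofReal R) :
    ∫ r in (0 : ℝ)..τ, ‖f r‖ ^ 2 ≤ R ^ 2 := by
  rw [intervalIntegral.integral_of_le hτ, integral_Ioc_eq_integral_Ioo]
  have h0 : 0 ≤ ∫ r in Ioo 0 τ, ‖f r‖ ^ 2 := integral_nonneg fun r => by positivity
  rw [hf.eLpNorm_eq_integral_rpow_norm (by norm_num) (by norm_num)] at hR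
  simp only [ENNReal.toReal_ofNat, Real.rpow_ofNat] at hR
  have h1 : ENNReal.ofReal ((∫ r in Ioo 0 τ, ‖f r‖ ^ 2) ^ (2 : ℝ)⁻¹) ≤ ENNReal.ofReal |R| :=
    hR.trans (ENNReal.ofReal_le_ofReal (le_abs_self R))
  rw [ENNReal.ofReal_le_ofReal_iff (abs_nonneg R)] at h1
  have h2 := pow_le_pow_left₀ (Real.rpow_nonneg h0 _) h1 2
  rw [sq_abs, ← Real.rpow_natCast, ← Real.rpow_mul h0] at h2
  norm_num at h2
  exact h2

theorem ae_norm_le_of_eLpNorm_top {a b : ℝ}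
    (hR : eLpNorm f ∞ (volume.restrict (Ioo a b)) ≤ ENNReal.ofReal R) :
    ∀ᵐ t ∂volume.restrict (Ioo a b), ‖f t‖ ≤ |R| := by
  rw [eLpNorm_exponent_top] at hR
  filter_upwards [enorm_ae_le_eLpNormEssSup f (volume.restrict (Ioo a b))] with t ht
  have h1 := (ht.trans hR).trans (ENNReal.ofReal_le_ofReal (le_abs_self R))
  rw [← ofReal_norm, ENNReal.ofReal_le_ofReal_iff (abs_nonneg R)] at h1
  exact h1

theorem intervalIntegrable_sub {E : Type*} [NormedAddCommGroup E] {F : ℝ → E} (hτ : 0 ≤ τ)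
    (hF : IntervalIntegrable F volume 0 τ) {s t : ℝ} (hs : s ∈ Icc 0 τ) (ht : t ∈ Icc 0 τ) :
    IntervalIntegrable F volume s t := by
  refine hF.mono_set ?_
  rw [uIcc_of_le hτ]
  exact uIcc_subset_Icc hs ht

theorem sq_integral_norm_le (hτ : 0 ≤ τ) (hf : MemLp f 2 (volume.restrict (Ioo 0 τ))) {s t : ℝ}
    (hs : s ∈ Icc 0 τ) (ht : t ∈ Icc 0 τ) (hst : s ≤ t) :
    (∫ r in s..t, ‖f r‖) ^ 2 ≤ (t - s) * ∫ r in s..t, ‖f r‖ ^ 2 :=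
  sq_integral_le hst
    (intervalIntegrable_sub hτ (intervalIntegrable_of_memLp_two hτ hf).norm hs ht)
    (intervalIntegrable_sub hτ (intervalIntegrable_norm_sq hτ hf) hs ht)

theorem norm_sq_integral_le [NormedSpace ℝ V] (hτ : 0 ≤ τ)
    (hf : MemLp f 2 (volume.restrict (Ioo 0 τ))) {s t : ℝ} (hs : s ∈ Icc 0 τ)
    (ht : t ∈ Icc 0 τ) (hst : s ≤ t) :
    ‖∫ r in s..t, f r‖ ^ 2 ≤ (t - s) * ∫ r in s..t, ‖f r‖ ^ 2 :=
  (pow_le_pow_left₀ (norm_nonneg _) (intervalIntegral.norm_integral_le_integral_norm hst) 2).trans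
    (sq_integral_norm_le hτ hf hs ht hst)

theorem sum_integral_le (hτ : 0 ≤ τ) (hf : MemLp f 2 (volume.restrict (Ioo 0 τ)))
    (hR : eLpNorm f 2 (volume.restrict (Ioo 0 τ)) ≤ ENNReal.ofReal R) {δ : ℝ} {n : ℕ}
    (hδ : 0 ≤ δ) (hn : n * δ ≤ τ) :
    ∑ i ∈ Finset.range n, ∫ r in (i * δ)..((i + 1 : ℕ) * δ), ‖f r‖ ^ 2 ≤ R ^ 2 := by
  have hI := intervalIntegrable_norm_sq hτ hf
  have hmem : ∀ i ≤ n, (i : ℝ) * δ ∈ Icc 0 τ := fun i hi =>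
    ⟨by positivity, (mul_le_mul_of_nonneg_right (by exact_mod_cast hi) hδ).trans hn⟩
  rw [intervalIntegral.sum_integral_adjacent_intervals (a := fun i : ℕ => (i : ℝ) * δ)
    fun i hi => intervalIntegrable_sub hτ hI (hmem i hi.le) (hmem (i + 1) hi)]
  refine le_trans ?_ (integral_norm_sq_le hτ hf hR)
  simp only [Nat.cast_zero, zero_mul]
  have h0 : 0 ≤ ∫ r in (n * δ)..τ, ‖f r‖ ^ 2 :=
    intervalIntegral.integral_nonneg hn fun r _ => by positivity
  have hadd := intervalIntegral.integral_add_adjacent_intervals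
    (intervalIntegrable_sub hτ hI (left_mem_Icc.2 hτ) (hmem n le_rfl))
    (intervalIntegrable_sub hτ hI (hmem n le_rfl) (right_mem_Icc.2 hτ))
  linarith

/-- Consistency error of the backward difference quotient. -/
theorem norm_sq_sub_difference_quotient_le [NormedSpace ℝ V] [CompleteSpace V] {u v : ℝ → V}
    (hτ : 0 ≤ τ) (hf : MemLp f 2 (volume.restrict (Ioo 0 τ))) (hv : ContinuousOn v (Icc 0 τ))
    (hvf : ∀ s ∈ Icc 0 τ, ∀ t ∈ Icc 0 τ, v t - v s = ∫ r in s..t, f r)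
    (huv : ∀ s ∈ Icc 0 τ, ∀ t ∈ Icc 0 τ, u t - u s = ∫ r in s..t, v r) {s t : ℝ}
    (hs : s ∈ Icc 0 τ) (ht : t ∈ Icc 0 τ) (hst : s < t) :
    ‖v t - (t - s)⁻¹ • (u t - u s)‖ ^ 2 ≤ (t - s) * ∫ r in s..t, ‖f r‖ ^ 2 := by
  have hpos : 0 < t - s := sub_pos.2 hst
  have hI := (intervalIntegrable_of_memLp_two hτ hf).norm
  have hvi : IntervalIntegrable v volume s t := by
    refine ContinuousOn.intervalIntegrable (hv.mono ?_)
    exact uIcc_subset_Icc hs ht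
  have hbound : ∀ r ∈ uIoc s t, ‖v t - v r‖ ≤ ∫ r in s..t, ‖f r‖ := by
    intro r hr
    rw [uIoc_of_le hst.le] at hr
    have hr' : r ∈ Icc 0 τ := ⟨hs.1.trans hr.1.le, hr.2.trans ht.2⟩
    rw [hvf r hr' t ht]
    refine (intervalIntegral.norm_integral_le_integral_norm hr.2).trans ?_
    rw [← intervalIntegral.integral_add_adjacent_intervals (intervalIntegrable_sub hτ hI hs hr')
      (intervalIntegrable_sub hτ hI hr' ht)]
    exact le_add_of_nonneg_left
      (intervalIntegral.integral_nonneg hr.1.le fun _ _ => norm_nonneg _)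
  have e : v t - (t - s)⁻¹ • (u t - u s) = (t - s)⁻¹ • ∫ r in s..t, (v t - v r) := by
    rw [intervalIntegral.integral_sub (by simp) hvi, intervalIntegral.integral_const, huv s hs t ht,
      smul_sub, inv_smul_smul₀ hpos.ne']
  have h1 := intervalIntegral.norm_integral_le_of_norm_le_const hbound
  rw [abs_of_pos hpos] at h1
  have h2 : ‖v t - (t - s)⁻¹ • (u t - u s)‖ ≤ ∫ r in s..t, ‖f r‖ := by
    rw [e, norm_smul, Real.norm_of_nonneg (inv_nonneg.2 hpos.le), inv_mul_le_iff₀ hpos]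
    linarith
  exact (pow_le_pow_left₀ (norm_nonneg _) h2 2).trans (sq_integral_norm_le hτ hf hs ht hst.le)

theorem le_on_Icc_of_ae_Ioo {a b c : ℝ} (hab : a < b) {φ : ℝ → ℝ} (hφ : ContinuousOn φ (Icc a b))
    (h : ∀ᵐ t ∂volume.restrict (Ioo a b), φ t ≤ c) : ∀ t ∈ Icc a b, φ t ≤ c := by
  intro t ht
  have := eqOn_Icc_of_ae_Ioo hab (hφ.sup continuousOn_const) (continuousOn_const (c := c))
    (by filter_upwards [h] with t ht using max_eq_right ht) ht
  exact (le_max_left _ _).trans this.le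

end Time

/-! ### The projection error -/

/-- The `L²` projection onto the Fourier space, as a continuous map into `H²_per(Ω)`. -/
theorem exists_projSob {L : Fin 2 → ℝ} (hL : ∀ j, 0 < L j) (N : ℕ) :
    ∃ P : L2 L →L[ℝ] Sob L 2, ∀ u, toL2 L (P u) = (fourierSpace L N).starProjection u := by
  set J : Sob L 2 →ₗ[ℝ] L2 L := (toL2 L : Sob L 2 →L[ℝ] L2 L).toLinearMap with hJ
  have hinj : Function.Injective J := toL2_injective hL 2
  have hle : fourierSpace L N ≤ LinearMap.range J := fun v hv =>
    exists_sob_of_mem_fourierSpace hL 2 N hv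
  set lift : fourierSpace L N →ₗ[ℝ] Sob L 2 :=
    (LinearEquiv.ofInjective J hinj).symm.toLinearMap.comp (Submodule.inclusion hle) with hlift
  refine ⟨(LinearMap.toContinuousLinearMap lift).comp
    (fourierSpace L N).orthogonalProjectionOnto, fun u => ?_⟩
  have h := (LinearEquiv.ofInjective J hinj).apply_symm_apply
    (Submodule.inclusion hle ((fourierSpace L N).orthogonalProjectionOnto u))
  exact congrArg Subtype.val h

/-- The tail of a function is orthogonal to the Fourier space, together with all derivatives. -/
theorem inner_tail_eq_zero {L : Fin 2 → ℝ} (hL : ∀ j, 0 < L j) {N : ℕ} {ρ η : Sob L 2} {u : L2 L}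
    (hρ : IsTail L N u (toL2 L ρ)) (hη : toL2 L η ∈ fourierSpace L N) :
    (inner ℝ (toL2 L ρ) (toL2 L η) : ℝ) = 0 ∧ (inner ℝ (gradL L ρ) (gradL L η) : ℝ) = 0 ∧
      (inner ℝ (lapCLM L ρ) (lapCLM L η) : ℝ) = 0 := by
  have h : ∀ ξ, coef L ξ (toL2 L ρ) = 0 ∨ coef L ξ (toL2 L η) = 0 := by
    intro ξ
    by_cases hξ : ξ ∈ freq N
    · left; rw [hρ ξ, if_pos hξ]
    · right; exact coef_eq_zero_of_mem_fourierSpace hL hη hξ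
  have hz : ∀ (w : Sob L 2) (ξ : ℤ × ℤ), coef L ξ (toL2 L w) = 0 →
      ∀ j, coef L ξ (deriv1 L j w) = 0 := by
    intro w ξ hw j
    have := norm_sq_coef_deriv1 hL j w ξ
    rw [hw] at this
    simpa using this
  have hd : ∀ j, (inner ℝ (deriv1 L j ρ) (deriv1 L j η) : ℝ) = 0 := fun j =>
    inner_eq_zero_of_coef hL fun ξ => (h ξ).imp (fun e => hz ρ ξ e j) fun e => hz η ξ e j
  refine ⟨inner_eq_zero_of_coef hL h, ?_, inner_eq_zero_of_coef hL fun ξ => (h ξ).imp ?_ ?_⟩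
  · rw [inner_gradL_eq_sum, hd, hd, add_zero]
  · intro e; rw [coef_lapCLM hL, e, mul_zero]
  · intro e; rw [coef_lapCLM hL, e, mul_zero]

/-- The tails of a path that is bounded in `H^m_per(Ω)` are small at every time. -/
theorem tail_bounds_on_Icc {L : Fin 2 → ℝ} (hL : ∀ j, 0 < L j) {N m : ℕ} (hN : 1 ≤ N)
    (hm : 1 ≤ m) {P : L2 L →L[ℝ] Sob L 2}
    (hP : ∀ u, toL2 L (P u) = (fourierSpace L N).starProjection u) {σ R : ℝ} (hσ : 0 < σ)
    {h : ℝ → L2 L} {H : ℝ → Sob L 2} (hH : ContinuousOn H (Icc 0 σ))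
    (hHh : ∀ t ∈ Icc 0 σ, toL2 L (H t) = h t) (hb : SobPathBound L m ∞ 0 σ R h) :
    ∀ t ∈ Icc 0 σ, ‖toL2 L (H t - P (h t))‖ ^ 2 ≤ (poincare L / N ^ 2) ^ m * R ^ 2 ∧
      gradSq L (H t - P (h t)) ≤ 2 * (poincare L / N ^ 2) ^ (m - 1) * R ^ 2 := by
  obtain ⟨U, hU, hUR⟩ := hb
  have hc : ContinuousOn h (Icc 0 σ) :=
    ((toL2 L).continuous.comp_continuousOn hH).congr fun t ht => (hHh t ht).symm
  have hρ : ContinuousOn (fun t => H t - P (h t)) (Icc 0 σ) :=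
    hH.sub (P.continuous.comp_continuousOn hc)
  have hr : 0 ≤ poincare L / N ^ 2 := div_nonneg (poincare_pos hL).le (by positivity)
  have hae : ∀ᵐ t ∂volume.restrict (Ioo 0 σ),
      ‖toL2 L (H t - P (h t))‖ ^ 2 ≤ (poincare L / N ^ 2) ^ m * R ^ 2 ∧
      gradSq L (H t - P (h t)) ≤ 2 * (poincare L / N ^ 2) ^ (m - 1) * R ^ 2 := by
    filter_upwards [hU.2, ae_norm_le_of_eLpNorm_top hUR, ae_restrict_mem measurableSet_Ioo]
      with t h1 h2 h3
    have ht : IsTail L N (toL2 L (U t)) (toL2 L (H t - P (h t))) := by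
      rw [h1, map_sub, hHh t (Ioo_subset_Icc_self h3), hP]
      exact isTail_sub_starProjection hL N (h t)
    have h4 : ‖U t‖ ^ 2 ≤ R ^ 2 := by
      rw [← sq_abs R]
      exact pow_le_pow_left₀ (norm_nonneg _) h2 2
    exact ⟨(ht.norm_sq_le hL hN hm).trans (mul_le_mul_of_nonneg_left h4 (pow_nonneg hr _)),
      (ht.gradSq_le hL hN hm).trans (mul_le_mul_of_nonneg_left h4 (by positivity))⟩
  have h1 := le_on_Icc_of_ae_Ioo hσ
    (((toL2 L).continuous.comp_continuousOn hρ).norm.pow 2) (hae.mono fun t h => h.1)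
  have h2 := le_on_Icc_of_ae_Ioo hσ (φ := fun t => gradSq L (H t - P (h t)))
    ((((deriv1 L 0).continuous.comp_continuousOn hρ).norm.pow 2).add
      (((deriv1 L 1).continuous.comp_continuousOn hρ).norm.pow 2)) (hae.mono fun t h => h.2)
  exact fun t ht => ⟨h1 t ht, h2 t ht⟩

/-! ### The error equation -/

/-- One step of the error equation, tested with the discrete error `η = P - w`; here `H`, `H'` are
the exact solution at the new and the old time, `P`, `P'` its projections, `w`, `w'` the discrete
solution and `v` the exact time derivative at the new time. -/
theorem error_inequality {L : Fin 2 → ℝ} (hL : ∀ j, 0 < L j) {k : ESModel} {α p q χ γ ε δ : ℝ}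
    (hp : 0 < p) (hq : 0 < q) {K : NNReal} (hK : LipschitzWith K (current k α p q))
    (hχ : 0 ≤ χ) (hγ : 0 ≤ γ) (hδ : 0 < δ) {N : ℕ} {H H' P P' w w' : Sob L 2} {v : L2 L}
    {z : SobDual L} (hP : toL2 L P = (fourierSpace L N).starProjection (toL2 L H))
    (hP' : toL2 L P' = (fourierSpace L N).starProjection (toL2 L H'))
    (hw : toL2 L w ∈ fourierSpace L N)
    (hexact : inner ℝ v (toL2 L (P - w)) + formA L k α p q γ ε H (P - w) = z (P - w))
    (hscheme : inner ℝ (δ⁻¹ • toL2 L (w - w')) (toL2 L (P - w)) + formPlus L χ γ ε w (P - w)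
      = z (P - w) - formMinus L k α p q χ w' (P - w)) :
    ‖toL2 L (P - w)‖ ^ 2 - ‖toL2 L (P' - w')‖ ^ 2 + ‖toL2 L ((P - w) - (P' - w'))‖ ^ 2
        + 2 * δ * (ε ^ 2 * ‖lapCLM L (P - w)‖ ^ 2)
      ≤ 2 * δ * ((K + χ + 1) * ((‖gradL L (H - H')‖ + ‖gradL L (H' - P')‖)
          + ‖gradL L (P' - w')‖) * ‖gradL L (P - w)‖)
        + 2 * δ * (‖v - δ⁻¹ • (toL2 L H - toL2 L H')‖ * ‖toL2 L (P - w)‖) := by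
  set η := P - w with hη
  set η' := P' - w' with hη'
  have hPm : toL2 L P ∈ fourierSpace L N := by
    rw [hP]; exact Submodule.starProjection_apply_mem _ _
  have hηm : toL2 L η ∈ fourierSpace L N := by
    rw [hη, map_sub]; exact Submodule.sub_mem _ hPm hw
  have htail : IsTail L N (toL2 L H) (toL2 L (H - P)) := by
    rw [map_sub, hP]; exact isTail_sub_starProjection hL N _
  have htail' : IsTail L N (toL2 L H') (toL2 L (H' - P')) := by
    rw [map_sub, hP']; exact isTail_sub_starProjection hL N _
  obtain ⟨o1, o2, o3⟩ := inner_tail_eq_zero hL htail hηm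
  obtain ⟨o1', -, -⟩ := inner_tail_eq_zero hL htail' hηm
  -- the projection error drops out of the implicit form
  have hplus : formPlus L χ γ ε H η - formPlus L χ γ ε w η
      = (γ + χ) * ‖gradL L η‖ ^ 2 + ε ^ 2 * ‖lapCLM L η‖ ^ 2 := by
    have e : H - w = (H - P) + η := by rw [hη]; abel
    have e1 : (inner ℝ (gradL L H) (gradL L η) : ℝ) - inner ℝ (gradL L w) (gradL L η)
        = ‖gradL L η‖ ^ 2 := by
      rw [← inner_sub_left, ← map_sub, e, map_add, inner_add_left, o2, zero_add,
        real_inner_self_eq_norm_sq]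
    have e2 : (inner ℝ (lapCLM L H) (lapCLM L η) : ℝ) - inner ℝ (lapCLM L w) (lapCLM L η)
        = ‖lapCLM L η‖ ^ 2 := by
      rw [← inner_sub_left, ← map_sub, e, map_add, inner_add_left, o3, zero_add,
        real_inner_self_eq_norm_sq]
    rw [formPlus_eq, formPlus_eq, ← e1, ← e2]
    ring
  -- and out of the difference quotient
  have hquot : (inner ℝ v (toL2 L η) : ℝ) - inner ℝ (δ⁻¹ • toL2 L (w - w')) (toL2 L η)
      = inner ℝ (v - δ⁻¹ • (toL2 L H - toL2 L H')) (toL2 L η)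
        + δ⁻¹ * inner ℝ (toL2 L (η - η')) (toL2 L η) := by
    have e : toL2 L (w - w') = (toL2 L H - toL2 L H') - toL2 L (η - η')
        - toL2 L (H - P) + toL2 L (H' - P') := by
      simp only [hη, hη', map_sub]
      abel
    rw [e, inner_sub_left, real_inner_smul_left, real_inner_smul_left, inner_add_left,
      inner_sub_left, inner_sub_left (_ - _) (toL2 L (η - η')), o1, o1']
    ring
  have hpol : 2 * (inner ℝ (toL2 L (η - η')) (toL2 L η) : ℝ)
      = ‖toL2 L η‖ ^ 2 - ‖toL2 L η'‖ ^ 2 + ‖toL2 L (η - η')‖ ^ 2 := by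
    rw [map_sub, norm_sub_sq_real, inner_sub_left, real_inner_self_eq_norm_sq,
      real_inner_comm (toL2 L η)]
    ring
  have hminus := abs_formMinus_sub_le hp hq hK (L := L) χ w' H η
  have hgrad : ‖gradL L (w' - H)‖ ≤ ‖gradL L (H - H')‖ + ‖gradL L (H' - P')‖ + ‖gradL L η'‖ := by
    have e : w' - H = -((H - H') + (H' - P') + η') := by rw [hη']; abel
    rw [e, map_neg, norm_neg, map_add, map_add]
    exact norm_add₃_le
  have hr := real_inner_le_norm (-(v - δ⁻¹ • (toL2 L H - toL2 L H'))) (toL2 L η)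
  rw [norm_neg, inner_neg_left] at hr
  rw [formA_eq_add hp hq hK χ] at hexact
  rw [abs_of_nonneg hχ] at hminus
  have hm1 : formMinus L k α p q χ w' η - formMinus L k α p q χ H η
      ≤ (K + χ + 1) * ((‖gradL L (H - H')‖ + ‖gradL L (H' - P')‖) + ‖gradL L η'‖)
        * ‖gradL L η‖ := by
    refine (le_abs_self _).trans (hminus.trans ?_)
    refine mul_le_mul_of_nonneg_right ?_ (norm_nonneg _)
    exact mul_le_mul (by linarith) hgrad (norm_nonneg _) (by positivity)
  have hdrop : 0 ≤ (γ + χ) * ‖gradL L η‖ ^ 2 := by positivity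
  set S := (K + χ + 1) * ((‖gradL L (H - H')‖ + ‖gradL L (H' - P')‖) + ‖gradL L η'‖)
    * ‖gradL L η‖
  set r := ‖v - δ⁻¹ • (toL2 L H - toL2 L H')‖ * ‖toL2 L η‖
  have hmain : δ⁻¹ * inner ℝ (toL2 L (η - η')) (toL2 L η) + ε ^ 2 * ‖lapCLM L η‖ ^ 2 ≤ S + r := by
    linarith
  have h2 := mul_le_mul_of_nonneg_left hmain (by positivity : 0 ≤ 2 * δ)
  have h3 : 2 * δ * (δ⁻¹ * inner ℝ (toL2 L (η - η')) (toL2 L η) + ε ^ 2 * ‖lapCLM L η‖ ^ 2)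
      = 2 * inner ℝ (toL2 L (η - η')) (toL2 L η) + 2 * δ * (ε ^ 2 * ‖lapCLM L η‖ ^ 2) := by
    field_simp
  rw [h3, hpol] at h2
  linarith

/-! ### The error estimate -/

theorem grid_mem {δ : ℝ} (hδ : 0 ≤ δ) {i n : ℕ} (hi : i ≤ n) : (i : ℝ) * δ ∈ Icc 0 (n * δ) :=
  ⟨by positivity, mul_le_mul_of_nonneg_right (by exact_mod_cast hi) hδ⟩

/-- The projection errors at the times `t_j`, `j < n`. For `n = 1` only the initial value is
involved. -/
theorem tail_bounds_on_grid {L : Fin 2 → ℝ} (hL : ∀ j, 0 < L j) {N n m : ℕ} (hN : 1 ≤ N)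
    (hn : 1 ≤ n) (hm : 1 ≤ m) {P : L2 L →L[ℝ] Sob L 2}
    (hP : ∀ u, toL2 L (P u) = (fourierSpace L N).starProjection u) {δ R : ℝ} (hδ : 0 < δ)
    {h : ℝ → L2 L} {H : ℝ → Sob L 2} (hH : ContinuousOn H (Icc 0 (n * δ)))
    (hHh : ∀ t ∈ Icc 0 (n * δ), toL2 L (H t) = h t)
    (hb : SobPathBound L m ∞ 0 ((n - 1) * δ) R h)
    (hb1 : n = 1 → ∃ w : Sob L m, toL2 L w = h 0 ∧ ‖w‖ ≤ R) {j : ℕ} (hj : j < n) :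
    ‖toL2 L (H (j * δ) - P (h (j * δ)))‖ ^ 2 ≤ (poincare L / N ^ 2) ^ m * R ^ 2 ∧
      gradSq L (H (j * δ) - P (h (j * δ))) ≤ 2 * (poincare L / N ^ 2) ^ (m - 1) * R ^ 2 := by
  rcases hn.eq_or_lt with h1 | h1
  · obtain rfl : j = 0 := by omega
    obtain ⟨w, hw, hwR⟩ := hb1 h1.symm
    have hr : 0 ≤ poincare L / N ^ 2 := div_nonneg (poincare_pos hL).le (by positivity)
    have ht : IsTail L N (toL2 L w) (toL2 L (H ((0 : ℕ) * δ) - P (h ((0 : ℕ) * δ)))) := by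
      rw [map_sub, hHh _ (grid_mem hδ.le (Nat.zero_le n)), hP, hw, Nat.cast_zero, zero_mul]
      exact isTail_sub_starProjection hL N (h 0)
    have h4 : ‖w‖ ^ 2 ≤ R ^ 2 := pow_le_pow_left₀ (norm_nonneg _) hwR 2
    exact ⟨(ht.norm_sq_le hL hN hm).trans (mul_le_mul_of_nonneg_left h4 (pow_nonneg hr _)),
      (ht.gradSq_le hL hN hm).trans (mul_le_mul_of_nonneg_left h4 (by positivity))⟩
  · have hn1 : (1 : ℝ) < n := by exact_mod_cast h1
    have hsub : Icc 0 (((n : ℝ) - 1) * δ) ⊆ Icc 0 (n * δ) :=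
      Icc_subset_Icc_right (mul_le_mul_of_nonneg_right (by linarith) hδ.le)
    refine tail_bounds_on_Icc hL hN hm hP (mul_pos (by linarith) hδ) (hH.mono hsub)
      (fun t ht => hHh t (hsub ht)) hb _ ⟨by positivity, ?_⟩
    have : (j : ℝ) + 1 ≤ n := by exact_mod_cast hj
    exact mul_le_mul_of_nonneg_right (by linarith) hδ.le

/-- Summation of the local errors over the time steps. -/
theorem sum_local_error_le {B κ G δ R : ℝ} {n : ℕ} (hB : 0 ≤ B) (hδ : 0 ≤ δ)
    {d σ r a b : ℕ → ℝ} (hd : ∀ j < n, d j ^ 2 ≤ κ ^ 2 * (δ * a j)) (hσ : ∀ j < n, σ j ^ 2 ≤ G)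
    (hr : ∀ j < n, r j ^ 2 ≤ δ * b j) (ha : ∑ j ∈ Finset.range n, a j ≤ R ^ 2)
    (hb : ∑ j ∈ Finset.range n, b j ≤ R ^ 2) :
    ∑ j ∈ Finset.range n, (B * (δ * (d j + σ j) ^ 2) + (δ + δ ^ 2) * r j ^ 2)
      ≤ 2 * B * κ ^ 2 * δ ^ 2 * R ^ 2 + 2 * B * (n * δ) * G + (1 + δ) * δ ^ 2 * R ^ 2 := by
  have hstep : ∀ j ∈ Finset.range n, B * (δ * (d j + σ j) ^ 2) + (δ + δ ^ 2) * r j ^ 2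
      ≤ 2 * B * κ ^ 2 * δ ^ 2 * a j + 2 * B * δ * G + (1 + δ) * δ ^ 2 * b j := by
    intro j hj
    rw [Finset.mem_range] at hj
    have h1 : (d j + σ j) ^ 2 ≤ 2 * (κ ^ 2 * (δ * a j)) + 2 * G := by
      nlinarith [hd j hj, hσ j hj, sq_nonneg (d j - σ j)]
    have h2 : B * (δ * (d j + σ j) ^ 2) ≤ B * (δ * (2 * (κ ^ 2 * (δ * a j)) + 2 * G)) := by
      gcongr
    have h3 : (δ + δ ^ 2) * r j ^ 2 ≤ (δ + δ ^ 2) * (δ * b j) :=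
      mul_le_mul_of_nonneg_left (hr j hj) (by positivity)
    linarith
  refine (Finset.sum_le_sum hstep).trans ?_
  rw [Finset.sum_add_distrib, Finset.sum_add_distrib, Finset.sum_const, Finset.card_range,
    nsmul_eq_mul]
  have h1 := mul_le_mul_of_nonneg_left ha (by positivity : 0 ≤ 2 * B * κ ^ 2 * δ ^ 2)
  have h2 := mul_le_mul_of_nonneg_left hb (by positivity : 0 ≤ (1 + δ) * δ ^ 2)
  rw [Finset.mul_sum] at h1 h2
  linarith

theorem total_error_le {B κ c δ ν τ R : ℝ} (hB : 0 ≤ B) (hc : 0 ≤ c) (hδ : 0 ≤ δ) (hν : 0 ≤ ν)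
    (hδτ : δ ≤ τ) :
    2 * B * κ ^ 2 * δ ^ 2 * R ^ 2 + 2 * B * τ * (2 * (c * ν ^ 2) * R ^ 2)
        + (1 + δ) * δ ^ 2 * R ^ 2
      ≤ (2 * B * κ ^ 2 + 4 * B * c + 1) * (|R| * (δ + ν)) ^ 2 * (1 + τ) := by
  have hτ : 0 ≤ τ := hδ.trans hδτ
  have h1 : δ ^ 2 ≤ (δ + ν) ^ 2 := by gcongr; linarith
  have h2 : ν ^ 2 ≤ (δ + ν) ^ 2 := by gcongr; linarith
  calc 2 * B * κ ^ 2 * δ ^ 2 * R ^ 2 + 2 * B * τ * (2 * (c * ν ^ 2) * R ^ 2)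
        + (1 + δ) * δ ^ 2 * R ^ 2
      = 2 * B * κ ^ 2 * δ ^ 2 * R ^ 2 * 1 + 4 * B * c * ν ^ 2 * R ^ 2 * τ
        + 1 * δ ^ 2 * R ^ 2 * (1 + δ) := by ring
    _ ≤ 2 * B * κ ^ 2 * (δ + ν) ^ 2 * R ^ 2 * (1 + τ) + 4 * B * c * (δ + ν) ^ 2 * R ^ 2 * (1 + τ)
        + 1 * (δ + ν) ^ 2 * R ^ 2 * (1 + τ) := by
      gcongr
      · linarith
      · linarith
    _ = _ := by rw [mul_pow, sq_abs]; ring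

theorem exp_mul_one_add_le {A s τ : ℝ} (hA : 0 ≤ A) (hτ : 0 ≤ τ) (hs : s ≤ (1 + A) * τ) :
    Real.exp s * (1 + τ) ≤ Real.exp ((2 + A) * τ) ^ 2 := by
  have hX : 1 ≤ Real.exp ((2 + A) * τ) := Real.one_le_exp (by positivity)
  have hexp : 1 + τ ≤ Real.exp τ := by linarith [Real.add_one_le_exp τ]
  calc Real.exp s * (1 + τ) ≤ Real.exp ((1 + A) * τ) * Real.exp τ := by gcongr
    _ = Real.exp ((2 + A) * τ) := by rw [← Real.exp_add]; ring_nf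
    _ ≤ _ := le_self_pow₀ hX two_ne_zero

theorem chiMin_nonneg (k : ESModel) {α p q : ℝ} (hα : 0 < α) (hp : 0 < p) (hpq : p < q) :
    0 ≤ chiMin k α p q := by
  cases k with
  | one =>
    have : 0 < q - p := sub_pos.2 hpq
    have : 0 < q := hp.trans hpq
    simp only [chiMin]
    positivity
  | two => exact le_rfl

theorem le_sqrt_mul_of_sq_le {x a b : ℝ} (hb : 0 ≤ b) (h : x ^ 2 ≤ a * b ^ 2) :
    x ≤ √a * b := by
  refine Real.le_sqrt_of_sq_le h |>.trans ?_
  rw [Real.sqrt_mul' _ (sq_nonneg b), Real.sqrt_sq hb]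

/-- The energy estimate for the discrete error `η_j = P_N h(t_j) - h_N^j`: the errors committed in
the single time steps add up, with at most exponential growth. -/
theorem discrete_error_le {L : Fin 2 → ℝ} (hL : ∀ j, 0 < L j) {k : ESModel} {α p q χ γ ε δ : ℝ}
    (hp : 0 < p) (hq : 0 < q) {K : NNReal} (hK : LipschitzWith K (current k α p q))
    (hχ : 0 ≤ χ) (hγ : 0 ≤ γ) (hε : 0 < ε) (hδ : 0 < δ) {N n : ℕ} {H P hN : ℕ → Sob L 2}
    {V : ℕ → L2 L} {z : ℕ → SobDual L} {κ B A : ℝ} (hκ : κ = K + χ + 1)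
    (hB : B = 2 * κ ^ 2 * poincare L / ε ^ 2) (hA : A = B ^ 2 / (4 * ε ^ 2))
    (hP : ∀ j ≤ n, toL2 L (P j) = (fourierSpace L N).starProjection (toL2 L (H j)))
    (hexact : ∀ j < n, ∀ φ, inner ℝ (V (j + 1)) (toL2 L φ)
      + formA L k α p q γ ε (H (j + 1)) φ = z (j + 1) φ)
    (h0 : hN 0 = P 0)
    (hscheme : ∀ j < n, toL2 L (hN (j + 1)) ∈ fourierSpace L N ∧
      ∀ φ : Sob L 2, toL2 L φ ∈ fourierSpace L N →
        inner ℝ (δ⁻¹ • toL2 L (hN (j + 1) - hN j)) (toL2 L φ)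
            + formPlus L χ γ ε (hN (j + 1)) φ
          = z (j + 1) φ - formMinus L k α p q χ (hN j) φ) {i : ℕ} (hi : i ≤ n) :
    ‖toL2 L (P i - hN i)‖ ^ 2 ≤ Real.exp ((1 + A) * δ * i) * ∑ j ∈ Finset.range i,
      (B * (δ * (‖gradL L (H (j + 1) - H j)‖ + ‖gradL L (H j - P j)‖) ^ 2) + (δ + δ ^ 2)
        * ‖V (j + 1) - δ⁻¹ • (toL2 L (H (j + 1)) - toL2 L (H j))‖ ^ 2) := by
  have hP0 := poincare_pos hL
  have hκ0 : 0 < κ := by rw [hκ]; positivity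
  have hB0 : 0 < B := by rw [hB]; positivity
  have hA0 : 0 ≤ A := by rw [hA]; positivity
  set F : ℕ → ℝ := fun j =>
    ‖toL2 L (P j - hN j)‖ ^ 2 + δ * ε ^ 2 * ‖lapCLM L (P j - hN j)‖ ^ 2 with hF
  have hFi : ‖toL2 L (P i - hN i)‖ ^ 2 ≤ F i := le_add_of_nonneg_right (by positivity)
  refine hFi.trans (discrete_gronwall (by positivity) (by simp [hF, h0])
    (fun j => by positivity) (fun j hj => ?_) i hi)
  obtain ⟨hw1, hw2⟩ := hscheme j hj
  have hm1 : toL2 L (P (j + 1) - hN (j + 1)) ∈ fourierSpace L N := by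
    rw [map_sub, hP _ hj]
    exact Submodule.sub_mem _ (Submodule.starProjection_apply_mem _ _) hw1
  have hineq := error_inequality hL hp hq hK hχ hγ hδ (hP _ hj) (hP _ hj.le) hw1
    (hexact j hj _) (hw2 _ hm1)
  rw [← hκ] at hineq
  have hinterp : B * ‖gradL L (P j - hN j)‖ ^ 2
      ≤ ε ^ 2 * ‖lapCLM L (P j - hN j)‖ ^ 2 + A * ‖toL2 L (P j - hN j)‖ ^ 2 := by
    rw [norm_sq_gradL]
    refine (mul_le_mul_of_nonneg_left
      (gradSq_le_interp hL (by positivity : 0 < ε ^ 2 / B) (P j - hN j)) hB0.le).trans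
      (le_of_eq ?_)
    rw [hA]
    field_simp
  rw [hB] at hinterp ⊢
  refine energy_step hδ hε hP0 hA0 (norm_nonneg _) ?_ ?_ hinterp hineq
  · have e := norm_add_le (toL2 L (P j - hN j))
      (toL2 L (P (j + 1) - hN (j + 1) - (P j - hN j)))
    rwa [← map_add, add_sub_cancel] at e
  · rw [norm_sq_gradL]
    exact gradSq_le_poincare hL _

theorem poincare_div_pow (L : Fin 2 → ℝ) (N : ℝ) (m : ℕ) :
    (poincare L / N ^ 2) ^ m = poincare L ^ m * (N⁻¹ ^ m) ^ 2 := by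
  rw [div_pow, div_eq_mul_inv, ← pow_mul, ← pow_mul, inv_pow, mul_comm 2 m]

/-- The projection error at the times `t_i`, `i ≤ n`. The last time is reached from the one before
with the help of the time derivative, here represented by its path `U` in `H^{m₁}_per(Ω)`. -/
theorem projection_error_le {L : Fin 2 → ℝ} (hL : ∀ j, 0 < L j) {N n m₁ m₂ : ℕ} (hN : 1 ≤ N)
    (hm₁ : 2 ≤ m₁) {P : L2 L →L[ℝ] Sob L 2}
    (hP : ∀ u, toL2 L (P u) = (fourierSpace L N).starProjection u) {δ R X : ℝ} (hX : 0 ≤ X)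
    {h : ℝ → L2 L} {H : ℝ → Sob L 2} {U : ℝ → Sob L m₁}
    (hHh : ∀ j ≤ n, toL2 L (H (j * δ)) = h (j * δ))
    (hHd : ∀ j < n, H ((j + 1 : ℕ) * δ) - H (j * δ)
      = sobIncl L hm₁ (∫ s in (j * δ)..((j + 1 : ℕ) * δ), U s))
    (hU : ∀ j < n, ‖∫ s in (j * δ)..((j + 1 : ℕ) * δ), U s‖ ^ 2 ≤ X ^ 2 * R ^ 2)
    (htail : ∀ j < n, ‖toL2 L (H (j * δ) - P (h (j * δ)))‖ ^ 2
      ≤ (poincare L / N ^ 2) ^ m₂ * R ^ 2) {i : ℕ} (hn : 1 ≤ n) (hi : i ≤ n) :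
    ‖toL2 L (H (i * δ) - P (h (i * δ)))‖ ≤ √(poincare L ^ m₂) * (|R| * (N : ℝ)⁻¹ ^ m₂)
      + √(poincare L ^ m₁) * (|R| * X * (N : ℝ)⁻¹ ^ m₁) := by
  have hP0 := poincare_pos hL
  have hlt : ∀ j < n, ‖toL2 L (H (j * δ) - P (h (j * δ)))‖
      ≤ √(poincare L ^ m₂) * (|R| * (N : ℝ)⁻¹ ^ m₂) := by
    intro j hj
    refine le_sqrt_mul_of_sq_le (by positivity) ((htail j hj).trans (le_of_eq ?_))
    rw [poincare_div_pow, mul_pow, sq_abs]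
    ring
  rcases hi.lt_or_eq with hlti | rfl
  · exact (hlt i hlti).trans (le_add_of_nonneg_right (by positivity))
  obtain ⟨j, rfl⟩ : ∃ j, i = j + 1 := ⟨i - 1, by omega⟩
  have hj : j < j + 1 := Nat.lt_succ_self j
  set W := ∫ s in (j * δ)..((j + 1 : ℕ) * δ), U s
  have hWh : toL2 L W = h ((j + 1 : ℕ) * δ) - h (j * δ) := by
    rw [← hHh _ le_rfl, ← hHh _ hj.le, ← map_sub, hHd j hj, toL2_sobIncl]
  have htailW : IsTail L N (toL2 L W)
      (toL2 L W - (fourierSpace L N).starProjection (toL2 L W)) :=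
    isTail_sub_starProjection hL N _
  have hsplit : toL2 L (H ((j + 1 : ℕ) * δ) - P (h ((j + 1 : ℕ) * δ)))
      = toL2 L (H (j * δ) - P (h (j * δ)))
        + (toL2 L W - (fourierSpace L N).starProjection (toL2 L W)) := by
    rw [hWh, map_sub, map_sub, map_sub, hP, hP, hHh _ le_rfl, hHh _ hj.le]
    abel
  rw [hsplit]
  refine (norm_add_le _ _).trans (add_le_add (hlt j hj) ?_)
  refine le_sqrt_mul_of_sq_le (by positivity) ?_
  refine (htailW.norm_sq_le hL hN (by omega)).trans ?_
  rw [poincare_div_pow]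
  calc _ ≤ poincare L ^ m₁ * ((N : ℝ)⁻¹ ^ m₁) ^ 2 * (X ^ 2 * R ^ 2) := by gcongr; exact hU j hj
    _ = _ := by rw [mul_pow, mul_pow, sq_abs]; ring

end ThinFilm

end

open ThinFilm in
theorem mainTheorem2 (L : Fin 2 → ℝ) (hL : ∀ j, 0 < L j)
    (k : ThinFilm.ESModel) (α p q χ γ ε : ℝ) (hα : 0 < α) (hp : 0 < p) (hpq : p < q)
    (hχ : ThinFilm.chiMin k α p q ≤ χ) (hγ : 0 ≤ γ) (hε : 0 < ε)
    (m₁ m₂ : ℕ) (hm₁ : 2 ≤ m₁) (hm₂ : 2 ≤ m₂) (R : ℝ) :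
    ∃ C : ℝ, 0 < C ∧
      ∀ (T : ℝ) (h₀ : ThinFilm.Sob L 2) (ζ h : ℝ → ThinFilm.L2 L),
        0 < T →
        ∫ x, ThinFilm.toL2 L h₀ x ∂(ThinFilm.cellMeasure L) = 0 →
        MemLp ζ 2 (volume.restrict (Ioo 0 T)) →
        (∀ᵐ t ∂volume.restrict (Ioo 0 T), ∫ x, ζ t x ∂(ThinFilm.cellMeasure L) = 0) →
        ThinFilm.IsWeakSolution L k α p q γ ε T (ThinFilm.toL2 L h₀) ζ h →
        ∀ (M N n : ℕ) (δt : ℝ) (ht htt : ℝ → ThinFilm.L2 L)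
          (ζd : ℕ → ThinFilm.SobDual L) (hN : ℕ → ThinFilm.Sob L 2),
          1 ≤ N → 1 ≤ n → n ≤ M → δt = T / M →
          -- the first and second time derivatives on `(0, t_n)` and the regularity assumptions
          ThinFilm.IsWeakTimeDeriv 0 (n * δt) h ht →
          ThinFilm.IsWeakTimeDeriv 0 (n * δt) ht htt →
          MemLp htt 2 (volume.restrict (Ioo 0 (n * δt))) →
          eLpNorm htt 2 (volume.restrict (Ioo 0 (n * δt))) ≤ ENNReal.ofReal R →
          ThinFilm.SobPathBound L m₁ 2 0 (n * δt) R ht →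
          ThinFilm.SobPathBound L m₂ ∞ 0 ((n - 1) * δt) R h →
          -- for `n = 1` the interval `(0, t_{n-1})` is empty: only the time `0` is left
          (n = 1 → ∃ w : ThinFilm.Sob L m₂,
            ThinFilm.toL2 L w = ThinFilm.toL2 L h₀ ∧ ‖w‖ ≤ R) →
          (∀ i : ℕ, 1 ≤ i → i ≤ n → ThinFilm.IsTimeValue L (n * δt) ζ (i * δt) (ζd i)) →
          ThinFilm.IsScheme L k α p q χ γ ε δt N n (ThinFilm.toL2 L h₀) ζd hN →
          ∀ i : ℕ, i ≤ n →
            ‖h (i * δt) - ThinFilm.toL2 L (hN i)‖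
              ≤ C * Real.exp (C * (n * δt)) *
                (δt + (N : ℝ) ^ (-(m₁ : ℤ)) + (N : ℝ) ^ (-((m₂ : ℤ) - 1))) := by
  obtain ⟨K, hK⟩ := exists_lipschitzWith_current k hα hp hpq
  have hq : 0 < q := hp.trans hpq
  have hχ0 : 0 ≤ χ := (chiMin_nonneg k hα hp hpq).trans hχ
  have hP0 := poincare_pos hL
  set Cp := poincare L with hCp
  -- a Lipschitz constant of the explicit form, enlarged by one to be positive
  set κ : ℝ := K + χ + 1 with hκ
  have hκ0 : 0 < κ := by positivity
  -- the weight left by Young's inequality when `‖∇η‖` is absorbed into `ε² ‖Δη‖²`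
  set B : ℝ := 2 * κ ^ 2 * Cp / ε ^ 2 with hB
  have hB0 : 0 < B := by positivity
  -- the constant of the interpolation `B ‖∇η‖² ≤ ε² ‖Δη‖² + A ‖η‖²`
  set A : ℝ := B ^ 2 / (4 * ε ^ 2) with hA
  have hA0 : 0 ≤ A := by positivity
  set κ₁ : ℝ := ‖(gradL L).comp (sobIncl L hm₁)‖ with hκ₁
  set Q : ℝ := 2 * B * κ₁ ^ 2 + 4 * B * Cp ^ (m₂ - 1) + 1 with hQ
  have hQ0 : 0 ≤ Q := by positivity
  set C₀ : ℝ := |R| * (√Q + √(Cp ^ m₂) + √(Cp ^ m₁)) with hC₀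
  have hC₀0 : 0 ≤ C₀ := by positivity
  refine ⟨C₀ + (2 + A), by positivity, ?_⟩
  intro T h₀ ζ h hT _ _ _ hsol M N n δ ht htt ζd hN hN1 hn hnM hδ h1 h2 htt2 httR hht hh hw hζd
    hscheme i hi
  have hM : (0 : ℝ) < M := by exact_mod_cast hn.trans hnM
  have hδ0 : 0 < δ := by rw [hδ]; exact div_pos hT hM
  have hn0 : (1 : ℝ) ≤ n := by exact_mod_cast hn
  set τ : ℝ := n * δ with hτ
  have hτ0 : 0 < τ := by positivity
  have hδτ : δ ≤ τ := le_mul_of_one_le_left hδ0.le hn0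
  have hτT : τ ≤ T := by
    have : (n : ℝ) ≤ M := by exact_mod_cast hnM
    calc τ ≤ M * δ := mul_le_mul_of_nonneg_right this hδ0.le
      _ = T := by rw [hδ]; field_simp
  have hmem : ∀ {j : ℕ}, j ≤ n → (j : ℝ) * δ ∈ Icc 0 τ := fun hj => grid_mem hδ0.le hj
  obtain ⟨U, hU, hUR⟩ := hht
  obtain ⟨H, V, hHc, hVc, hHh, hHd, hVd, hhd, heq⟩ :=
    exists_representatives hL hK hτ0 hτT hm₁ hsol h1 h2 hU
  obtain ⟨P, hP⟩ := exists_projSob hL N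
  have hh0 : h 0 = toL2 L h₀ := hsol.2.2
  have htails : ∀ j < n, _ := fun j hj => tail_bounds_on_grid hL hN1 hn (by omega) hP hδ0 hHc hHh
    hh (by rw [hh0]; exact hw) hj
  -- the discrete error at the time `t_j`
  set η : ℕ → Sob L 2 := fun j => P (h (j * δ)) - hN j with hη
  set d : ℕ → ℝ := fun j => ‖gradL L (H ((j + 1 : ℕ) * δ) - H (j * δ))‖ with hd
  set σ : ℕ → ℝ := fun j => ‖gradL L (H (j * δ) - P (h (j * δ)))‖ with hσ
  set r : ℕ → ℝ := fun j =>
    ‖V ((j + 1 : ℕ) * δ) - δ⁻¹ • (h ((j + 1 : ℕ) * δ) - h (j * δ))‖ with hr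
  set E : ℕ → ℝ := fun j => B * (δ * (d j + σ j) ^ 2) + (δ + δ ^ 2) * r j ^ 2 with hE
  have hE0 : ∀ j, 0 ≤ E j := fun j => by simp only [hE]; positivity
  have hgron : ‖toL2 L (η i)‖ ^ 2
      ≤ Real.exp ((1 + A) * δ * i) * ∑ j ∈ Finset.range i, E j := by
    refine (discrete_error_le (H := fun j => H (j * δ)) (P := fun j => P (h (j * δ)))
      (V := fun j => V (j * δ)) (z := ζd) hL hp hq hK hχ0 hγ hε hδ0 hκ hB hA
      (fun j hj => by rw [hP, hHh _ (hmem hj)]) (fun j hj φ => ?_) ?_ (fun j hj => ?_) hi).trans ?_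
    · obtain ⟨Z, hZc, hZ, hZt⟩ := hζd (j + 1) (by omega) hj
      rw [← hZt]
      exact heq Z hZc hZ _ (hmem hj) φ
    · refine toL2_injective hL 2 ?_
      rw [hP, hscheme.1, Nat.cast_zero, zero_mul, hh0]
    · exact hscheme.2 (j + 1) (by omega) hj
    · refine mul_le_mul_of_nonneg_left (Finset.sum_le_sum fun j hj => le_of_eq ?_)
        (Real.exp_pos _).le
      have hj' : j < n := (Finset.mem_range.1 hj).trans_le hi
      rw [hHh _ (hmem hj'), hHh _ (hmem hj'.le)]
  -- the local errors, step by step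
  set I : ℕ → ℝ := fun j => ∫ s in (j * δ)..((j + 1 : ℕ) * δ), ‖U s‖ ^ 2 with hI
  have hlen : ∀ j : ℕ, ((j + 1 : ℕ) : ℝ) * δ - j * δ = δ := fun j => by push_cast; ring
  have hlt : ∀ j : ℕ, (j : ℝ) * δ < ((j + 1 : ℕ) : ℝ) * δ := fun j => by linarith [hlen j]
  have hW : ∀ j < n, ‖∫ s in (j * δ)..((j + 1 : ℕ) * δ), U s‖ ^ 2 ≤ δ * I j := by
    intro j hj
    have := norm_sq_integral_le hτ0.le hU.1 (hmem hj.le) (hmem hj) (hlt j).le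
    rwa [hlen] at this
  have hdj : ∀ j < n, d j ^ 2 ≤ κ₁ ^ 2 * (δ * I j) := by
    intro j hj
    simp only [hd]
    rw [hHd _ (hmem hj.le) _ (hmem hj)]
    have := ((gradL L).comp (sobIncl L hm₁)).le_opNorm (∫ s in (j * δ)..((j + 1 : ℕ) * δ), U s)
    refine (pow_le_pow_left₀ (norm_nonneg _) this 2).trans ?_
    rw [mul_pow]
    exact mul_le_mul_of_nonneg_left (hW j hj) (sq_nonneg _)
  have hσj : ∀ j < n, σ j ^ 2 ≤ 2 * (Cp / N ^ 2) ^ (m₂ - 1) * R ^ 2 := by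
    intro j hj
    simp only [hσ]
    rw [norm_sq_gradL]
    exact (htails j hj).2
  have hrj : ∀ j < n, r j ^ 2
      ≤ δ * ∫ s in (j * δ)..((j + 1 : ℕ) * δ), ‖htt s‖ ^ 2 := by
    intro j hj
    have := norm_sq_sub_difference_quotient_le hτ0.le htt2 hVc hVd hhd (hmem hj.le) (hmem hj)
      (hlt j)
    rwa [hlen] at this
  have hIR : ∑ j ∈ Finset.range n, I j ≤ R ^ 2 :=
    sum_integral_le hτ0.le hU.1 hUR hδ0.le le_rfl
  have hsum := sum_local_error_le hB0.le hδ0.le hdj hσj hrj hIR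
    (sum_integral_le hτ0.le htt2 httR hδ0.le le_rfl)
  -- the powers of `N` in the statement are integer powers with negative exponents
  have hN0 : (0 : ℝ) < N := by exact_mod_cast hN1
  have hN1' : (1 : ℝ) ≤ N := by exact_mod_cast hN1
  set μ : ℝ := (N : ℝ) ^ (-(m₁ : ℤ)) with hμ
  set ν : ℝ := (N : ℝ) ^ (-((m₂ : ℤ) - 1)) with hν
  have hμ0 : 0 ≤ μ := by positivity
  have hν0 : 0 ≤ ν := by positivity
  have hμe : (N : ℝ)⁻¹ ^ m₁ = μ := by rw [hμ, zpow_neg, zpow_natCast, inv_pow]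
  have hνe : (N : ℝ)⁻¹ ^ (m₂ - 1) = ν := by
    have e : (m₂ : ℤ) - 1 = ((m₂ - 1 : ℕ) : ℤ) := by omega
    rw [hν, e, zpow_neg, zpow_natCast, inv_pow]
  have hνle : (N : ℝ)⁻¹ ^ m₂ ≤ ν := by
    rw [← hνe]
    exact pow_le_pow_of_le_one (by positivity) (inv_le_one_of_one_le₀ hN1') (Nat.sub_le _ _)
  set X : ℝ := Real.exp ((2 + A) * τ) with hX
  have hX1 : 1 ≤ X := Real.one_le_exp (by positivity)
  have hηi : ‖toL2 L (η i)‖ ≤ √Q * (|R| * X * (δ + ν)) := by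
    refine le_sqrt_mul_of_sq_le (by positivity) ?_
    have hSE : ∑ j ∈ Finset.range i, E j ≤ Q * (|R| * (δ + ν)) ^ 2 * (1 + τ) := by
      refine (Finset.sum_le_sum_of_subset_of_nonneg (Finset.range_subset_range.2 hi)
        fun j _ _ => hE0 j).trans (hsum.trans ?_)
      rw [poincare_div_pow, hνe, ← hτ]
      exact total_error_le hB0.le (by positivity) hδ0.le hν0 hδτ
    have hexp : Real.exp ((1 + A) * δ * i) * (1 + τ) ≤ X ^ 2 := by
      have hiδ : (1 + A) * δ * i ≤ (1 + A) * τ := by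
        rw [mul_assoc, mul_comm δ]
        exact mul_le_mul_of_nonneg_left (hmem hi).2 (by positivity)
      exact exp_mul_one_add_le hA0 hτ0.le hiδ
    calc _ ≤ _ := hgron
      _ ≤ Real.exp ((1 + A) * δ * i) * (Q * (|R| * (δ + ν)) ^ 2 * (1 + τ)) := by gcongr
      _ = Q * (|R| * (δ + ν)) ^ 2 * (Real.exp ((1 + A) * δ * i) * (1 + τ)) := by ring
      _ ≤ Q * (|R| * (δ + ν)) ^ 2 * X ^ 2 := by gcongr
      _ = _ := by ring
  have hI0 : ∀ l, 0 ≤ I l := fun l =>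
    intervalIntegral.integral_nonneg (hlt l).le fun _ _ => by positivity
  have hδX : δ ≤ X ^ 2 := by
    have := exp_mul_one_add_le hA0 hτ0.le (s := 0) (by positivity)
    rw [Real.exp_zero, one_mul] at this
    linarith
  have hρi := projection_error_le hL hN1 hm₁ hP (zero_le_one.trans hX1)
    (fun j hj => hHh _ (hmem hj)) (fun j hj => hHd _ (hmem hj.le) _ (hmem hj))
    (fun j hj => (hW j hj).trans (mul_le_mul hδX ((Finset.single_le_sum (fun l _ => hI0 l)
      (Finset.mem_range.2 hj)).trans hIR) (hI0 j) (sq_nonneg _)))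
    (fun j hj => (htails j hj).1) hn hi
  rw [← hCp, hμe] at hρi
  have hfinal : ‖h (i * δ) - toL2 L (hN i)‖ ≤ C₀ * X * (δ + μ + ν) := by
    have hsplit : h (i * δ) - toL2 L (hN i)
        = toL2 L (η i) + toL2 L (H (i * δ) - P (h (i * δ))) := by
      simp only [hη, map_sub, hHh _ (hmem hi)]
      abel
    rw [hsplit]
    refine (norm_add_le _ _).trans ((add_le_add hηi hρi).trans ?_)
    have hR0 := abs_nonneg R
    have b1 : √Q * (|R| * X * (δ + ν)) ≤ √Q * (|R| * X * (δ + μ + ν)) := by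
      gcongr
      linarith
    have hsum0 : ν ≤ δ + μ + ν := by linarith
    have b2 : √(Cp ^ m₂) * (|R| * (N : ℝ)⁻¹ ^ m₂) ≤ √(Cp ^ m₂) * (|R| * X * (δ + μ + ν)) := by
      gcongr
      · exact le_mul_of_one_le_right hR0 hX1
      · exact hνle.trans hsum0
    have b3 : √(Cp ^ m₁) * (|R| * X * μ) ≤ √(Cp ^ m₁) * (|R| * X * (δ + μ + ν)) := by
      gcongr
      linarith
    calc _ ≤ _ := add_le_add b1 (add_le_add b2 b3)
      _ = _ := by rw [hC₀]; ring
  have hle : X ≤ Real.exp ((C₀ + (2 + A)) * τ) :=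
    Real.exp_le_exp.2 (mul_le_mul_of_nonneg_right (by linarith) hτ0.le)
  refine hfinal.trans (mul_le_mul_of_nonneg_right ?_ (by positivity))
  exact mul_le_mul (by linarith) hle (Real.exp_pos _).le (by positivity)
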